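/- Let $m,n\in\mathbb N$, $1<q<n$, let $D\subset\mathbb R^n$ be open and bounded, and let $c_2\in\mathbb R$. A Borel function $f:\mathbb R^{m\times n}\to\mathbb R$ is called admissible if for some $c_1$ with $0<c_1<c_2$ we have $c_1(|\xi|^q-1)\le f(\xi)\le c_2(|\xi|^q+1)$ for all $\xi\in\mathbb R^{m\times n}$, where $|\cdot|$ is the Euclidean (Frobenius) norm. For $\varepsilon,M>0$, a set $\mathscr G\subset\mathbb R^n$ is called $(\varepsilon,M)$-good if $|x-y|\ge 2/M$ for all distinct $x,y\in\mathscr G$ and $\overline B_{\varepsilon/M}(\varepsilon x)\subset D$ for all $x\in\mathscr G$. For $\theta\in(0,1)$, $l\in\mathbb N_0$ and $x\in\mathbb R^n$ let $$C^l_{\varepsilon,\theta,M}(\varepsilon x)=\{y:\ 2^{-(l+1)}\theta\varepsilon/M<|y-\varepsilon x|<2^{-l}\theta\varepsilon/M\}.$$ There is a function $C:[0,\infty]\to(0,\infty)$, depending only on $c_2,n,m,q,D$, with the following property. Let $(u_j)_{j\in\mathbb N}\subset W^{1,q}_0(D;\mathbb R^m)$ and $u\in W^{1,q}_0(D;\mathbb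 R^m)$ be such that $u_j\rightharpoonup u$ weakly in $W^{1,q}(D;\mathbb R^m)$, and put $S=\sup_j\|\nabla u_j\|_{L^q(D)}$. Then $S<\infty$, and the following two statements hold. **(A)** Let $f$ be admissible, let $(\varepsilon_j)$ be a decreasing sequence of positive numbers converging to $0$, let $M>0$, $\theta\in(0,1)$, $k\in\mathbb N$, $k\ge1$, and let $\mathscr G_j$ be $(\varepsilon_j,M)$-good for every $j$. Then for every $j$ and $x\in\mathscr G_j$ there is $k_{j,x}\in\{0,\dots,k-1\}$, and there is a sequence $(w_j)\subset W^{1,q}_0(D;\mathbb R^m)$, such that (i) $w_j=u_j$ a.e. in $D\setminus\bigcup_{x\in\mathscr G_j}C^{k_{j,x}}_{\varepsilon_j,\theta,M}(\varepsilon_jx)$; (ii) for every $x\in\mathscr G_j$, $w_j=\bar u_{j,x}$ on $\partial B_{\bar\sigma_{j,x}}(\varepsilon_jx)$ in the sense of traces, where $\bar u_{j,x}$ is the mean value of $u_j$ over $C^{k_{j,x}}_{\varepsilon_j,\theta,M}(\varepsilon_jx)$ and $\bar\sigma_{j,x}=\frac34\,2^{-k_{j,x}}\,\theta\varepsilon_j/M$;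 (iii) $w_j\rightharpoonup u$ weakly in $W^{1,q}(D;\mathbb R^m)$; (iv) $\displaystyle\Big|\int_Df(\nabla w_j)\,dx-\int_Df(\nabla u_j)\,dx\Big|\le\frac{C(S)}k$ for every $j$; (v) if $(|\nabla u_j|^q)$ is equi-integrable, then so is $(|\nabla w_j|^q)$. **(B)** Suppose that $(|\nabla u_j|^q)$ is equi-integrable. Then there are constants $C_k>0$, $k\in\mathbb N$ (which may blow up as $k\to\infty$, and which may depend on the sequence $(u_j)$ and on $c_2,n,m,q,D$, but not on $f,(\varepsilon_j),M,\theta,(\mathscr G_j)$), such that for all $f,(\varepsilon_j),M,\theta,k,(\mathscr G_j)$ as in (A) there is a sequence $(w_j)\subset W^{1,q}_0(D;\mathbb R^m)$ that satisfies (i)–(iii) with $k_{j,x}=0$ for all $j$ and all $x\in\mathscr G_j$, for which $(|\nabla w_j|^q)$ is equi-integrable, and for every $j$ $$\Big|\int_Df(\nabla w_j)\,dx-\int_Df(\nabla u_j)\,dx\Big|\le C_k\theta^n+\frac{C(S)}k .$$ -/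

import Mathlib

open MeasureTheory Filter Topology Set
open scoped ENNReal NNReal ContDiff

namespace JoiningLemma

/-- `ℝⁿ` with its Euclidean norm. -/
abbrev Vec (n : ℕ) : Type := EuclideanSpace ℝ (Fin n)

/-- `ℝ^{m × n}` with its Euclidean (Frobenius) norm; the entry `(i, a)` sits in row `i` and
column `a`. -/
abbrev Mat (m n : ℕ) : Type := EuclideanSpace ℝ (Fin m × Fin n)

/-- The classical gradient of `φ : ℝⁿ → ℝᵐ`, with entries `∂ₐ φᵢ`. -/
noncomputable def classicalGrad {n m : ℕ} (φ : Vec n → Vec m) (x : Vec n) : Mat m n :=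
  WithLp.toLp 2 fun ia => fderiv ℝ φ x (EuclideanSpace.single ia.2 1) ia.1

/-- `G` is a weak (distributional) gradient of `u` in the open set `D`. -/
structure HasWeakGrad {n m : ℕ} (D : Set (Vec n)) (u : Vec n → Vec m) (G : Vec n → Mat m n) :
    Prop where
  locallyIntegrableOn : LocallyIntegrableOn u D volume
  locallyIntegrableOn_grad : LocallyIntegrableOn G D volume
  integral_eq : ∀ φ : Vec n → ℝ, ContDiff ℝ ∞ φ → HasCompactSupport φ → tsupport φ ⊆ D →
    ∀ (i : Fin m) (a : Fin n),
      ∫ x in D, u x i * fderiv ℝ φ x (EuclideanSpace.single a 1) =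
        -∫ x in D, G x (i, a) * φ x

open Classical in
/-- The weak gradient `∇u` in `D`; it is determined up to a null set of `D` when it exists, and it
is set to `0` when it does not exist. -/
noncomputable def weakGrad {n m : ℕ} (D : Set (Vec n)) (u : Vec n → Vec m) : Vec n → Mat m n :=
  if h : ∃ G, HasWeakGrad D u G then h.choose else 0

/-- `u ∈ W₀^{1,q}(D; ℝᵐ)`: `u` and its weak gradient belong to `L^q(D)`, and `u` is the limit, in
the norm of `W^{1,q}`, of smooth maps with compact support in `D`. -/
def MemW01 {n m : ℕ} (q : ℝ) (D : Set (Vec n)) (u : Vec n → Vec m) : Prop :=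
  MemLp u (ENNReal.ofReal q) (volume.restrict D) ∧
  ∃ G : Vec n → Mat m n, HasWeakGrad D u G ∧
    MemLp G (ENNReal.ofReal q) (volume.restrict D) ∧
    ∃ φ : ℕ → Vec n → Vec m,
      (∀ l, ContDiff ℝ ∞ (φ l) ∧ HasCompactSupport (φ l) ∧ tsupport (φ l) ⊆ D) ∧
      Tendsto (fun l => eLpNorm (fun x => φ l x - u x) (ENNReal.ofReal q) (volume.restrict D))
        atTop (𝓝 0) ∧
      Tendsto (fun l => eLpNorm (fun x => classicalGrad (φ l) x - G x) (ENNReal.ofReal q)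
        (volume.restrict D)) atTop (𝓝 0)

/-- Weak convergence in `L^q(D; V)`, `1 < q < ∞`, tested against `L^{q'}(D; V)` with
`q' = q / (q - 1)`. -/
def WeakTendstoLp {n : ℕ} {V : Type*} [NormedAddCommGroup V] [InnerProductSpace ℝ V] (q : ℝ)
    (D : Set (Vec n)) (v : ℕ → Vec n → V) (v₀ : Vec n → V) : Prop :=
  ∀ φ : Vec n → V, MemLp φ (ENNReal.ofReal (q / (q - 1))) (volume.restrict D) →
    Tendsto (fun j => ∫ x in D, inner ℝ (v j x) (φ x)) atTop
      (𝓝 (∫ x in D, inner ℝ (v₀ x) (φ x)))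

/-- Weak convergence in `W^{1,q}(D; ℝᵐ)`: the maps and their weak gradients converge weakly
in `L^q(D)`. -/
def WeakTendstoW1 {n m : ℕ} (q : ℝ) (D : Set (Vec n)) (v : ℕ → Vec n → Vec m)
    (v₀ : Vec n → Vec m) : Prop :=
  WeakTendstoLp q D v v₀ ∧
    WeakTendstoLp q D (fun j => weakGrad D (v j)) (weakGrad D v₀)

/-- `sup_j ‖∇u_j‖_{L^q(D)}`. -/
noncomputable def supGradNorm {n m : ℕ} (q : ℝ) (D : Set (Vec n)) (u : ℕ → Vec n → Vec m) :
    ℝ≥0∞ :=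
  ⨆ j, eLpNorm (weakGrad D (u j)) (ENNReal.ofReal q) (volume.restrict D)

/-- The sequence `(|∇u_j|^q)` is equi-integrable on `D`. -/
def EquiIntegrableGrad {n m : ℕ} (q : ℝ) (D : Set (Vec n)) (u : ℕ → Vec n → Vec m) : Prop :=
  UnifIntegrable (fun j x => ‖weakGrad D (u j) x‖ ^ q) 1 (volume.restrict D)

/-- The energy `∫_D f(∇u) dx`. -/
noncomputable def energy {n m : ℕ} (f : Mat m n → ℝ) (D : Set (Vec n)) (u : Vec n → Vec m) : ℝ :=
  ∫ x in D, f (weakGrad D u x)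

/-- `f` is Borel measurable with growth of order `q` and constants `0 < c₁ < c₂`. -/
structure HasGrowth {m n : ℕ} (q c₁ c₂ : ℝ) (f : Mat m n → ℝ) : Prop where
  measurable : Measurable f
  pos : 0 < c₁
  lt : c₁ < c₂
  lower : ∀ ξ, c₁ * (‖ξ‖ ^ q - 1) ≤ f ξ
  upper : ∀ ξ, f ξ ≤ c₂ * (‖ξ‖ ^ q + 1)

/-- The two properties of the centres of the good perforations: they are `2/M`-separated, and the
closed balls of radius `ε/M` around the rescaled centres lie in `D`. -/
structure GoodCentres {n : ℕ} (D : Set (Vec n)) (ε M : ℝ) (G : Set (Vec n)) : Prop where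
  separated : ∀ x ∈ G, ∀ y ∈ G, x ≠ y → 2 / M ≤ ‖x - y‖
  closedBall_subset : ∀ x ∈ G, Metric.closedBall (ε • x) (ε / M) ⊆ D

/-- The open dyadic annulus `{2^{-(l+1)} θ ε / M < |y - ε x| < 2^{-l} θ ε / M}`. -/
def annulus {n : ℕ} (ε θ M : ℝ) (l : ℕ) (x : Vec n) : Set (Vec n) :=
  {y | (2 ^ (l + 1))⁻¹ * (θ * ε / M) < ‖y - ε • x‖ ∧ ‖y - ε • x‖ < (2 ^ l)⁻¹ * (θ * ε / M)}

/-- The radius `(3/4) 2^{-l} θ ε / M` of the intermediate sphere of the annulus. -/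
noncomputable def midRadius (ε θ M : ℝ) (l : ℕ) : ℝ :=
  3 / 4 * (2 ^ l)⁻¹ * (θ * ε / M)

/-- `w` equals the constant `c` on the sphere `∂B_r(y)` in the sense of traces: the difference
`w - c` has zero trace on `∂B_r(y)`, that is, `w - c ∈ W₀^{1,q}(B_r(y); ℝᵐ)`. For `w` of class
`W^{1,q}` near the sphere, the traces from the two sides of the sphere agree. -/
def EqConstOnSphere {n m : ℕ} (q : ℝ) (w : Vec n → Vec m) (c : Vec m) (y : Vec n) (r : ℝ) :
    Prop :=
  MemW01 q (Metric.ball y r) (fun x => w x - c)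

/-- `(w_j) ⊆ W₀^{1,q}(D; ℝᵐ)` converges weakly to `u₀` in `W^{1,q}`, agrees with `u_j` outside the
annuli of index `κ j x` around the points `ε_j x`, `x ∈ G_j`, and, on the intermediate
sphere of each of these annuli, equals the mean of `u_j` over the annulus. -/
structure IsModification {n m : ℕ} (q : ℝ) (D : Set (Vec n)) (ε : ℕ → ℝ) (θ M : ℝ)
    (G : ℕ → Set (Vec n)) (κ : ℕ → Vec n → ℕ) (u : ℕ → Vec n → Vec m) (u₀ : Vec n → Vec m)
    (w : ℕ → Vec n → Vec m) : Prop where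
  mem : ∀ j, MemW01 q D (w j)
  eq_off : ∀ j, ∀ᵐ y ∂(volume.restrict D),
    y ∉ ⋃ x ∈ G j, annulus (ε j) θ M (κ j x) x → w j y = u j y
  eq_on_sphere : ∀ j, ∀ x ∈ G j,
    EqConstOnSphere q (w j) (⨍ y in annulus (ε j) θ M (κ j x) x, u j y)
      (ε j • x) (midRadius (ε j) θ M (κ j x))
  weakTendsto : WeakTendstoW1 q D w u₀

end JoiningLemma

open JoiningLemma

/-! # Joining maps to constants in annuli around perforations

Near each centre `a = ε_j x` the map `u = u_j` is modified in one dyadic annulus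
`{ρ/2 < |y - a| < ρ}`: with a smooth cutoff function `φ`, compactly supported in the annulus and
equal to `1` near the sphere of radius `3ρ/4`, and with the mean `c` of `u` over the annulus, put
`w = u + φ (c - u)`. All centres are treated at once by `correction`, the sum of the maps
`φ (c - u)`; the good balls are disjoint and of equal volume in the bounded set `D`, so there are
finitely many of them.

*Estimates.* Since `|∇φ| ≤ const / ρ`, the gradient `-φ ∇u + (c - u) ⊗ ∇φ` of the correction is
controlled by `|∇u|` and by the Poincaré–Wirtinger inequality in the annulus. That inequality is
proved (`exists_poincare`) by covering the annulus with caps `{|p| < 1, ± pᵢ > 2⁻⁽ⁿ⁺¹⁾}`. They are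
convex, so that differences of smooth maps can be integrated along segments
(`lintegral_sub_rpow_le_of_convex`), and for `n ≥ 2` any two of them are joined through overlaps.
The caps reach inwards beyond the annulus, so the right-hand side is the gradient in a wider
annulus `wideRing`, still contained in the ball. The inequality is localized: if `u - c` is
integrated only over a subset `E` of the annulus, there is an extra factor `τ + |E| / (ρ τ)ⁿ`, with
`τ ∈ (0, 1]` free.

*Energy.* The growth of `f` and the Poincaré inequality bound the change of the energy by a
constant times `|U| + ∫_U |∇u|^q`, where `U` is the union of the wide annuli
(`enorm_energy_sub_le`). A point lies in at most `n + 1` of the wide dyadic annuli of a ball, so by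
the pigeonhole principle one of the first `k` of them carries at most the fraction `(n + 1) / k` of
`1 + |∇u|^q` in the ball; summing over the balls gives the bound `C(S) / k`
(`exists_index_sum_le`). With the index `0` throughout, `|U|` is at most `θⁿ |D|`. If this is below
the threshold `δ_k` at which equi-integrability makes `∫_U |∇u|^q ≤ 1 / k`, the bound is clear;
otherwise `∫_U |∇u|^q ≤ S^q ≤ S^q θⁿ |D| / δ_k` (`abs_le_add_joiningConst_div`).

*Equi-integrability.* To estimate the gradient of the correction in a set `E`, the annuli are split
into those in which `E` has measure at most `τⁿ⁺¹ ρⁿ`, where the localized Poincaré inequality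
gains the factor `2τ`, and the others, whose union has measure at most a constant times
`|E| / τⁿ⁺¹` (`HasCorrectionBounds`).

*Weak convergence.* By the Poincaré inequality the corrections tend to `0` in `L^q`, as the radii
do, and their gradients are bounded in `L^q` because weakly convergent sequences are bounded.
Bounded gradients of maps that tend to `0` converge weakly to `0`, by integration by parts against
a dense set of test functions (`weakTendstoLp_grad_zero`). -/

namespace JoiningLemma

variable {n m : ℕ}

/-! ### Gradients of smooth maps -/

/-- The operator norm of a linear map is at most the Frobenius norm of its matrix. -/
lemma norm_fderiv_apply_le (φ : Vec n → Vec m) (x v : Vec n) :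
    ‖fderiv ℝ φ x v‖ ≤ ‖classicalGrad φ x‖ * ‖v‖ := by
  have hv : v = ∑ a, v a • EuclideanSpace.single a (1 : ℝ) := by
    ext b
    simp [Pi.single_apply]
  have hcoord : ∀ i, fderiv ℝ φ x v i = ∑ a, v a * classicalGrad φ x (i, a) := by
    intro i
    conv_lhs => rw [hv]
    simp [classicalGrad]
  rw [EuclideanSpace.norm_eq, EuclideanSpace.norm_eq (classicalGrad φ x), EuclideanSpace.norm_eq v,
    ← Real.sqrt_mul (by positivity)]
  apply Real.sqrt_le_sqrt
  rw [Fintype.sum_prod_type, Finset.sum_mul]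
  refine Finset.sum_le_sum fun i _ => ?_
  rw [hcoord i]
  simp only [Real.norm_eq_abs, sq_abs]
  rw [mul_comm]
  exact Finset.sum_mul_sq_le_sq_mul_sq _ _ _

/-- The tensor product `v ⊗ z`, with entries `vᵢ zₐ`, of a value and a direction. -/
noncomputable def outer (v : Vec m) (z : Vec n) : Mat m n :=
  WithLp.toLp 2 fun ia => v ia.1 * z ia.2

@[simp] lemma outer_apply (v : Vec m) (z : Vec n) (ia : Fin m × Fin n) :
    outer v z ia = v ia.1 * z ia.2 := rfl

@[simp] lemma classicalGrad_apply (φ : Vec n → Vec m) (x : Vec n) (ia : Fin m × Fin n) :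
    classicalGrad φ x ia = fderiv ℝ φ x (EuclideanSpace.single ia.2 1) ia.1 := rfl

lemma norm_outer (v : Vec m) (z : Vec n) : ‖outer v z‖ = ‖v‖ * ‖z‖ := by
  rw [EuclideanSpace.norm_eq, EuclideanSpace.norm_eq v, EuclideanSpace.norm_eq z,
    ← Real.sqrt_mul (by positivity), Fintype.sum_prod_type, Finset.sum_mul_sum]
  simp [mul_pow]

@[simp] lemma outer_zero_right (v : Vec m) : outer v (0 : Vec n) = 0 := by
  ext ia; simp

lemma outer_sub_left (v v' : Vec m) (z : Vec n) : outer (v - v') z = outer v z - outer v' z := by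
  ext ia; simp [sub_mul]

@[fun_prop]
lemma continuous_outer : Continuous fun p : Vec m × Vec n => outer p.1 p.2 := by
  unfold outer
  fun_prop

/-- The gradient of a scalar function as a vector of partial derivatives. -/
noncomputable def partials (ζ : Vec n → ℝ) (x : Vec n) : Vec n :=
  WithLp.toLp 2 fun a => fderiv ℝ ζ x (EuclideanSpace.single a 1)

@[simp] lemma partials_apply (ζ : Vec n → ℝ) (x : Vec n) (a : Fin n) :
    partials ζ x a = fderiv ℝ ζ x (EuclideanSpace.single a 1) := rfl

lemma continuous_partials {ζ : Vec n → ℝ} (hζ : ContDiff ℝ ∞ ζ) : Continuous (partials ζ) := by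
  have := hζ.continuous_fderiv (by simp)
  unfold partials
  fun_prop

lemma continuous_classicalGrad {φ : Vec n → Vec m} (hφ : ContDiff ℝ ∞ φ) :
    Continuous (classicalGrad φ) := by
  have := hφ.continuous_fderiv (by simp)
  unfold classicalGrad
  fun_prop

lemma classicalGrad_add {φ ψ : Vec n → Vec m} {x : Vec n} (hφ : DifferentiableAt ℝ φ x)
    (hψ : DifferentiableAt ℝ ψ x) :
    classicalGrad (fun y => φ y + ψ y) x = classicalGrad φ x + classicalGrad ψ x := by
  ext ia
  simp [fderiv_fun_add hφ hψ]

lemma classicalGrad_smul {ζ : Vec n → ℝ} {φ : Vec n → Vec m} {x : Vec n}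
    (hζ : DifferentiableAt ℝ ζ x) (hφ : DifferentiableAt ℝ φ x) :
    classicalGrad (fun y => ζ y • φ y) x =
      ζ x • classicalGrad φ x + outer (φ x) (partials ζ x) := by
  ext ia
  simp [fderiv_fun_smul hζ hφ, mul_comm]

lemma tsupport_classicalGrad_subset (φ : Vec n → Vec m) :
    tsupport (classicalGrad φ) ⊆ tsupport φ := by
  refine closure_minimal ?_ (isClosed_tsupport _)
  intro x hx
  by_contra h
  apply hx
  have : fderiv ℝ φ x = 0 := by
    by_contra h'
    exact h (support_fderiv_subset ℝ h')
  ext ia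
  simp [this]

lemma hasCompactSupport_classicalGrad {φ : Vec n → Vec m} (hφ : HasCompactSupport φ) :
    HasCompactSupport (classicalGrad φ) :=
  hφ.mono' ((subset_tsupport _).trans (tsupport_classicalGrad_subset φ))

/-- Integration by parts for smooth maps, one of which has compact support. -/
lemma integral_coord_mul_fderiv {φ : Vec n → Vec m} {ψ : Vec n → ℝ} (hφ : ContDiff ℝ ∞ φ)
    (hφc : HasCompactSupport φ) (hψ : ContDiff ℝ ∞ ψ) (i : Fin m) (a : Fin n) :
    ∫ x, φ x i * fderiv ℝ ψ x (EuclideanSpace.single a 1) =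
      -∫ x, classicalGrad φ x (i, a) * ψ x := by
  have hφi : ContDiff ℝ ∞ (fun x => φ x i) := by
    have := contDiff_euclidean.1 hφ i
    exact this
  have hφci : HasCompactSupport (fun x => φ x i) :=
    hφc.mono fun x hx h => hx (by simp [h])
  have hder : ∀ x, classicalGrad φ x (i, a) =
      fderiv ℝ (fun x => φ x i) x (EuclideanSpace.single a 1) := by
    intro x
    have h1 : DifferentiableAt ℝ φ x := (hφ.differentiable (by simp)) x
    have h2 := ((EuclideanSpace.proj i : Vec m →L[ℝ] ℝ).hasFDerivAt.comp x h1.hasFDerivAt).fderiv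
    have h3 : (fun x => φ x i) = (EuclideanSpace.proj i : Vec m →L[ℝ] ℝ) ∘ φ := rfl
    rw [h3, h2]
    simp
  simp_rw [hder]
  have hcψ := hψ.continuous_fderiv (by simp)
  have hcφ := hφi.continuous_fderiv (by simp)
  have hc1 := hφi.continuous
  have hc2 := hψ.continuous
  have hgc : HasCompactSupport
      (fun x => fderiv ℝ (fun x => φ x i) x (EuclideanSpace.single a 1)) := by
    have := hφci.fderiv (𝕜 := ℝ)
    exact this.mono fun x hx h => hx (by simp [h])
  apply integral_mul_fderiv_eq_neg_fderiv_mul_of_integrable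
  · exact Continuous.integrable_of_hasCompactSupport (by fun_prop) hgc.mul_right
  · exact Continuous.integrable_of_hasCompactSupport (by fun_prop) hφci.mul_right
  · exact Continuous.integrable_of_hasCompactSupport (by fun_prop) hφci.mul_right
  · exact fun x _ => (hφi.differentiable (by simp)) x
  · exact fun x _ => (hψ.differentiable (by simp)) x

/-! ### Hölder's inequality for pairings -/

section Pairing

variable {α V : Type*} [MeasurableSpace α] {μ : Measure α} [NormedAddCommGroup V]
  [InnerProductSpace ℝ V] {q : ℝ}

lemma one_le_ofReal {q : ℝ} (hq : 1 < q) : 1 ≤ ENNReal.ofReal q := by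
  simpa using ENNReal.ofReal_le_ofReal hq.le

lemma holderConjugate_ofReal (hq : 1 < q) :
    (ENNReal.ofReal q).HolderConjugate (ENNReal.ofReal (q / (q - 1))) :=
  (Real.HolderConjugate.conjExponent hq).ennrealOfReal

lemma enorm_integral_inner_le (hq : 1 < q) {f g : α → V} (hf : AEStronglyMeasurable f μ)
    (hg : AEStronglyMeasurable g μ) :
    ‖∫ x, inner ℝ (f x) (g x) ∂μ‖ₑ ≤
      eLpNorm f (ENNReal.ofReal q) μ * eLpNorm g (ENNReal.ofReal (q / (q - 1))) μ := by
  have := holderConjugate_ofReal hq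
  refine (enorm_integral_le_lintegral_enorm _).trans ?_
  rw [← eLpNorm_one_eq_lintegral_enorm]
  have h := eLpNorm_le_eLpNorm_mul_eLpNorm_of_nnnorm (r := 1) (p := ENNReal.ofReal q)
    (q := ENNReal.ofReal (q / (q - 1))) hf hg (fun a b => inner ℝ a b) 1
    (Eventually.of_forall fun x => by simpa using nnnorm_inner_le_nnnorm (𝕜 := ℝ) (f x) (g x))
  simpa using h

lemma integrable_inner_of_memLp (hq : 1 < q) {f g : α → V} (hf : MemLp f (ENNReal.ofReal q) μ)
    (hg : MemLp g (ENNReal.ofReal (q / (q - 1))) μ) :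
    Integrable (fun x => inner ℝ (f x) (g x)) μ := by
  have := holderConjugate_ofReal hq
  rw [← memLp_one_iff_integrable]
  exact MemLp.of_bilin (fun a b => inner ℝ a b) 1 hf hg (hf.1.inner hg.1)
    (Eventually.of_forall fun x => by simpa using nnnorm_inner_le_nnnorm (𝕜 := ℝ) (f x) (g x))

/-- Strong convergence in `L^q` passes to the limit in the pairing with `L^{q'}`. -/
lemma tendsto_integral_inner (hq : 1 < q) {f : ℕ → α → V} {f₀ g : α → V}
    (hf : ∀ l, MemLp (f l) (ENNReal.ofReal q) μ) (hf₀ : MemLp f₀ (ENNReal.ofReal q) μ)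
    (hg : MemLp g (ENNReal.ofReal (q / (q - 1))) μ)
    (h : Tendsto (fun l => eLpNorm (fun x => f l x - f₀ x) (ENNReal.ofReal q) μ) atTop (𝓝 0)) :
    Tendsto (fun l => ∫ x, inner ℝ (f l x) (g x) ∂μ) atTop (𝓝 (∫ x, inner ℝ (f₀ x) (g x) ∂μ)) := by
  rw [tendsto_iff_edist_tendsto_0]
  have hlim : Tendsto (fun l => eLpNorm (fun x => f l x - f₀ x) (ENNReal.ofReal q) μ *
      eLpNorm g (ENNReal.ofReal (q / (q - 1))) μ) atTop (𝓝 0) := by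
    simpa using ENNReal.Tendsto.mul_const h (Or.inr hg.eLpNorm_ne_top)
  refine tendsto_of_tendsto_of_tendsto_of_le_of_le tendsto_const_nhds hlim
    (fun _ => zero_le) fun l => ?_
  have : edist (∫ x, inner ℝ (f l x) (g x) ∂μ) (∫ x, inner ℝ (f₀ x) (g x) ∂μ) =
      ‖∫ x, inner ℝ (f l x - f₀ x) (g x) ∂μ‖ₑ := by
    rw [edist_eq_enorm_sub, ← integral_sub (integrable_inner_of_memLp hq (hf l) hg)
      (integrable_inner_of_memLp hq hf₀ hg)]
    simp_rw [inner_sub_left]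
  rw [this]
  exact enorm_integral_inner_le hq ((hf l).1.sub hf₀.1) hg.1

end Pairing

/-! ### Sobolev maps with zero boundary values -/

/-- `G` is a weak gradient of `u ∈ W₀^{1,q}(D; ℝᵐ)`, stated as: the pair `(u, G)` is the limit
in `L^q(D) × L^q(D)` of pairs `(φ_l, ∇φ_l)` with `φ_l` smooth and compactly supported in `D`. -/
structure IsW01Pair (q : ℝ) (D : Set (Vec n)) (u : Vec n → Vec m) (G : Vec n → Mat m n) :
    Prop where
  memLp : MemLp u (ENNReal.ofReal q) (volume.restrict D)
  memLp_grad : MemLp G (ENNReal.ofReal q) (volume.restrict D)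
  approx : ∃ φ : ℕ → Vec n → Vec m,
      (∀ l, ContDiff ℝ ∞ (φ l) ∧ HasCompactSupport (φ l) ∧ tsupport (φ l) ⊆ D) ∧
      Tendsto (fun l => eLpNorm (fun x => φ l x - u x) (ENNReal.ofReal q) (volume.restrict D))
        atTop (𝓝 0) ∧
      Tendsto (fun l => eLpNorm (fun x => classicalGrad (φ l) x - G x) (ENNReal.ofReal q)
        (volume.restrict D)) atTop (𝓝 0)

lemma locallyIntegrableOn_of_memLp {E : Type*} [NormedAddCommGroup E] {p : ℝ≥0∞} (hp : 1 ≤ p)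
    {D : Set (Vec n)} {u : Vec n → E} (hu : MemLp u p (volume.restrict D)) :
    LocallyIntegrableOn u D volume :=
  locallyIntegrableOn_of_locallyIntegrable_restrict (hu.locallyIntegrable hp)

lemma eq_zero_of_tsupport_subset {D : Set (Vec n)} {E : Type*} [NormedAddCommGroup E]
    {φ : Vec n → E} (h : tsupport φ ⊆ D) {x : Vec n} (hx : x ∉ D) : φ x = 0 := by
  by_contra h'
  exact hx (h (subset_tsupport _ h'))

lemma continuous_euclideanSpace_single {ι : Type*} [Fintype ι] [DecidableEq ι]
    {f : Vec n → ℝ} (hf : Continuous f) (i : ι) :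
    Continuous fun x => EuclideanSpace.single i (f x) := by
  have : (fun x => EuclideanSpace.single i (f x)) =
      fun x => f x • EuclideanSpace.single i (1 : ℝ) := by
    funext x
    ext j
    simp
  rw [this]
  exact hf.smul continuous_const

namespace IsW01Pair

variable {q : ℝ} {D : Set (Vec n)} {u : Vec n → Vec m} {G : Vec n → Mat m n}

/-- Integration by parts against a smooth function that need not vanish outside `D`. -/
lemma integral_eq_of_hasCompactSupport (hq : 1 < q) (h : IsW01Pair q D u G)
    {ψ : Vec n → ℝ} (hψ : ContDiff ℝ ∞ ψ) (hψc : HasCompactSupport ψ) (i : Fin m) (a : Fin n) :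
    ∫ x in D, u x i * fderiv ℝ ψ x (EuclideanSpace.single a 1) = -∫ x in D, G x (i, a) * ψ x := by
  obtain ⟨φ, hφ, hφu, hφG⟩ := h.approx
  have hsm : ∀ l, Continuous (φ l) := fun l => (hφ l).1.continuous
  have hmem : ∀ l, MemLp (φ l) (ENNReal.ofReal q) (volume.restrict D) := fun l =>
    ((hsm l).memLp_of_hasCompactSupport (hφ l).2.1).restrict D
  have hmem' : ∀ l, MemLp (classicalGrad (φ l)) (ENNReal.ofReal q) (volume.restrict D) := fun l =>
    ((continuous_classicalGrad (hφ l).1).memLp_of_hasCompactSupport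
      (hasCompactSupport_classicalGrad (hφ l).2.1)).restrict D
  have hψ1 : Continuous (fun x => fderiv ℝ ψ x (EuclideanSpace.single a 1)) := by
    have := hψ.continuous_fderiv (by simp)
    fun_prop
  have hψ1c : HasCompactSupport (fun x => fderiv ℝ ψ x (EuclideanSpace.single a 1)) :=
    (hψc.fderiv (𝕜 := ℝ)).mono fun x hx h => hx (by simp [h])
  have hg1 : MemLp (fun x => EuclideanSpace.single i (fderiv ℝ ψ x (EuclideanSpace.single a 1)))
      (ENNReal.ofReal (q / (q - 1))) (volume.restrict D) := by
    refine MemLp.restrict D (Continuous.memLp_of_hasCompactSupport ?_ ?_)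
    · exact continuous_euclideanSpace_single hψ1 i
    · exact hψ1c.mono fun x hx h => hx (by simp [h])
  have hg2 : MemLp (fun x => EuclideanSpace.single (i, a) (ψ x))
      (ENNReal.ofReal (q / (q - 1))) (volume.restrict D) := by
    refine MemLp.restrict D (Continuous.memLp_of_hasCompactSupport ?_ ?_)
    · exact continuous_euclideanSpace_single hψ.continuous (i, a)
    · exact hψc.mono fun x hx h => hx (by simp [h])
  have t1 := tendsto_integral_inner hq hmem h.memLp hg1 hφu
  have t2 := tendsto_integral_inner hq hmem' h.memLp_grad hg2 hφG
  simp only [EuclideanSpace.inner_single_right, conj_trivial] at t1 t2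
  have heq : ∀ l, ∫ x in D, fderiv ℝ ψ x (EuclideanSpace.single a 1) * φ l x i =
      -∫ x in D, ψ x * classicalGrad (φ l) x (i, a) := by
    intro l
    rw [setIntegral_eq_integral_of_forall_compl_eq_zero,
      setIntegral_eq_integral_of_forall_compl_eq_zero]
    · simpa only [mul_comm] using integral_coord_mul_fderiv (hφ l).1 (hφ l).2.1 hψ i a
    · intro x hx
      have := eq_zero_of_tsupport_subset ((tsupport_classicalGrad_subset _).trans (hφ l).2.2) hx
      rw [this]; simp
    · intro x hx
      have := eq_zero_of_tsupport_subset (hφ l).2.2 hx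
      rw [this]; simp
  simp_rw [heq] at t1
  have := tendsto_nhds_unique t1 t2.neg
  simpa only [mul_comm] using this

lemma hasWeakGrad (hq : 1 < q) (h : IsW01Pair q D u G) : HasWeakGrad D u G where
  locallyIntegrableOn := locallyIntegrableOn_of_memLp (one_le_ofReal hq) h.memLp
  locallyIntegrableOn_grad := locallyIntegrableOn_of_memLp (one_le_ofReal hq) h.memLp_grad
  integral_eq _ hφ hφc _ i a := h.integral_eq_of_hasCompactSupport hq hφ hφc i a

lemma memW01 (hq : 1 < q) (h : IsW01Pair q D u G) : MemW01 q D u :=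
  ⟨h.memLp, G, h.hasWeakGrad hq, h.memLp_grad, h.approx⟩

lemma congr {u' : Vec n → Vec m} {G' : Vec n → Mat m n} (h : IsW01Pair q D u G)
    (hu : u =ᵐ[volume.restrict D] u') (hG : G =ᵐ[volume.restrict D] G') :
    IsW01Pair q D u' G' := by
  obtain ⟨φ, hφ, hφu, hφG⟩ := h.approx
  refine ⟨h.memLp.ae_eq hu, h.memLp_grad.ae_eq hG, φ, hφ, hφu.congr fun l => ?_,
    hφG.congr fun l => ?_⟩
  · refine eLpNorm_congr_ae ?_
    filter_upwards [hu] with x hx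
    rw [hx]
  · refine eLpNorm_congr_ae ?_
    filter_upwards [hG] with x hx
    rw [hx]

end IsW01Pair

/-- Two weak gradients of the same map agree almost everywhere. -/
lemma HasWeakGrad.ae_eq {D : Set (Vec n)} (hD : IsOpen D) {u : Vec n → Vec m}
    {G G' : Vec n → Mat m n} (h : HasWeakGrad D u G) (h' : HasWeakGrad D u G') :
    G =ᵐ[volume.restrict D] G' := by
  have key : ∀ ia : Fin m × Fin n, ∀ᵐ x ∂(volume : Measure (Vec n)), x ∈ D →
      G x ia - G' x ia = 0 := by
    rintro ⟨i, a⟩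
    have hl : ∀ {H : Vec n → Mat m n}, LocallyIntegrableOn H D volume →
        LocallyIntegrableOn (fun x => H x (i, a)) D volume := by
      intro H hH x hx
      obtain ⟨s, hs, hint⟩ := hH x hx
      exact ⟨s, hs, (EuclideanSpace.proj (i, a) : Mat m n →L[ℝ] ℝ).integrable_comp hint⟩
    have hl1 := hl h.locallyIntegrableOn_grad
    have hl2 := hl h'.locallyIntegrableOn_grad
    refine hD.ae_eq_zero_of_integral_contDiff_smul_eq_zero (hl1.sub hl2) ?_
    intro g hg hgc hgD
    have hi : ∀ {H : Vec n → ℝ}, LocallyIntegrableOn H D volume →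
        IntegrableOn (fun x => H x * g x) D volume := by
      intro H hH
      have hK : IntegrableOn H (tsupport g) volume :=
        hH.integrableOn_compact_subset hgD hgc
      have : IntegrableOn (fun x => H x * g x) (tsupport g) volume :=
        hK.mul_continuousOn hg.continuous.continuousOn hgc
      refine this.of_forall_sdiff_eq_zero hD.measurableSet ?_
      intro x hx
      rw [image_eq_zero_of_notMem_tsupport hx.2, mul_zero]
    have e1 := h.integral_eq g hg hgc hgD i a
    have e2 := h'.integral_eq g hg hgc hgD i a
    rw [← setIntegral_eq_integral_of_forall_compl_eq_zero (s := D)]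
    · have : ∀ x, g x • (G x (i, a) - G' x (i, a)) =
          G x (i, a) * g x - G' x (i, a) * g x :=
        fun x => by rw [← sub_mul, mul_comm]; rfl
      rw [integral_congr_ae (Eventually.of_forall this), integral_sub (hi hl1) (hi hl2)]
      linarith
    · intro x hx
      rw [eq_zero_of_tsupport_subset hgD hx, zero_smul]
  rw [Filter.EventuallyEq, ae_restrict_iff' hD.measurableSet]
  filter_upwards [ae_all_iff.2 key] with x hx hxD
  ext ia
  exact sub_eq_zero.1 (hx ia hxD)

lemma HasWeakGrad.weakGrad_ae_eq {D : Set (Vec n)} (hD : IsOpen D) {u : Vec n → Vec m}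
    {G : Vec n → Mat m n} (h : HasWeakGrad D u G) :
    weakGrad D u =ᵐ[volume.restrict D] G := by
  have hex : ∃ G, HasWeakGrad D u G := ⟨G, h⟩
  have : HasWeakGrad D u (weakGrad D u) := by
    unfold weakGrad
    rw [dif_pos hex]
    exact hex.choose_spec
  exact this.ae_eq hD h

lemma MemW01.isW01Pair {q : ℝ} {D : Set (Vec n)} (hD : IsOpen D) {u : Vec n → Vec m}
    (h : MemW01 q D u) : IsW01Pair q D u (weakGrad D u) := by
  obtain ⟨hu, G, hG, hGm, happ⟩ := h
  exact IsW01Pair.congr ⟨hu, hGm, happ⟩ (ae_eq_refl _) (hG.weakGrad_ae_eq hD).symm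

namespace IsW01Pair

variable {q : ℝ} {D : Set (Vec n)} {u : Vec n → Vec m} {G : Vec n → Mat m n}

lemma weakGrad_ae_eq (hq : 1 < q) (hD : IsOpen D) (h : IsW01Pair q D u G) :
    weakGrad D u =ᵐ[volume.restrict D] G :=
  (h.hasWeakGrad hq).weakGrad_ae_eq hD

/-- Multiplication by a smooth function `ζ` and addition of a test map. The multiplication may
localize the map to an open subset `B` of `D`, if `ζ` vanishes near the rest of `D`. -/
lemma smul_add (hq : 1 < q) (h : IsW01Pair q D u G) {B : Set (Vec n)} (hBD : B ⊆ D)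
    {ζ : Vec n → ℝ} (hζ : ContDiff ℝ ∞ ζ) {Z : ℝ} (hZ : ∀ x, |ζ x| ≤ Z)
    (hZ' : ∀ x, ‖partials ζ x‖ ≤ Z) (hsupp : D ∩ tsupport ζ ⊆ B)
    {ψ : Vec n → Vec m} (hψ : ContDiff ℝ ∞ ψ) (hψc : HasCompactSupport ψ) (hψB : tsupport ψ ⊆ B) :
    IsW01Pair q B (fun x => ζ x • u x + ψ x)
      (fun x => ζ x • G x + outer (u x) (partials ζ x) + classicalGrad ψ x) := by
  have hq1 := one_le_ofReal hq
  obtain ⟨φ, hφ, hφu, hφG⟩ := h.approx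
  have hle : volume.restrict B ≤ volume.restrict D := Measure.restrict_mono hBD le_rfl
  have huB := h.memLp.mono_measure hle
  have hGB := h.memLp_grad.mono_measure hle
  have hcζ := hζ.continuous
  have hcp := continuous_partials hζ
  have hcontφ : ∀ l, Continuous (φ l) := fun l => (hφ l).1.continuous
  have hcontG : ∀ l, Continuous (classicalGrad (φ l)) :=
    fun l => continuous_classicalGrad (hφ l).1
  have m1 : ∀ {E : Type _} [NormedAddCommGroup E] [NormedSpace ℝ E] {v : Vec n → E}
      {μ : Measure (Vec n)}, MemLp v (ENNReal.ofReal q) μ →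
      MemLp (fun x => ζ x • v x) (ENNReal.ofReal q) μ := by
    intro E _ _ v μ hv
    refine hv.of_le_mul (c := Z) (hcζ.aestronglyMeasurable.smul hv.1)
      (Eventually.of_forall fun x => ?_)
    rw [norm_smul, Real.norm_eq_abs]
    exact mul_le_mul_of_nonneg_right (hZ x) (norm_nonneg _)
  have mo : ∀ {v : Vec n → Vec m} {μ : Measure (Vec n)}, AEStronglyMeasurable v μ →
      AEStronglyMeasurable (fun x => outer (v x) (partials ζ x)) μ := fun hv =>
    continuous_outer.comp_aestronglyMeasurable (hv.prodMk hcp.aestronglyMeasurable)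
  have mop : MemLp (fun x => outer (u x) (partials ζ x)) (ENNReal.ofReal q)
      (volume.restrict B) := by
    refine huB.of_le_mul (c := Z) (mo huB.1) (Eventually.of_forall fun x => ?_)
    rw [norm_outer, mul_comm]
    exact mul_le_mul_of_nonneg_right (hZ' x) (norm_nonneg _)
  refine ⟨(m1 huB).add ((hψ.continuous.memLp_of_hasCompactSupport hψc).restrict B),
    ((m1 hGB).add mop).add (((continuous_classicalGrad hψ).memLp_of_hasCompactSupport
      (hasCompactSupport_classicalGrad hψc)).restrict B),
    fun l x => ζ x • φ l x + ψ x, fun l => ⟨(hζ.smul (hφ l).1).add hψ, ?_, ?_⟩, ?_, ?_⟩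
  · exact ((hφ l).2.1.smul_left (f := ζ)).add hψc
  · refine (tsupport_add (fun x => ζ x • φ l x) ψ).trans (union_subset ?_ hψB)
    refine (subset_inter ?_ ?_).trans hsupp
    · exact (tsupport_smul_subset_right ζ (φ l)).trans (hφ l).2.2
    · exact tsupport_smul_subset_left ζ (φ l)
  · have hlim : Tendsto (fun l => ENNReal.ofReal Z *
        eLpNorm (fun x => φ l x - u x) (ENNReal.ofReal q) (volume.restrict D)) atTop (𝓝 0) := by
      simpa using ENNReal.Tendsto.const_mul hφu (Or.inr ENNReal.ofReal_ne_top)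
    refine tendsto_of_tendsto_of_tendsto_of_le_of_le tendsto_const_nhds hlim
      (fun _ => zero_le) fun l => ?_
    refine (eLpNorm_mono_measure _ hle).trans ?_
    refine eLpNorm_le_mul_eLpNorm_of_ae_le_mul (Eventually.of_forall fun x => ?_) _
    rw [add_sub_add_right_eq_sub, ← smul_sub, norm_smul, Real.norm_eq_abs]
    exact mul_le_mul_of_nonneg_right (hZ x) (norm_nonneg _)
  · have hlim : Tendsto (fun l => ENNReal.ofReal Z *
        eLpNorm (fun x => classicalGrad (φ l) x - G x) (ENNReal.ofReal q) (volume.restrict D) +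
        ENNReal.ofReal Z *
        eLpNorm (fun x => φ l x - u x) (ENNReal.ofReal q) (volume.restrict D)) atTop (𝓝 0) := by
      simpa using (ENNReal.Tendsto.const_mul hφG (Or.inr ENNReal.ofReal_ne_top)).add
        (ENNReal.Tendsto.const_mul hφu (Or.inr ENNReal.ofReal_ne_top))
    refine tendsto_of_tendsto_of_tendsto_of_le_of_le tendsto_const_nhds hlim
      (fun _ => zero_le) fun l => ?_
    refine (eLpNorm_mono_measure _ hle).trans ?_
    have hfun : (fun x => classicalGrad (fun x => ζ x • φ l x + ψ x) x -
        (ζ x • G x + outer (u x) (partials ζ x) + classicalGrad ψ x)) =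
        (fun x => ζ x • (classicalGrad (φ l) x - G x)) +
          fun x => outer (φ l x - u x) (partials ζ x) := by
      funext x
      have d1 := hζ.differentiable (by simp) x
      have d2 := (hφ l).1.differentiable (by simp) x
      have d3 := hψ.differentiable (by simp) x
      rw [classicalGrad_add (φ := fun x => ζ x • φ l x) (d1.smul d2) d3,
        classicalGrad_smul d1 d2]
      simp only [Pi.add_apply, outer_sub_left, smul_sub]
      abel
    rw [hfun]
    refine (eLpNorm_add_le ?_ ?_ hq1).trans (add_le_add ?_ ?_)
    · exact hcζ.aestronglyMeasurable.smul ((hcontG l).aestronglyMeasurable.sub h.memLp_grad.1)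
    · exact mo ((hcontφ l).aestronglyMeasurable.sub h.memLp.1)
    · refine eLpNorm_le_mul_eLpNorm_of_ae_le_mul (Eventually.of_forall fun x => ?_) _
      rw [norm_smul, Real.norm_eq_abs]
      exact mul_le_mul_of_nonneg_right (hZ x) (norm_nonneg _)
    · refine eLpNorm_le_mul_eLpNorm_of_ae_le_mul (Eventually.of_forall fun x => ?_) _
      rw [norm_outer, mul_comm]
      exact mul_le_mul_of_nonneg_right (hZ' x) (norm_nonneg _)

end IsW01Pair

/-! ### Poincaré inequalities for differences -/

section ENNRealTools

variable {α : Type*} [MeasurableSpace α] {μ : Measure α} {q : ℝ}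

/-- Jensen's inequality for `x ↦ x ^ q` and a finite measure. -/
lemma lintegral_rpow_le (hq : 1 < q) {f : α → ℝ≥0∞} (hf : AEMeasurable f μ) :
    (∫⁻ x, f x ∂μ) ^ q ≤ μ univ ^ (q - 1) * ∫⁻ x, f x ^ q ∂μ := by
  have hpq := Real.HolderConjugate.conjExponent hq
  have h := ENNReal.lintegral_mul_le_Lp_mul_Lq μ hpq hf (aemeasurable_const (b := (1 : ℝ≥0∞)))
  simp only [Pi.mul_apply, mul_one, ENNReal.one_rpow, lintegral_one] at h
  have h2 := ENNReal.rpow_le_rpow h (by positivity : (0 : ℝ) ≤ q)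
  rw [ENNReal.mul_rpow_of_nonneg _ _ (by positivity), ← ENNReal.rpow_mul, ← ENNReal.rpow_mul,
    one_div_mul_cancel (by positivity), ENNReal.rpow_one, mul_comm] at h2
  convert h2 using 3
  unfold Real.conjExponent
  field_simp

lemma enorm_integral_rpow_le {E : Type*} [NormedAddCommGroup E] [NormedSpace ℝ E] (hq : 1 < q)
    {f : α → E} (hf : AEStronglyMeasurable f μ) :
    ‖∫ x, f x ∂μ‖ₑ ^ q ≤ μ univ ^ (q - 1) * ∫⁻ x, ‖f x‖ₑ ^ q ∂μ :=
  (ENNReal.rpow_le_rpow (enorm_integral_le_lintegral_enorm f) (by positivity)).trans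
    (lintegral_rpow_le hq hf.enorm)

end ENNRealTools

section ChangeOfVariables

lemma lintegral_add_smul_right {c : ℝ} (hc : 0 < c) {h : Vec n → ℝ≥0∞} (hh : Measurable h)
    (y : Vec n) :
    ∫⁻ z, h (y + c • z) = ENNReal.ofReal ((c ^ n)⁻¹) * ∫⁻ z, h z := by
  have h1 : ∫⁻ z, h (y + c • z) = ∫⁻ z, h (y + z) ∂(Measure.map (c • ·) volume) := by
    rw [lintegral_map (by fun_prop) (by fun_prop)]
  rw [h1, Measure.map_addHaar_smul _ hc.ne', lintegral_smul_measure, finrank_euclideanSpace,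
    Fintype.card_fin, abs_of_pos (by positivity), smul_eq_mul, lintegral_add_left_eq_self]

end ChangeOfVariables

section Convex

variable {q : ℝ}

lemma enorm_sub_rpow_le_lintegral (hq : 1 < q) {φ : Vec n → Vec m} (hφ : ContDiff ℝ ∞ φ)
    (y z : Vec n) :
    ‖φ y - φ z‖ₑ ^ q ≤
      ‖z - y‖ₑ ^ q * ∫⁻ s in Ioo (0 : ℝ) 1, ‖classicalGrad φ (y + s • (z - y))‖ₑ ^ q := by
  have hcG := continuous_classicalGrad hφ
  have hder : ∀ s : ℝ, HasDerivAt (fun s : ℝ => φ (y + s • (z - y)))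
      (fderiv ℝ φ (y + s • (z - y)) (z - y)) s := by
    intro s
    have h1 : HasDerivAt (fun s : ℝ => y + s • (z - y)) (z - y) s := by
      simpa using ((hasDerivAt_id s).smul_const (z - y)).const_add y
    exact ((hφ.differentiable (by simp)) _).hasFDerivAt.comp_hasDerivAt s h1
  have hcont : Continuous fun s : ℝ => fderiv ℝ φ (y + s • (z - y)) (z - y) := by
    have := hφ.continuous_fderiv (by simp)
    fun_prop
  have hftc := intervalIntegral.integral_eq_sub_of_hasDerivAt (a := 0) (b := 1)
    (fun s _ => hder s) (hcont.intervalIntegrable _ _)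
  simp only [one_smul, zero_smul, add_zero, add_sub_cancel] at hftc
  have hle : ‖φ y - φ z‖ₑ ≤
      ∫⁻ s in Ioo (0 : ℝ) 1, ‖z - y‖ₑ * ‖classicalGrad φ (y + s • (z - y))‖ₑ := by
    rw [← enorm_neg, neg_sub, ← hftc, intervalIntegral.integral_of_le zero_le_one,
      integral_Ioc_eq_integral_Ioo]
    refine (enorm_integral_le_lintegral_enorm _).trans (lintegral_mono fun s => ?_)
    rw [← ofReal_norm, ← ofReal_norm, ← ofReal_norm, ← ENNReal.ofReal_mul (norm_nonneg _), mul_comm]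
    exact ENNReal.ofReal_le_ofReal (norm_fderiv_apply_le _ _ _)
  have hmeas : Measurable fun s : ℝ => ‖classicalGrad φ (y + s • (z - y))‖ₑ := by
    have : Continuous fun s : ℝ => classicalGrad φ (y + s • (z - y)) := by fun_prop
    exact this.measurable.enorm
  rw [lintegral_const_mul _ hmeas] at hle
  have h2 := ENNReal.rpow_le_rpow hle (by positivity : (0 : ℝ) ≤ q)
  rw [ENNReal.mul_rpow_of_nonneg _ _ (by positivity)] at h2
  refine h2.trans (mul_le_mul_right ?_ _)
  simpa using lintegral_rpow_le (μ := volume.restrict (Ioo (0 : ℝ) 1)) hq hmeas.aemeasurable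

/-- The Poincaré inequality for differences on a convex set `K`. One of the two points is
restricted to `E`; the factor `τ + |E| / τ ^ n` is small if `|E|` is small and `τ` is well chosen.

The points `(1 - s) y + s z`, `y ∈ E`, `z ∈ K`, cover each `p ∈ K` with density at most
`s⁻ⁿ |E|` and at most `(1 - s)⁻ⁿ |K|`. -/
lemma lintegral_sub_rpow_le_of_convex (hq : 1 < q) {K : Set (Vec n)} (hKm : MeasurableSet K)
    (hK : Convex ℝ K) {R : ℝ} (hR : ∀ y ∈ K, ∀ z ∈ K, ‖z - y‖ ≤ R)
    {φ : Vec n → Vec m} (hφ : ContDiff ℝ ∞ φ) {E : Set (Vec n)}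
    (hE : MeasurableSet E) (hEK : E ⊆ K) {τ : ℝ} (hτ : 0 < τ) (hτ1 : τ ≤ 1) :
    ∫⁻ y in E, ∫⁻ z in K, ‖φ y - φ z‖ₑ ^ q ≤
      ENNReal.ofReal R ^ q * 2 ^ n * (volume K + 1) *
        (ENNReal.ofReal τ + volume E * ENNReal.ofReal (τ ^ n)⁻¹) *
        ∫⁻ x in K, ‖classicalGrad φ x‖ₑ ^ q := by
  set h : Vec n → ℝ≥0∞ := K.indicator fun x => ‖classicalGrad φ x‖ₑ ^ q with hh
  have hhm : Measurable h :=
    ((continuous_classicalGrad hφ).measurable.enorm.pow_const q).indicator hKm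
  set H := ∫⁻ x, h x with hH
  have hHK : H = ∫⁻ x in K, ‖classicalGrad φ x‖ₑ ^ q := lintegral_indicator hKm _
  rw [← hHK]
  have hjoint : Measurable fun p : (Vec n × Vec n) × ℝ => h (p.1.1 + p.2 • (p.1.2 - p.1.1)) :=
    hhm.comp (by fun_prop)
  -- the averages of `h` over the points of the segments with parameter `s`
  set J : ℝ → ℝ≥0∞ := fun s => ∫⁻ y in E, ∫⁻ z in K, h (y + s • (z - y)) with hJ
  have step1 : ∫⁻ y in E, ∫⁻ z in K, ‖φ y - φ z‖ₑ ^ q ≤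
      ENNReal.ofReal R ^ q * ∫⁻ s in Ioo (0 : ℝ) 1, J s := by
    have e1 : ∫⁻ y in E, ∫⁻ z in K, ‖φ y - φ z‖ₑ ^ q ≤ ∫⁻ y in E, ∫⁻ z in K,
        ENNReal.ofReal R ^ q * ∫⁻ s in Ioo (0 : ℝ) 1, h (y + s • (z - y)) := by
      refine setLIntegral_mono' hE fun y hy => setLIntegral_mono' hKm fun z hz => ?_
      refine (enorm_sub_rpow_le_lintegral hq hφ y z).trans (mul_le_mul' ?_ ?_)
      · refine ENNReal.rpow_le_rpow ?_ (by positivity)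
        rw [← ofReal_norm]
        exact ENNReal.ofReal_le_ofReal (hR y (hEK hy) z hz)
      · refine setLIntegral_mono' measurableSet_Ioo fun s hs => ?_
        have : y + s • (z - y) ∈ K := hK.add_smul_sub_mem (hEK hy) hz ⟨hs.1.le, hs.2.le⟩
        rw [hh, indicator_of_mem this]
    refine e1.trans (le_of_eq ?_)
    have m1 : Measurable fun p : Vec n × Vec n =>
        ∫⁻ s in Ioo (0 : ℝ) 1, h (p.1 + s • (p.2 - p.1)) := hjoint.lintegral_prod_right'
    have m2 : Measurable fun y : Vec n =>
        ∫⁻ z in K, ∫⁻ s in Ioo (0 : ℝ) 1, h (y + s • (z - y)) := m1.lintegral_prod_right'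
    have e2 : ∀ y : Vec n, ∫⁻ z in K, ENNReal.ofReal R ^ q *
        ∫⁻ s in Ioo (0 : ℝ) 1, h (y + s • (z - y)) =
        ENNReal.ofReal R ^ q * ∫⁻ z in K, ∫⁻ s in Ioo (0 : ℝ) 1, h (y + s • (z - y)) := fun y =>
      lintegral_const_mul _ (m1.comp (by fun_prop : Measurable fun z : Vec n => (y, z)))
    simp_rw [e2]
    rw [lintegral_const_mul _ m2]
    congr 1
    have e3 : ∀ y : Vec n, ∫⁻ z in K, ∫⁻ s in Ioo (0 : ℝ) 1, h (y + s • (z - y)) =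
        ∫⁻ s in Ioo (0 : ℝ) 1, ∫⁻ z in K, h (y + s • (z - y)) := fun y =>
      lintegral_lintegral_swap
        (hhm.comp (by fun_prop : Measurable fun p : Vec n × ℝ => y + p.2 • (p.1 - y))).aemeasurable
    simp_rw [e3]
    refine lintegral_lintegral_swap (Measurable.aemeasurable ?_)
    have : Measurable fun p : (Vec n × ℝ) × Vec n => h (p.1.1 + p.1.2 • (p.2 - p.1.1)) :=
      hhm.comp (by fun_prop)
    exact this.lintegral_prod_right'
  have bound1 : ∀ s : ℝ, 0 < s → J s ≤ volume E * (ENNReal.ofReal (s ^ n)⁻¹ * H) := by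
    intro s hs
    have : ∀ y : Vec n, ∫⁻ z in K, h (y + s • (z - y)) ≤ ENNReal.ofReal (s ^ n)⁻¹ * H := by
      intro y
      refine (setLIntegral_le_lintegral _ _).trans (le_of_eq ?_)
      rw [← lintegral_add_smul_right hs hhm (y - s • y)]
      congr 1 with z
      rw [smul_sub]
      congr 1
      abel
    refine (lintegral_mono this).trans (le_of_eq ?_)
    rw [setLIntegral_const, mul_comm]
  have bound2 : ∀ s : ℝ, s < 1 → J s ≤ volume K * (ENNReal.ofReal ((1 - s) ^ n)⁻¹ * H) := by
    intro s hs
    have hsw : J s = ∫⁻ z in K, ∫⁻ y in E, h (y + s • (z - y)) :=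
      lintegral_lintegral_swap (hhm.comp (by fun_prop :
        Measurable fun p : Vec n × Vec n => p.1 + s • (p.2 - p.1))).aemeasurable
    rw [hsw]
    have : ∀ z : Vec n, ∫⁻ y in E, h (y + s • (z - y)) ≤ ENNReal.ofReal ((1 - s) ^ n)⁻¹ * H := by
      intro z
      refine (setLIntegral_le_lintegral _ _).trans (le_of_eq ?_)
      rw [← lintegral_add_smul_right (sub_pos.2 hs) hhm (s • z)]
      congr 1 with y
      congr 1
      rw [smul_sub, sub_smul, one_smul]
      abel
    refine (lintegral_mono this).trans (le_of_eq ?_)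
    rw [setLIntegral_const, mul_comm]
  have hhalf : ∀ r : ℝ, 1 / 2 ≤ r → ENNReal.ofReal (r ^ n)⁻¹ ≤ 2 ^ n := by
    intro r hr
    have : (r ^ n)⁻¹ ≤ 2 ^ n := by
      rw [← inv_pow]
      refine pow_le_pow_left₀ (by positivity) ?_ _
      rw [inv_le_comm₀ (by linarith) (by norm_num)]
      linarith
    refine (ENNReal.ofReal_le_ofReal this).trans (le_of_eq ?_)
    rw [ENNReal.ofReal_pow (by norm_num)]
    norm_num
  have hone : (1 : ℝ≥0∞) ≤ ENNReal.ofReal (τ ^ n)⁻¹ := by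
    rw [← ENNReal.ofReal_one]
    refine ENNReal.ofReal_le_ofReal ?_
    exact (one_le_inv₀ (by positivity)).2 (pow_le_one₀ hτ.le hτ1)
  have h2n : (1 : ℝ≥0∞) ≤ 2 ^ n := one_le_pow₀ (by norm_num)
  set Q := volume E * ENNReal.ofReal (τ ^ n)⁻¹ with hQ
  have bound : ∀ s ∈ Ioo (0 : ℝ) 1, J s ≤
      (Ioo (0 : ℝ) τ).indicator (fun _ => 2 ^ n * volume K * H) s + 2 ^ n * Q * H := by
    intro s hs
    by_cases hsτ : s < τ
    · rw [indicator_of_mem (show s ∈ Ioo 0 τ from ⟨hs.1, hsτ⟩)]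
      rcases le_total s (1 / 2) with h' | h'
      · refine (bound2 s hs.2).trans (le_add_right ?_)
        calc volume K * (ENNReal.ofReal ((1 - s) ^ n)⁻¹ * H)
            ≤ volume K * (2 ^ n * H) := by gcongr; exact hhalf _ (by linarith)
          _ = 2 ^ n * volume K * H := by ring
      · refine (bound1 s hs.1).trans (le_add_left ?_)
        calc volume E * (ENNReal.ofReal (s ^ n)⁻¹ * H)
            ≤ volume E * 1 * (2 ^ n * H) := by
              rw [mul_one]; gcongr; exact hhalf _ h'
          _ ≤ Q * (2 ^ n * H) := by rw [hQ]; gcongr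
          _ = 2 ^ n * Q * H := by ring
    · refine (bound1 s hs.1).trans (le_add_left ?_)
      have h1 : ENNReal.ofReal (s ^ n)⁻¹ ≤ ENNReal.ofReal (τ ^ n)⁻¹ := by
        refine ENNReal.ofReal_le_ofReal ?_
        rw [not_lt] at hsτ
        gcongr
      calc volume E * (ENNReal.ofReal (s ^ n)⁻¹ * H)
          ≤ volume E * (ENNReal.ofReal (τ ^ n)⁻¹ * H) := by gcongr
        _ = 1 * Q * H := by rw [hQ]; ring
        _ ≤ 2 ^ n * Q * H := by gcongr
  have step2 : ∫⁻ s in Ioo (0 : ℝ) 1, J s ≤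
      2 ^ n * volume K * H * ENNReal.ofReal τ + 2 ^ n * Q * H := by
    refine (setLIntegral_mono' measurableSet_Ioo bound).trans ?_
    rw [lintegral_add_right _ measurable_const]
    refine add_le_add ?_ ?_
    · refine (setLIntegral_le_lintegral _ _).trans ?_
      rw [lintegral_indicator measurableSet_Ioo, setLIntegral_const, Real.volume_Ioo, sub_zero]
    · rw [setLIntegral_const, Real.volume_Ioo]
      simp
  calc ∫⁻ y in E, ∫⁻ z in K, ‖φ y - φ z‖ₑ ^ q
      ≤ ENNReal.ofReal R ^ q * (2 ^ n * volume K * H * ENNReal.ofReal τ + 2 ^ n * Q * H) :=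
        step1.trans (by gcongr)
    _ ≤ ENNReal.ofReal R ^ q * (2 ^ n * (volume K + 1) * H * ENNReal.ofReal τ +
          2 ^ n * ((volume K + 1) * Q) * H) := by
        gcongr
        · exact le_self_add
        · exact le_mul_of_one_le_left zero_le (le_add_self)
    _ = _ := by ring

end Convex

/-! ### The Poincaré inequality in annuli -/

/-- The open annulus with centre `a` and radii `r < R`. -/
def ring (a : Vec n) (r R : ℝ) : Set (Vec n) := {y | r < ‖y - a‖ ∧ ‖y - a‖ < R}

lemma isOpen_ring (a : Vec n) (r R : ℝ) : IsOpen (ring a r R) := by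
  have h1 : IsOpen {y : Vec n | r < ‖y - a‖} := isOpen_lt (by fun_prop) (by fun_prop)
  have h2 : IsOpen {y : Vec n | ‖y - a‖ < R} := isOpen_lt (by fun_prop) (by fun_prop)
  exact h1.and h2

lemma ring_subset_ball (a : Vec n) (r R : ℝ) : ring a r R ⊆ Metric.ball a R := fun y hy => by
  rw [mem_ball_iff_norm]; exact hy.2

lemma volume_ring_lt_top (a : Vec n) (r R : ℝ) : volume (ring a r R) < ⊤ :=
  (measure_mono (ring_subset_ball a r R)).trans_lt measure_ball_lt_top

/-- A Poincaré inequality for differences between points of `S` and points of `T`, controlled by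
the gradient in the annulus with radii `2⁻⁽ⁿ⁺¹⁾` and `1`. The factor is small if the first point is
restricted to a set `E` of small measure. -/
def DiffBound (m : ℕ) (q : ℝ) (S T : Set (Vec n)) (C : ℝ≥0∞) : Prop :=
  ∀ φ : Vec n → Vec m, ContDiff ℝ ∞ φ → ∀ E ⊆ S, MeasurableSet E → ∀ τ : ℝ, 0 < τ → τ ≤ 1 →
    ∫⁻ y in E, ∫⁻ z in T, ‖φ y - φ z‖ₑ ^ q ≤
      C * (ENNReal.ofReal τ + volume E * ENNReal.ofReal (τ ^ n)⁻¹) *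
        ∫⁻ x in ring 0 (2 ^ (n + 1))⁻¹ 1, ‖classicalGrad φ x‖ₑ ^ q

lemma DiffBound.mono {q : ℝ} {S T S' T' : Set (Vec n)} {C : ℝ≥0∞} (h : DiffBound m q S T C)
    (hS : S' ⊆ S) (hT : T' ⊆ T) : DiffBound m q S' T' C := fun φ hφ E hE hEm τ hτ hτ1 =>
  (lintegral_mono fun _ => lintegral_mono_set hT).trans (h φ hφ E (hE.trans hS) hEm τ hτ hτ1)

lemma le_add_mul_ofReal_inv_pow {τ : ℝ} (hτ : 0 < τ) (hτ1 : τ ≤ 1) (a : ℝ≥0∞) :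
    a ≤ ENNReal.ofReal τ + a * ENNReal.ofReal (τ ^ n)⁻¹ := by
  refine le_add_left (le_mul_of_one_le_right zero_le ?_)
  rw [← ENNReal.ofReal_one]
  exact ENNReal.ofReal_le_ofReal ((one_le_inv₀ (by positivity)).2 (pow_le_one₀ hτ.le hτ1))

lemma measurable_enorm_sub_rpow (q : ℝ) {φ : Vec n → Vec m} (hφ : Continuous φ) :
    Measurable fun p : Vec n × Vec n => ‖φ p.1 - φ p.2‖ₑ ^ q := by
  have : Continuous fun p : Vec n × Vec n => φ p.1 - φ p.2 := by fun_prop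
  exact this.measurable.enorm.pow_const q

lemma measurable_enorm_const_sub_rpow (q : ℝ) {φ : Vec n → Vec m} (hφ : Continuous φ)
    (y : Vec n) : Measurable fun z : Vec n => ‖φ y - φ z‖ₑ ^ q := by
  have : Continuous fun z : Vec n => φ y - φ z := by fun_prop
  exact this.measurable.enorm.pow_const q

/-- Differences are compared through the points of a common set `H` of positive measure. -/
lemma DiffBound.trans {q : ℝ} (hq : 1 < q) {S H T : Set (Vec n)} {C₁ C₂ : ℝ≥0∞}
    (h₁ : DiffBound m q S H C₁) (h₂ : DiffBound m q H T C₂) (hC₁ : C₁ ≠ ⊤) (hC₂ : C₂ ≠ ⊤)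
    (hHm : MeasurableSet H) (hH0 : volume H ≠ 0) (hHt : volume H ≠ ⊤) (hTt : volume T ≠ ⊤) :
    ∃ C ≠ (⊤ : ℝ≥0∞), DiffBound m q S T C := by
  refine ⟨(volume H)⁻¹ * (2 ^ (q - 1) * (volume T * C₁ + C₂ * (1 + volume H))), ?_, ?_⟩
  · have h2 : (2 : ℝ≥0∞) ^ (q - 1) ≠ ⊤ := ENNReal.rpow_ne_top_of_nonneg (by linarith) (by simp)
    have := ENNReal.inv_ne_top.2 hH0
    finiteness
  intro φ hφ E hE hEm τ hτ hτ1
  set g := ∫⁻ x in ring 0 (2 ^ (n + 1))⁻¹ 1, ‖classicalGrad φ x‖ₑ ^ q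
  set F : ℝ≥0∞ := ENNReal.ofReal τ + volume E * ENNReal.ofReal (τ ^ n)⁻¹ with hF
  have hd := measurable_enorm_sub_rpow q hφ.continuous
  have hd1 := measurable_enorm_const_sub_rpow q hφ.continuous
  have hpt : ∀ y z p : Vec n, ‖φ y - φ z‖ₑ ^ q ≤
      2 ^ (q - 1) * (‖φ y - φ p‖ₑ ^ q + ‖φ p - φ z‖ₑ ^ q) := by
    intro y z p
    refine le_trans ?_ (ENNReal.rpow_add_le_mul_rpow_add_rpow _ _ hq.le)
    refine ENNReal.rpow_le_rpow ?_ (by positivity)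
    rw [← sub_add_sub_cancel (φ y) (φ p) (φ z)]
    exact enorm_add_le _ _
  have e1 : ∀ y z : Vec n, volume H * ‖φ y - φ z‖ₑ ^ q ≤
      2 ^ (q - 1) * ((∫⁻ p in H, ‖φ y - φ p‖ₑ ^ q) + ∫⁻ p in H, ‖φ p - φ z‖ₑ ^ q) := by
    intro y z
    rw [← lintegral_add_left (hd1 y), ← lintegral_const_mul', mul_comm, ← setLIntegral_const]
    · exact lintegral_mono fun p => hpt y z p
    · exact ENNReal.rpow_ne_top_of_nonneg (by linarith) (by simp)
  have m2 : Measurable fun z : Vec n => ∫⁻ p in H, ‖φ p - φ z‖ₑ ^ q :=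
    (hd.comp measurable_swap).lintegral_prod_right'
  have m1 : Measurable fun y : Vec n => ∫⁻ p in H, ‖φ y - φ p‖ₑ ^ q :=
    hd.lintegral_prod_right'
  have h2t : (2 : ℝ≥0∞) ^ (q - 1) ≠ ⊤ := ENNReal.rpow_ne_top_of_nonneg (by linarith) (by simp)
  have e2 : ∀ y : Vec n, volume H * ∫⁻ z in T, ‖φ y - φ z‖ₑ ^ q ≤
      2 ^ (q - 1) * (volume T * (∫⁻ p in H, ‖φ y - φ p‖ₑ ^ q) +
        ∫⁻ z in T, ∫⁻ p in H, ‖φ p - φ z‖ₑ ^ q) := by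
    intro y
    rw [← lintegral_const_mul _ (hd1 y), mul_comm (volume T), ← setLIntegral_const,
      ← lintegral_add_left measurable_const, ← lintegral_const_mul' _ _ h2t]
    exact lintegral_mono fun z => e1 y z
  have hsw : ∫⁻ z in T, ∫⁻ p in H, ‖φ p - φ z‖ₑ ^ q ≤ C₂ * (1 + volume H) * g := by
    rw [lintegral_lintegral_swap (f := fun z p => ‖φ p - φ z‖ₑ ^ q)
      (hd.comp measurable_swap).aemeasurable]
    simpa using h₂ φ hφ H subset_rfl hHm 1 one_pos le_rfl
  have e3 : volume H * ∫⁻ y in E, ∫⁻ z in T, ‖φ y - φ z‖ₑ ^ q ≤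
      2 ^ (q - 1) * (volume T * (C₁ * F * g) + volume E * (C₂ * (1 + volume H) * g)) := by
    rw [← lintegral_const_mul' _ _ hHt]
    refine (lintegral_mono fun y => e2 y).trans ?_
    rw [lintegral_const_mul' _ _ h2t, lintegral_add_right _ measurable_const,
      lintegral_const_mul' _ _ hTt, setLIntegral_const, mul_comm _ (volume E)]
    gcongr
    exact h₁ φ hφ E hE hEm τ hτ hτ1
  have hEF : volume E ≤ F := le_add_mul_ofReal_inv_pow hτ hτ1 _
  calc ∫⁻ y in E, ∫⁻ z in T, ‖φ y - φ z‖ₑ ^ q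
      = (volume H)⁻¹ * (volume H * ∫⁻ y in E, ∫⁻ z in T, ‖φ y - φ z‖ₑ ^ q) := by
        rw [← mul_assoc, ENNReal.inv_mul_cancel hH0 hHt, one_mul]
    _ ≤ (volume H)⁻¹ *
        (2 ^ (q - 1) * (volume T * (C₁ * F * g) + F * (C₂ * (1 + volume H) * g))) := by
        refine mul_le_mul' le_rfl (e3.trans ?_)
        gcongr
    _ = _ := by ring

/-- The cap of points `p` of the unit ball with `s pᵢ > 2⁻⁽ⁿ⁺¹⁾`. -/
def cap (v : Fin n × ℤˣ) : Set (Vec n) :=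
  {p | ‖p‖ < 1 ∧ (2 ^ (n + 1))⁻¹ < ((v.2 : ℤ) : ℝ) * p v.1}

lemma isOpen_cap (v : Fin n × ℤˣ) : IsOpen (cap v) := by
  have h1 : IsOpen {p : Vec n | ‖p‖ < 1} := isOpen_lt (by fun_prop) (by fun_prop)
  have h2 : IsOpen {p : Vec n | (2 ^ (n + 1))⁻¹ < ((v.2 : ℤ) : ℝ) * p v.1} :=
    isOpen_lt (by fun_prop) (by fun_prop)
  exact h1.and h2

lemma volume_cap_ne_top (v : Fin n × ℤˣ) : volume (cap v) ≠ ⊤ := by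
  refine ((measure_mono (t := Metric.ball (0 : Vec n) 1) ?_).trans_lt measure_ball_lt_top).ne
  intro p hp
  simpa using hp.1

lemma convex_cap (v : Fin n × ℤˣ) : Convex ℝ (cap v) := by
  intro x hx y hy a b ha hb hab
  refine ⟨?_, ?_⟩
  · have h := convex_ball (0 : Vec n) 1 (by simpa using hx.1) (by simpa using hy.1) ha hb hab
    simpa using h
  · have h1 := hx.2
    have h2 := hy.2
    simp only [PiLp.add_apply, PiLp.smul_apply, smul_eq_mul]
    rcases ha.eq_or_lt with rfl | ha
    · have : b = 1 := by linarith
      subst this; simpa using h2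
    · have e1 := mul_lt_mul_of_pos_left h1 ha
      have e2 := mul_le_mul_of_nonneg_left h2.le hb
      have : (2 ^ (n + 1) : ℝ)⁻¹ = a * (2 ^ (n + 1))⁻¹ + b * (2 ^ (n + 1))⁻¹ := by
        rw [← add_mul, hab, one_mul]
      rw [this]
      linarith

lemma abs_intUnit (s : ℤˣ) : |((s : ℤ) : ℝ)| = 1 := by
  rcases Int.units_eq_one_or s with rfl | rfl <;> simp

lemma cap_subset_ring (v : Fin n × ℤˣ) : cap v ⊆ ring 0 (2 ^ (n + 1))⁻¹ 1 := by
  intro p hp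
  simp only [ring, mem_ofPred_eq, sub_zero]
  refine ⟨hp.2.trans_le ((le_abs_self _).trans ?_), hp.1⟩
  rw [abs_mul, abs_intUnit, one_mul]
  exact PiLp.norm_apply_le p v.1

/-- The caps cover the annulus with radii `1/2` and `1`: some coordinate of `p` is at least
`|p| / √n` in absolute value. -/
lemma ring_subset_iUnion_cap : ring (0 : Vec n) (1 / 2) 1 ⊆ ⋃ v, cap v := by
  intro p hp
  simp only [ring, mem_ofPred_eq, sub_zero] at hp
  by_contra hcon
  simp only [mem_iUnion, not_exists] at hcon
  have hsmall : ∀ i, p i ^ 2 ≤ ((2 ^ (n + 1))⁻¹) ^ 2 := by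
    intro i
    refine sq_le_sq' ?_ ?_
    · have := hcon (i, -1)
      simp only [cap, mem_ofPred_eq, hp.2, true_and, not_lt] at this
      push_cast at this
      linarith
    · have := hcon (i, 1)
      simp only [cap, mem_ofPred_eq, hp.2, true_and, not_lt] at this
      push_cast at this
      linarith
  have hsum : ‖p‖ ^ 2 ≤ n * ((2 ^ (n + 1))⁻¹) ^ 2 := by
    rw [EuclideanSpace.real_norm_sq_eq]
    refine (Finset.sum_le_sum fun i _ => hsmall i).trans ?_
    simp
  have hn : (n : ℝ) ≤ 2 ^ n := by exact_mod_cast n.lt_two_pow_self.le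
  have h1 : (n : ℝ) * ((2 ^ (n + 1))⁻¹) ^ 2 ≤ 1 / 4 := by
    have hp1 : (1 : ℝ) ≤ 2 ^ n := one_le_pow₀ (by norm_num)
    have h4 : ((2 : ℝ) ^ (n + 1)) ^ 2 = 4 * (2 ^ n) ^ 2 := by ring
    rw [inv_pow, ← div_eq_mul_inv, div_le_iff₀ (by positivity), h4]
    nlinarith
  nlinarith [hp.1]

lemma exists_diffBound_cap {q : ℝ} (hq : 1 < q) (v : Fin n × ℤˣ) :
    ∃ C ≠ (⊤ : ℝ≥0∞), DiffBound m q (cap v) (cap v) C := by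
  refine ⟨ENNReal.ofReal 2 ^ q * 2 ^ n * (volume (cap v) + 1), ?_, ?_⟩
  · have := volume_cap_ne_top v
    have : ENNReal.ofReal 2 ^ q ≠ ⊤ := ENNReal.rpow_ne_top_of_nonneg (by linarith) (by simp)
    finiteness
  · intro φ hφ E hE hEm τ hτ hτ1
    refine (lintegral_sub_rpow_le_of_convex hq (isOpen_cap v).measurableSet (convex_cap v)
      (R := 2) ?_ hφ hEm hE hτ hτ1).trans ?_
    · intro y hy z hz
      refine (norm_sub_le _ _).trans ?_
      linarith [hy.1, hz.1]
    · gcongr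
      exact cap_subset_ring v

/-- Two caps overlap unless they are opposite. -/
lemma cap_inter_nonempty {v v' : Fin n × ℤˣ} (h : v.1 = v'.1 → v.2 = v'.2) :
    (cap v ∩ cap v').Nonempty := by
  obtain ⟨i, s⟩ := v
  obtain ⟨i', s'⟩ := v'
  have hn : 1 ≤ n := by
    have := i.2
    omega
  have hsmall : (2 ^ (n + 1) : ℝ)⁻¹ ≤ 1 / 4 := by
    have : (2 : ℝ) ^ 2 ≤ 2 ^ (n + 1) := pow_le_pow_right₀ (by norm_num) (by omega)
    rw [one_div]
    exact inv_anti₀ (by norm_num) (by linarith)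
  have hs : ((s : ℤ) : ℝ) * ((s : ℤ) : ℝ) = 1 := by
    rcases Int.units_eq_one_or s with rfl | rfl <;> simp
  have hs' : ((s' : ℤ) : ℝ) * ((s' : ℤ) : ℝ) = 1 := by
    rcases Int.units_eq_one_or s' with rfl | rfl <;> simp
  simp only at h
  by_cases hi : i = i'
  · obtain rfl := hi
    obtain rfl := h rfl
    refine ⟨EuclideanSpace.single i (((s : ℤ) : ℝ) * (1 / 2)), ?_⟩
    rw [inter_self]
    refine ⟨?_, ?_⟩
    · rw [PiLp.norm_single, Real.norm_eq_abs, abs_mul, abs_intUnit]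
      norm_num
    · simp only [PiLp.single_apply, if_true]
      rw [← mul_assoc, hs]
      linarith
  · set p : Vec n := EuclideanSpace.single i (((s : ℤ) : ℝ) * (2 / 5)) +
      EuclideanSpace.single i' (((s' : ℤ) : ℝ) * (2 / 5)) with hp
    have hnorm : ‖p‖ < 1 := by
      refine (norm_add_le _ _).trans_lt ?_
      rw [PiLp.norm_single, PiLp.norm_single, Real.norm_eq_abs,
        Real.norm_eq_abs, abs_mul, abs_mul, abs_intUnit, abs_intUnit]
      norm_num
    have hi' : i' ≠ i := fun h => hi h.symm
    refine ⟨p, ⟨hnorm, ?_⟩, hnorm, ?_⟩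
    · simp only [hp, PiLp.add_apply, PiLp.single_apply, if_true, hi, if_false, add_zero]
      rw [← mul_assoc, hs]
      linarith
    · simp only [hp, PiLp.add_apply, PiLp.single_apply, if_true, hi', if_false, zero_add]
      rw [← mul_assoc, hs']
      linarith

lemma exists_diffBound_cap_of_overlap {q : ℝ} (hq : 1 < q) {v v' : Fin n × ℤˣ}
    (h : v.1 = v'.1 → v.2 = v'.2) :
    ∃ C ≠ (⊤ : ℝ≥0∞), DiffBound m q (cap v) (cap v') C := by
  obtain ⟨C₁, hC₁, h₁⟩ := exists_diffBound_cap (m := m) hq v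
  obtain ⟨C₂, hC₂, h₂⟩ := exists_diffBound_cap (m := m) hq v'
  have hop := (isOpen_cap v).inter (isOpen_cap v')
  refine (h₁.mono subset_rfl (inter_subset_left (t := cap v'))).trans hq
    (h₂.mono (inter_subset_right (s := cap v)) subset_rfl) hC₁ hC₂ hop.measurableSet
    (hop.measure_pos volume (cap_inter_nonempty h)).ne' ?_ (volume_cap_ne_top v')
  exact ((measure_mono inter_subset_left).trans_lt (volume_cap_ne_top v).lt_top).ne

/-- In dimension at least two, opposite caps are connected through a third one. -/
lemma exists_diffBound_cap_cap {q : ℝ} (hq : 1 < q) (hn : 2 ≤ n) (v v' : Fin n × ℤˣ) :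
    ∃ C ≠ (⊤ : ℝ≥0∞), DiffBound m q (cap v) (cap v') C := by
  by_cases h : v.1 = v'.1 → v.2 = v'.2
  · exact exists_diffBound_cap_of_overlap hq h
  · have : Nontrivial (Fin n) := Fin.nontrivial_iff_two_le.2 hn
    obtain ⟨i, hi⟩ := exists_ne v.1
    push Not at h
    obtain ⟨C₁, hC₁, h₁⟩ := exists_diffBound_cap_of_overlap (m := m) hq (v := v) (v' := (i, 1))
      (fun h => absurd h.symm hi)
    obtain ⟨C₂, hC₂, h₂⟩ := exists_diffBound_cap_of_overlap (m := m) hq (v := (i, 1)) (v' := v')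
      (fun h' => absurd (h'.trans h.1.symm) hi)
    have hne : (cap ((i, 1) : Fin n × ℤˣ)).Nonempty := by
      simpa using cap_inter_nonempty (v := (i, 1)) (v' := (i, 1)) (fun _ => rfl)
    exact h₁.trans hq h₂ hC₁ hC₂ (isOpen_cap _).measurableSet
      ((isOpen_cap _).measure_pos volume hne).ne' (volume_cap_ne_top _) (volume_cap_ne_top _)

lemma exists_diffBound_ring {q : ℝ} (hq : 1 < q) (hn : 2 ≤ n) :
    ∃ C ≠ (⊤ : ℝ≥0∞), DiffBound m q (ring (0 : Vec n) (1 / 2) 1) (ring 0 (1 / 2) 1) C := by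
  choose C hC h using exists_diffBound_cap_cap (m := m) hq hn
  refine ⟨∑ v, ∑ v', C v v', by simp [hC], ?_⟩
  intro φ hφ E hE hEm τ hτ hτ1
  have hd := measurable_enorm_sub_rpow q hφ.continuous
  have hEU : E ⊆ ⋃ v, E ∩ cap v := by
    rw [← inter_iUnion]
    exact subset_inter subset_rfl (hE.trans ring_subset_iUnion_cap)
  calc ∫⁻ y in E, ∫⁻ z in ring 0 (1 / 2) 1, ‖φ y - φ z‖ₑ ^ q
      ≤ ∫⁻ y in ⋃ v, E ∩ cap v, ∫⁻ z in ⋃ v', cap v', ‖φ y - φ z‖ₑ ^ q :=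
        (lintegral_mono_set hEU).trans (lintegral_mono fun y =>
          lintegral_mono_set ring_subset_iUnion_cap)
    _ ≤ ∑ v, ∫⁻ y in E ∩ cap v, ∑ v', ∫⁻ z in cap v', ‖φ y - φ z‖ₑ ^ q := by
        refine (lintegral_iUnion_le _ _).trans ?_
        rw [tsum_fintype]
        refine Finset.sum_le_sum fun v _ => lintegral_mono fun y => ?_
        refine (lintegral_iUnion_le _ _).trans ?_
        rw [tsum_fintype]
    _ = ∑ v, ∑ v', ∫⁻ y in E ∩ cap v, ∫⁻ z in cap v', ‖φ y - φ z‖ₑ ^ q := by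
        refine Finset.sum_congr rfl fun v _ => ?_
        rw [lintegral_finsetSum]
        exact fun v' _ => hd.lintegral_prod_right'
    _ ≤ ∑ v, ∑ v', C v v' * (ENNReal.ofReal τ + volume E * ENNReal.ofReal (τ ^ n)⁻¹) *
        ∫⁻ x in ring 0 (2 ^ (n + 1))⁻¹ 1, ‖classicalGrad φ x‖ₑ ^ q := by
        refine Finset.sum_le_sum fun v _ => Finset.sum_le_sum fun v' _ => ?_
        refine (h v v' φ hφ (E ∩ cap v) inter_subset_right
          (hEm.inter (isOpen_cap v).measurableSet) τ hτ hτ1).trans ?_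
        gcongr
        exact inter_subset_left
    _ = _ := by simp_rw [← Finset.sum_mul]

lemma eLpNorm_rpow {α E : Type*} [MeasurableSpace α] {μ : Measure α} [NormedAddCommGroup E]
    {q : ℝ} (hq : 1 < q) (f : α → E) :
    eLpNorm f (ENNReal.ofReal q) μ ^ q = ∫⁻ x, ‖f x‖ₑ ^ q ∂μ := by
  have h0 : ENNReal.ofReal q ≠ 0 := by simp; linarith
  rw [eLpNorm_eq_lintegral_rpow_enorm_toReal h0 ENNReal.ofReal_ne_top,
    ENNReal.toReal_ofReal (by linarith), ← ENNReal.rpow_mul, one_div_mul_cancel (by linarith),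
    ENNReal.rpow_one]

section Average

variable {α E : Type*} [MeasurableSpace α] {μ : Measure α} [NormedAddCommGroup E] [NormedSpace ℝ E]
  {q : ℝ}

lemma enorm_average_rpow_le (hq : 1 < q) {f : α → E} (hf : AEStronglyMeasurable f μ)
    (h0 : μ univ ≠ 0) (ht : μ univ ≠ ⊤) :
    ‖⨍ x, f x ∂μ‖ₑ ^ q ≤ (μ univ)⁻¹ * ∫⁻ x, ‖f x‖ₑ ^ q ∂μ := by
  have h := enorm_integral_rpow_le hq (hf.smul_measure (μ univ)⁻¹)
  rw [Measure.smul_apply, smul_eq_mul, ENNReal.inv_mul_cancel h0 ht, ENNReal.one_rpow, one_mul,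
    lintegral_smul_measure] at h
  exact h

lemma enorm_sub_average_rpow_le [CompleteSpace E] (hq : 1 < q) {f : α → E} (hf : Integrable f μ)
    (h0 : μ univ ≠ 0) (ht : μ univ ≠ ⊤) (c : E) :
    ‖c - ⨍ x, f x ∂μ‖ₑ ^ q ≤ (μ univ)⁻¹ * ∫⁻ x, ‖c - f x‖ₑ ^ q ∂μ := by
  have : IsFiniteMeasure μ := ⟨ht.lt_top⟩
  have : NeZero μ := ⟨fun h => h0 (by simp [h])⟩
  have e : c - ⨍ x, f x ∂μ = ⨍ x, (c - f x) ∂μ := by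
    conv_lhs => rw [← average_const μ c]
    simp only [average_eq]
    rw [integral_sub (integrable_const c) hf, smul_sub]
  rw [e]
  exact enorm_average_rpow_le hq (aestronglyMeasurable_const.sub hf.1) h0 ht

end Average

section Scaling

variable {q : ℝ}

lemma setLIntegral_comp_affine {ρ : ℝ} (hρ : 0 < ρ) (a : Vec n) {S : Set (Vec n)}
    (hS : MeasurableSet S) {h : Vec n → ℝ≥0∞} (hh : Measurable h) :
    ∫⁻ y in S, h y = ENNReal.ofReal (ρ ^ n) *
      ∫⁻ z in (fun z => a + ρ • z) ⁻¹' S, h (a + ρ • z) := by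
  have h1 := lintegral_add_smul_right hρ (hh.indicator hS) a
  rw [lintegral_indicator hS] at h1
  have hm : MeasurableSet ((fun z : Vec n => a + ρ • z) ⁻¹' S) :=
    (by fun_prop : Measurable fun z : Vec n => a + ρ • z) hS
  rw [← lintegral_indicator hm]
  have h2 : ∀ z, ((fun z => a + ρ • z) ⁻¹' S).indicator (fun z => h (a + ρ • z)) z =
      S.indicator h (a + ρ • z) := fun z => rfl
  simp_rw [h2]
  rw [h1, ← mul_assoc, ← ENNReal.ofReal_mul (by positivity), mul_inv_cancel₀ (by positivity),
    ENNReal.ofReal_one, one_mul]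

lemma volume_comp_affine {ρ : ℝ} (hρ : 0 < ρ) (a : Vec n) {S : Set (Vec n)}
    (hS : MeasurableSet S) :
    volume S = ENNReal.ofReal (ρ ^ n) * volume ((fun z => a + ρ • z) ⁻¹' S) := by
  simpa using setLIntegral_comp_affine hρ a hS (h := fun _ => 1) measurable_const

lemma preimage_ring {ρ : ℝ} (hρ : 0 < ρ) (a : Vec n) (r R : ℝ) :
    (fun z => a + ρ • z) ⁻¹' ring a (r * ρ) (R * ρ) = ring 0 r R := by
  ext z
  simp only [ring, mem_preimage, mem_ofPred_eq, add_sub_cancel_left, norm_smul, Real.norm_eq_abs,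
    abs_of_pos hρ, sub_zero]
  rw [mul_comm ρ, mul_lt_mul_iff_left₀ hρ, mul_lt_mul_iff_left₀ hρ]

lemma classicalGrad_comp_affine {φ : Vec n → Vec m} (hφ : ContDiff ℝ ∞ φ) (a : Vec n) (ρ : ℝ)
    (z : Vec n) :
    classicalGrad (fun z => φ (a + ρ • z)) z = ρ • classicalGrad φ (a + ρ • z) := by
  have h1 : HasFDerivAt (fun z : Vec n => a + ρ • z) (ρ • ContinuousLinearMap.id ℝ (Vec n)) z :=
    ((hasFDerivAt_id z).const_smul ρ).const_add a
  have h2 := ((hφ.differentiable (by simp) (a + ρ • z)).hasFDerivAt.comp z h1).fderiv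
  ext ia
  rw [classicalGrad_apply]
  change fderiv ℝ (φ ∘ fun z => a + ρ • z) z _ _ = _
  rw [h2]
  simp

/-- The bound for differences in annuli of arbitrary centre and radius. -/
lemma DiffBound.scale (hq : 1 < q) {C : ℝ≥0∞}
    (hC : DiffBound m q (ring (0 : Vec n) (1 / 2) 1) (ring 0 (1 / 2) 1) C)
    {φ : Vec n → Vec m} (hφ : ContDiff ℝ ∞ φ) (a : Vec n) {ρ : ℝ} (hρ : 0 < ρ)
    {E : Set (Vec n)} (hE : E ⊆ ring a (1 / 2 * ρ) (1 * ρ)) (hEm : MeasurableSet E)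
    {τ : ℝ} (hτ : 0 < τ) (hτ1 : τ ≤ 1) :
    ∫⁻ y in E, ∫⁻ z in ring a (1 / 2 * ρ) (1 * ρ), ‖φ y - φ z‖ₑ ^ q ≤
      ENNReal.ofReal (ρ ^ n) * (C * ENNReal.ofReal ρ ^ q *
        (ENNReal.ofReal τ + volume E * ENNReal.ofReal ((ρ * τ) ^ n)⁻¹) *
        ∫⁻ x in ring a ((2 ^ (n + 1))⁻¹ * ρ) (1 * ρ), ‖classicalGrad φ x‖ₑ ^ q) := by
  have hd := measurable_enorm_sub_rpow q hφ.continuous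
  set T : Vec n → Vec n := fun z => a + ρ • z with hT
  have hTm : Measurable T := by fun_prop
  set E' := T ⁻¹' E with hE'
  have hEsub : E' ⊆ ring 0 (1 / 2) 1 := by
    rw [← preimage_ring hρ a]
    exact preimage_mono hE
  have hψ : ContDiff ℝ ∞ fun z => φ (T z) := hφ.comp (by fun_prop)
  have key := hC (fun z => φ (T z)) hψ E' hEsub (hTm hEm) τ hτ hτ1
  set c := ENNReal.ofReal (ρ ^ n) with hc
  have hc0 : c ≠ 0 := by
    rw [hc]; simp only [ne_eq, ENNReal.ofReal_eq_zero, not_le]; positivity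
  have hct : c ≠ ⊤ := ENNReal.ofReal_ne_top
  have e1 : ∀ y, ∫⁻ z in ring a (1 / 2 * ρ) (1 * ρ), ‖φ y - φ z‖ₑ ^ q =
      c * ∫⁻ z in ring 0 (1 / 2) 1, ‖φ y - φ (T z)‖ₑ ^ q := by
    intro y
    rw [setLIntegral_comp_affine hρ a (isOpen_ring _ _ _).measurableSet
      (measurable_enorm_const_sub_rpow q hφ.continuous y), preimage_ring hρ]
  have e2 : ∫⁻ y in E, ∫⁻ z in ring a (1 / 2 * ρ) (1 * ρ), ‖φ y - φ z‖ₑ ^ q =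
      c * (c * ∫⁻ y in E', ∫⁻ z in ring 0 (1 / 2) 1, ‖φ (T y) - φ (T z)‖ₑ ^ q) := by
    rw [setLIntegral_comp_affine hρ a hEm hd.lintegral_prod_right']
    congr 1
    rw [← lintegral_const_mul' _ _ hct]
    refine lintegral_congr fun y => ?_
    exact e1 (T y)
  have e3 : ∫⁻ x in ring a ((2 ^ (n + 1))⁻¹ * ρ) (1 * ρ), ‖classicalGrad φ x‖ₑ ^ q =
      c * ∫⁻ z in ring 0 (2 ^ (n + 1))⁻¹ 1, ‖classicalGrad φ (T z)‖ₑ ^ q := by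
    rw [setLIntegral_comp_affine hρ a (isOpen_ring _ _ _).measurableSet
      ((continuous_classicalGrad hφ).measurable.enorm.pow_const q), preimage_ring hρ]
  have e4 : ∫⁻ z in ring 0 (2 ^ (n + 1))⁻¹ 1, ‖classicalGrad (fun z => φ (T z)) z‖ₑ ^ q =
      ENNReal.ofReal ρ ^ q *
        ∫⁻ z in ring 0 (2 ^ (n + 1))⁻¹ 1, ‖classicalGrad φ (T z)‖ₑ ^ q := by
    rw [← lintegral_const_mul' _ _ (ENNReal.rpow_ne_top_of_nonneg (by linarith)
      ENNReal.ofReal_ne_top)]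
    refine lintegral_congr fun z => ?_
    rw [classicalGrad_comp_affine hφ, enorm_smul, ENNReal.mul_rpow_of_nonneg _ _ (by linarith),
      Real.enorm_eq_ofReal hρ.le]
  have e5 : volume E' * ENNReal.ofReal (τ ^ n)⁻¹ =
      volume E * ENNReal.ofReal ((ρ * τ) ^ n)⁻¹ := by
    rw [volume_comp_affine hρ a hEm, mul_pow, mul_inv, ENNReal.ofReal_mul (by positivity), ← hT,
      ← hE', mul_comm (ENNReal.ofReal (ρ ^ n)), mul_assoc, ← mul_assoc (ENNReal.ofReal (ρ ^ n)),
      ← ENNReal.ofReal_mul (by positivity), mul_inv_cancel₀ (by positivity)]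
    simp
  rw [e2, e3, ← e5]
  rw [e4] at key
  refine mul_le_mul_right (a := c) ((mul_le_mul_right key c).trans (le_of_eq ?_))
  ring

/-- The Poincaré–Wirtinger inequality in an annulus, localized to a subset `E`. -/
lemma exists_poincare (hq : 1 < q) (hn : 2 ≤ n) (m : ℕ) : ∃ C ≠ (⊤ : ℝ≥0∞),
    ∀ (D : Set (Vec n)) (u : Vec n → Vec m) (G : Vec n → Mat m n), IsW01Pair q D u G →
    ∀ (a : Vec n) (ρ : ℝ), 0 < ρ → ring a ((2 ^ (n + 1))⁻¹ * ρ) ρ ⊆ D →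
    ∀ E ⊆ ring a (ρ / 2) ρ, MeasurableSet E → ∀ τ : ℝ, 0 < τ → τ ≤ 1 →
    ∫⁻ y in E, ‖u y - ⨍ z in ring a (ρ / 2) ρ, u z‖ₑ ^ q ≤
      C * ENNReal.ofReal ρ ^ q *
        (ENNReal.ofReal τ + volume E * ENNReal.ofReal ((ρ * τ) ^ n)⁻¹) *
        ∫⁻ x in ring a ((2 ^ (n + 1))⁻¹ * ρ) ρ, ‖G x‖ₑ ^ q := by
  obtain ⟨C, hCt, hC⟩ := exists_diffBound_ring (m := m) hq hn
  set v₁ := volume (ring (0 : Vec n) (1 / 2) 1) with hv₁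
  have hv₁0 : v₁ ≠ 0 := by
    refine ((isOpen_ring _ _ _).measure_pos volume ?_).ne'
    refine ⟨EuclideanSpace.single ⟨0, by omega⟩ (3 / 4 : ℝ), ?_⟩
    simp only [ring, mem_ofPred_eq, sub_zero, PiLp.norm_single, Real.norm_eq_abs]
    norm_num
  have hv₁t : v₁ ≠ ⊤ := (volume_ring_lt_top _ _ _).ne
  refine ⟨v₁⁻¹ * C, ENNReal.mul_ne_top (ENNReal.inv_ne_top.2 hv₁0) hCt, ?_⟩
  intro D u G hu a ρ hρ hRD E hE hEm τ hτ hτ1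
  have hq1 := one_le_ofReal hq
  obtain ⟨φ, hφ, hφu, hφG⟩ := hu.approx
  have hr1 : ring a (ρ / 2) ρ = ring a (1 / 2 * ρ) (1 * ρ) := by rw [one_mul]; congr 1; ring
  have hr2 : ring a ((2 ^ (n + 1))⁻¹ * ρ) ρ = ring a ((2 ^ (n + 1))⁻¹ * ρ) (1 * ρ) := by
    rw [one_mul]
  set R := ring a (ρ / 2) ρ with hR
  set R' := ring a ((2 ^ (n + 1))⁻¹ * ρ) ρ with hR'
  have hRm : MeasurableSet R := (isOpen_ring _ _ _).measurableSet
  have hsmall : (2 ^ (n + 1) : ℝ)⁻¹ ≤ 1 / 2 := by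
    have : (2 : ℝ) ^ 1 ≤ 2 ^ (n + 1) := pow_le_pow_right₀ (by norm_num) (by omega)
    rw [one_div]
    exact inv_anti₀ (by norm_num) (by linarith)
  have hRR' : R ⊆ R' := by
    intro y hy
    refine ⟨lt_of_le_of_lt ?_ hy.1, hy.2⟩
    nlinarith
  have hRsD : R ⊆ D := hRR'.trans hRD
  have hvolR : volume R = ENNReal.ofReal (ρ ^ n) * v₁ := by
    rw [hv₁, ← preimage_ring hρ a, ← hr1]
    exact volume_comp_affine hρ a hRm
  have hR0 : volume R ≠ 0 := by
    rw [hvolR]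
    refine mul_ne_zero ?_ hv₁0
    simp only [ne_eq, ENNReal.ofReal_eq_zero, not_le]; positivity
  have hRt : volume R ≠ ⊤ := (volume_ring_lt_top _ _ _).ne
  have : IsFiniteMeasure (volume.restrict R) := ⟨by simpa using hRt.lt_top⟩
  have hleD : ∀ {S : Set (Vec n)}, S ⊆ D → volume.restrict S ≤ volume.restrict D :=
    fun h => Measure.restrict_mono h le_rfl
  have hcont : ∀ l, Continuous (φ l) := fun l => (hφ l).1.continuous
  have hmφ : ∀ l, MemLp (φ l) (ENNReal.ofReal q) volume := fun l =>
    (hcont l).memLp_of_hasCompactSupport (hφ l).2.1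
  have huR : MemLp u (ENNReal.ofReal q) (volume.restrict R) := hu.memLp.mono_measure (hleD hRsD)
  have hφint : ∀ l, Integrable (φ l) (volume.restrict R) := fun l =>
    ((hmφ l).restrict R).integrable hq1
  have huint : Integrable u (volume.restrict R) := huR.integrable hq1
  set K : ℝ≥0∞ := v₁⁻¹ * C * ENNReal.ofReal ρ ^ q *
        (ENNReal.ofReal τ + volume E * ENNReal.ofReal ((ρ * τ) ^ n)⁻¹) with hK
  have hKt : K ≠ ⊤ := by
    have h1 : ENNReal.ofReal ρ ^ q ≠ ⊤ :=
      ENNReal.rpow_ne_top_of_nonneg (by linarith) ENNReal.ofReal_ne_top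
    have h2 : v₁⁻¹ ≠ ⊤ := ENNReal.inv_ne_top.2 hv₁0
    have h3 : volume E ≠ ⊤ := ((measure_mono hE).trans_lt hRt.lt_top).ne
    finiteness
  -- the inequality for the smooth approximations
  have hsm : ∀ l, ∫⁻ y in E, ‖φ l y - ⨍ z in R, φ l z‖ₑ ^ q ≤
      K * ∫⁻ x in R', ‖classicalGrad (φ l) x‖ₑ ^ q := by
    intro l
    have h1 : ∫⁻ y in E, ‖φ l y - ⨍ z in R, φ l z‖ₑ ^ q ≤
        (volume R)⁻¹ * ∫⁻ y in E, ∫⁻ z in R, ‖φ l y - φ l z‖ₑ ^ q := by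
      rw [← lintegral_const_mul' _ _ (ENNReal.inv_ne_top.2 hR0)]
      refine lintegral_mono fun y => ?_
      have := enorm_sub_average_rpow_le hq (hφint l) (by simpa using hR0) (by simpa using hRt)
        (φ l y)
      simpa using this
    have h2 := hC.scale hq (hφ l).1 a hρ (hE.trans hr1.subset) hEm hτ hτ1
    rw [← hr1, ← hr2] at h2
    refine (h1.trans (mul_le_mul_right h2 _)).trans (le_of_eq ?_)
    have hc0 : ENNReal.ofReal (ρ ^ n) ≠ 0 := by
      simp only [ne_eq, ENNReal.ofReal_eq_zero, not_le]; positivity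
    rw [hvolR, ENNReal.mul_inv (Or.inl hc0) (Or.inl ENNReal.ofReal_ne_top), hK]
    calc _ = ((ENNReal.ofReal (ρ ^ n))⁻¹ * ENNReal.ofReal (ρ ^ n)) *
          (v₁⁻¹ * C * ENNReal.ofReal ρ ^ q *
            (ENNReal.ofReal τ + volume E * ENNReal.ofReal ((ρ * τ) ^ n)⁻¹) *
            ∫⁻ x in R', ‖classicalGrad (φ l) x‖ₑ ^ q) := by ring
      _ = _ := by rw [ENNReal.inv_mul_cancel hc0 ENNReal.ofReal_ne_top, one_mul]
  have hq0 : (0 : ℝ) < q := by linarith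
  set p := ENNReal.ofReal q with hp
  set d : ℕ → ℝ≥0∞ := fun l => eLpNorm (fun x => φ l x - u x) p (volume.restrict D) with hd
  set d' : ℕ → ℝ≥0∞ := fun l => eLpNorm (fun x => classicalGrad (φ l) x - G x) p
    (volume.restrict D) with hd'
  have hbound : ∀ l, eLpNorm (fun y => u y - ⨍ z in R, u z) p (volume.restrict E) ≤
      d l + (K ^ (1 / q) * (d' l + eLpNorm G p (volume.restrict R')) + d l) := by
    intro l
    have t1 : eLpNorm (fun y => u y - φ l y) p (volume.restrict E) ≤ d l := by
      rw [hd]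
      have : (fun y => u y - φ l y) = -(fun y => φ l y - u y) := by funext; simp
      rw [this, eLpNorm_neg]
      exact eLpNorm_mono_measure _ (hleD (hE.trans hRsD))
    have t2 : eLpNorm (fun y => φ l y - ⨍ z in R, φ l z) p (volume.restrict E) ≤
        K ^ (1 / q) * (d' l + eLpNorm G p (volume.restrict R')) := by
      have s1 : eLpNorm (fun y => φ l y - ⨍ z in R, φ l z) p (volume.restrict E) ≤
          K ^ (1 / q) * eLpNorm (classicalGrad (φ l)) p (volume.restrict R') := by
        rw [← ENNReal.rpow_le_rpow_iff hq0, ENNReal.mul_rpow_of_nonneg _ _ hq0.le,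
          ← ENNReal.rpow_mul, one_div_mul_cancel hq0.ne', ENNReal.rpow_one, eLpNorm_rpow hq,
          eLpNorm_rpow hq]
        exact hsm l
      refine s1.trans (mul_le_mul_right ?_ _)
      have hGR : AEStronglyMeasurable G (volume.restrict R') :=
        hu.memLp_grad.1.mono_measure (hleD hRD)
      have hgm := (continuous_classicalGrad (hφ l).1).aestronglyMeasurable
        (μ := volume.restrict R')
      have : classicalGrad (φ l) = (fun x => classicalGrad (φ l) x - G x) + G := by
        funext x; simp
      conv_lhs => rw [this]
      refine (eLpNorm_add_le (hgm.sub hGR) hGR hq1).trans ?_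
      gcongr
      exact eLpNorm_mono_measure _ (hleD hRD)
    have t3 : eLpNorm (fun _ : Vec n => (⨍ z in R, φ l z) - ⨍ z in R, u z) p (volume.restrict E) ≤
        d l := by
      have e : (⨍ z in R, φ l z) - ⨍ z in R, u z = ⨍ z in R, (φ l z - u z) := by
        simp only [average_eq]
        rw [integral_sub (hφint l) huint, smul_sub]
      rw [e, ← ENNReal.rpow_le_rpow_iff hq0, eLpNorm_rpow hq, setLIntegral_const]
      have h1 := enorm_average_rpow_le hq ((hφint l).1.sub huint.1) (by simpa using hR0)
        (by simpa using hRt)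
      simp only [Measure.restrict_apply_univ] at h1
      calc _ ≤ ((volume R)⁻¹ * ∫⁻ z in R, ‖φ l z - u z‖ₑ ^ q) * volume R := by
            refine mul_le_mul' h1 (measure_mono hE)
        _ = ∫⁻ z in R, ‖φ l z - u z‖ₑ ^ q := by
            rw [mul_comm, ← mul_assoc, ENNReal.mul_inv_cancel hR0 hRt, one_mul]
        _ ≤ _ := by
            rw [hd, eLpNorm_rpow hq]
            exact lintegral_mono' (hleD hRsD) le_rfl
    have hsplit : (fun y => u y - ⨍ z in R, u z) = (fun y => u y - φ l y) +
        ((fun y => φ l y - ⨍ z in R, φ l z) +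
          fun _ : Vec n => (⨍ z in R, φ l z) - ⨍ z in R, u z) := by
      funext y; simp
    rw [hsplit]
    have huE : AEStronglyMeasurable u (volume.restrict E) :=
      hu.memLp.1.mono_measure (hleD (hE.trans hRsD))
    have hφE := (hcont l).aestronglyMeasurable (μ := volume.restrict E)
    refine (eLpNorm_add_le (huE.sub hφE) ((hφE.sub aestronglyMeasurable_const).add
      aestronglyMeasurable_const) hq1).trans (add_le_add t1 ?_)
    exact (eLpNorm_add_le (hφE.sub aestronglyMeasurable_const)
      aestronglyMeasurable_const hq1).trans (add_le_add t2 t3)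
  have hlim : Tendsto (fun l => d l +
      (K ^ (1 / q) * (d' l + eLpNorm G p (volume.restrict R')) + d l)) atTop
      (𝓝 (0 + (K ^ (1 / q) * (0 + eLpNorm G p (volume.restrict R')) + 0))) :=
    hφu.add ((ENNReal.Tendsto.const_mul (hφG.add tendsto_const_nhds)
      (Or.inr (ENNReal.rpow_ne_top_of_nonneg (by positivity) hKt))).add hφu)
  have hfin := ge_of_tendsto' hlim hbound
  rw [zero_add, zero_add, add_zero, ← ENNReal.rpow_le_rpow_iff hq0,
    ENNReal.mul_rpow_of_nonneg _ _ hq0.le, ← ENNReal.rpow_mul, one_div_mul_cancel hq0.ne',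
    ENNReal.rpow_one, eLpNorm_rpow hq, eLpNorm_rpow hq] at hfin
  exact hfin

end Scaling

/-! ### Weak convergence -/

section Dual

variable {α V : Type*} [MeasurableSpace α] {μ : Measure α} [NormedAddCommGroup V]
  [InnerProductSpace ℝ V] {q : ℝ}

/-- The test function `|v|^{q-2} v` recovers the norm of `v ∈ L^q`. -/
lemma eLpNorm_le_of_pairing_le (hq : 1 < q) {v : α → V} (hv : MemLp v (ENNReal.ofReal q) μ)
    {C : ℝ≥0∞} (h : ∀ g : α → V, MemLp g (ENNReal.ofReal (q / (q - 1))) μ →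
      ‖∫ x, inner ℝ (v x) (g x) ∂μ‖ₑ ≤ C * eLpNorm g (ENNReal.ofReal (q / (q - 1))) μ) :
    eLpNorm v (ENNReal.ofReal q) μ ≤ C := by
  have hq' : 1 < q / (q - 1) := by rw [lt_div_iff₀ (by linarith)]; linarith
  have hq0 : 0 < q - 1 := by linarith
  set N := eLpNorm v (ENNReal.ofReal q) μ with hN
  have hNt : N ≠ ⊤ := hv.eLpNorm_ne_top
  rcases eq_or_ne N 0 with hN0 | hN0
  · rw [hN0]; exact zero_le
  set g : α → V := fun x => ‖v x‖ ^ (q - 2) • v x with hg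
  have hgnorm : ∀ x, ‖g x‖ = ‖v x‖ ^ (q - 1) := by
    intro x
    rw [hg, norm_smul, Real.norm_eq_abs, abs_of_nonneg (by positivity)]
    rcases (norm_nonneg (v x)).eq_or_lt with h0 | h0
    · rw [← h0, mul_zero, Real.zero_rpow hq0.ne']
    · rw [← Real.rpow_add_one h0.ne']; congr 1; ring
  have hgm : AEStronglyMeasurable g μ :=
    (hv.1.norm.aemeasurable.pow_const (q - 2)).aestronglyMeasurable.smul hv.1
  have hgpow : eLpNorm g (ENNReal.ofReal (q / (q - 1))) μ ^ (q / (q - 1)) = N ^ q := by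
    rw [eLpNorm_rpow hq', hN, eLpNorm_rpow hq]
    refine lintegral_congr fun x => ?_
    rw [← ofReal_norm, hgnorm, ← ENNReal.ofReal_rpow_of_nonneg (norm_nonneg _) hq0.le, ofReal_norm,
      ← ENNReal.rpow_mul]
    congr 1
    field_simp
  have hgN : eLpNorm g (ENNReal.ofReal (q / (q - 1))) μ = N ^ (q - 1) := by
    refine ENNReal.rpow_left_injective (by linarith : q / (q - 1) ≠ 0) ?_
    simp only
    rw [hgpow, ← ENNReal.rpow_mul]
    congr 1
    field_simp
  have hgL : MemLp g (ENNReal.ofReal (q / (q - 1))) μ := by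
    refine ⟨hgm, ?_⟩
    rw [hgN]
    exact (ENNReal.rpow_ne_top_of_nonneg hq0.le hNt).lt_top
  have hpair : ‖∫ x, inner ℝ (v x) (g x) ∂μ‖ₑ = N ^ q := by
    have e : ∀ x, inner ℝ (v x) (g x) = ‖v x‖ ^ q := by
      intro x
      rw [hg, inner_smul_right, real_inner_self_eq_norm_sq]
      rcases (norm_nonneg (v x)).eq_or_lt with h0 | h0
      · rw [← h0, Real.zero_rpow (by linarith : q ≠ 0)]; simp
      · rw [← Real.rpow_natCast, ← Real.rpow_add h0]; congr 1; push_cast; ring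
    simp_rw [e]
    rw [Real.enorm_eq_ofReal (integral_nonneg fun x => by positivity)]
    rw [ofReal_integral_eq_lintegral_ofReal]
    · rw [hN, eLpNorm_rpow hq]
      refine lintegral_congr fun x => ?_
      rw [← ofReal_norm, ENNReal.ofReal_rpow_of_nonneg (norm_nonneg _) (by linarith)]
    · have := hv.integrable_norm_rpow (by simp; linarith) ENNReal.ofReal_ne_top
      rwa [ENNReal.toReal_ofReal (by linarith)] at this
    · exact Eventually.of_forall fun x => by positivity
  have hfin := h g hgL
  rw [hpair, hgN] at hfin
  have hsplit : N ^ q = N * N ^ (q - 1) := by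
    have h1 := ENNReal.rpow_add 1 (q - 1) hN0 hNt
    rwa [add_sub_cancel, ENNReal.rpow_one] at h1
  rw [hsplit] at hfin
  have hp0 : N ^ (q - 1) ≠ 0 := by simp [hN0, hNt]
  have hpt : N ^ (q - 1) ≠ ⊤ := ENNReal.rpow_ne_top_of_nonneg hq0.le hNt
  exact (ENNReal.mul_le_mul_iff_left hp0 hpt).1 hfin

/-- Weakly convergent sequences are bounded. -/
lemma WeakTendstoLp.iSup_eLpNorm_lt_top [CompleteSpace V] (hq : 1 < q) {D : Set (Vec n)}
    {v : ℕ → Vec n → V} {v₀ : Vec n → V}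
    (hv : ∀ j, MemLp (v j) (ENNReal.ofReal q) (volume.restrict D))
    (h : WeakTendstoLp q D v v₀) :
    ⨆ j, eLpNorm (v j) (ENNReal.ofReal q) (volume.restrict D) < ⊤ := by
  have hq' : 1 < q / (q - 1) := by rw [lt_div_iff₀ (by linarith)]; linarith
  have hc := holderConjugate_ofReal hq
  have : Fact (1 ≤ ENNReal.ofReal q) := ⟨one_le_ofReal hq⟩
  have : Fact (1 ≤ ENNReal.ofReal (q / (q - 1))) := ⟨one_le_ofReal hq'⟩
  set p := ENNReal.ofReal q
  set p' := ENNReal.ofReal (q / (q - 1))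
  let T : ℕ → Lp V p' (volume.restrict D) →ₗ[ℝ] ℝ := fun j =>
    { toFun := fun g => ∫ x in D, inner ℝ (v j x) (g x)
      map_add' := fun g g' => by
        rw [← integral_add (integrable_inner_of_memLp hq (hv j) (Lp.memLp g))
          (integrable_inner_of_memLp hq (hv j) (Lp.memLp g'))]
        refine integral_congr_ae ?_
        filter_upwards [Lp.coeFn_add g g'] with x hx
        rw [hx, Pi.add_apply, inner_add_right]
      map_smul' := fun c g => by
        rw [RingHom.id_apply, smul_eq_mul, ← integral_const_mul]
        refine integral_congr_ae ?_
        filter_upwards [Lp.coeFn_smul c g] with x hx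
        rw [hx, Pi.smul_apply, inner_smul_right] }
  have hT : ∀ j g, ‖T j g‖ ≤ (eLpNorm (v j) p (volume.restrict D)).toReal * ‖g‖ := by
    intro j g
    have h1 := enorm_integral_inner_le hq (hv j).1 (Lp.memLp g).1
    rw [Lp.norm_def, ← ENNReal.toReal_mul, ← toReal_enorm]
    exact ENNReal.toReal_mono (ENNReal.mul_ne_top (hv j).eLpNorm_ne_top
      (Lp.memLp g).eLpNorm_ne_top) h1
  obtain ⟨C, hC⟩ := banach_steinhaus (g := fun j => (T j).mkContinuous _ (hT j)) (by
    intro g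
    obtain ⟨C, hC⟩ := (h g (Lp.memLp g)).norm.bddAbove_range
    exact ⟨C, fun j => hC ⟨j, rfl⟩⟩)
  refine lt_of_le_of_lt (iSup_le fun j => ?_) (ENNReal.ofReal_lt_top (r := C))
  refine eLpNorm_le_of_pairing_le hq (hv j) fun g hg => ?_
  have h1 := ((T j).mkContinuous _ (hT j)).le_of_opNorm_le (hC j) (hg.toLp g)
  have h2 : (T j).mkContinuous _ (hT j) (hg.toLp g) = ∫ x in D, inner ℝ (v j x) (g x) := by
    refine integral_congr_ae ?_
    filter_upwards [hg.coeFn_toLp] with x hx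
    rw [hx]
  rw [h2, Lp.norm_toLp] at h1
  have hC0 : 0 ≤ C := (norm_nonneg _).trans (hC j)
  rw [← ofReal_norm]
  refine (ENNReal.ofReal_le_ofReal h1).trans (le_of_eq ?_)
  rw [ENNReal.ofReal_mul hC0, ENNReal.ofReal_toReal hg.eLpNorm_ne_top]

lemma WeakTendstoLp.add_of_tendsto_zero (hq : 1 < q) {D : Set (Vec n)}
    {v h : ℕ → Vec n → V} {v₀ : Vec n → V}
    (hv : ∀ j, MemLp (v j) (ENNReal.ofReal q) (volume.restrict D))
    (hh : ∀ j, MemLp (h j) (ENNReal.ofReal q) (volume.restrict D))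
    (hw : WeakTendstoLp q D v v₀) (h0 : WeakTendstoLp q D h 0) {w : ℕ → Vec n → V}
    (hadd : ∀ j, w j =ᵐ[volume.restrict D] v j + h j) :
    WeakTendstoLp q D w v₀ := by
  intro φ hφ
  have h1 := (hw φ hφ).add (h0 φ hφ)
  simp only [Pi.zero_apply, inner_zero_left, integral_zero, add_zero] at h1
  refine h1.congr fun j => ?_
  rw [← integral_add (integrable_inner_of_memLp hq (hv j) hφ)
    (integrable_inner_of_memLp hq (hh j) hφ)]
  refine integral_congr_ae ?_
  filter_upwards [hadd j] with x hx
  rw [hx, Pi.add_apply, inner_add_left]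

lemma weakTendstoLp_zero_of_tendsto (hq : 1 < q) {D : Set (Vec n)} {v : ℕ → Vec n → V}
    (hv : ∀ j, MemLp (v j) (ENNReal.ofReal q) (volume.restrict D))
    (h : Tendsto (fun j => eLpNorm (v j) (ENNReal.ofReal q) (volume.restrict D)) atTop (𝓝 0)) :
    WeakTendstoLp q D v 0 := fun _ hφ =>
  tendsto_integral_inner hq hv MemLp.zero hφ (by simpa using h)

end Dual

/-- If `v_j → 0` in `L^q` and the gradients are bounded in `L^q`, they converge weakly to `0`:
test functions are approximated by smooth ones, for which the gradient is integrated by parts. -/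
lemma weakTendstoLp_grad_zero {q : ℝ} (hq : 1 < q) {D : Set (Vec n)} (hD : IsOpen D)
    {v : ℕ → Vec n → Vec m} {H : ℕ → Vec n → Mat m n} (hv : ∀ j, IsW01Pair q D (v j) (H j))
    (h0 : Tendsto (fun j => eLpNorm (v j) (ENNReal.ofReal q) (volume.restrict D)) atTop (𝓝 0))
    {B : ℝ≥0} (hB : ∀ j, eLpNorm (H j) (ENNReal.ofReal q) (volume.restrict D) ≤ B) :
    WeakTendstoLp q D H 0 := by
  have hq' : 1 < q / (q - 1) := by rw [lt_div_iff₀ (by linarith)]; linarith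
  -- smooth test functions
  have hsmooth : ∀ g : Vec n → Mat m n, HasCompactSupport g → ContDiff ℝ ∞ g →
      Tendsto (fun j => ∫ x in D, inner ℝ (H j x) (g x)) atTop (𝓝 0) := by
    intro g hgc hg
    have hgi : ∀ ia, ContDiff ℝ ∞ (fun x => g x ia) := fun ia => contDiff_euclidean.1 hg ia
    have hgci : ∀ ia, HasCompactSupport (fun x => g x ia) := fun ia =>
      hgc.mono fun x hx h => hx (by simp [h])
    have hcoord : ∀ ia, MemLp (fun x => EuclideanSpace.single ia (g x ia))
        (ENNReal.ofReal (q / (q - 1))) (volume.restrict D) := fun ia =>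
      MemLp.restrict D (Continuous.memLp_of_hasCompactSupport
        (continuous_euclideanSpace_single (hgi ia).continuous ia)
        ((hgci ia).mono fun x hx h => hx (by simp [h])))
    have hsum : ∀ j, ∫ x in D, inner ℝ (H j x) (g x) =
        ∑ ia : Fin m × Fin n, -∫ x in D, inner ℝ (v j x) (EuclideanSpace.single ia.1
          (fderiv ℝ (fun x => g x ia) x (EuclideanSpace.single ia.2 1))) := by
      intro j
      have e1 : ∀ x, inner ℝ (H j x) (g x) =
          ∑ ia, inner ℝ (H j x) (EuclideanSpace.single ia (g x ia)) := by
        intro x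
        simp only [EuclideanSpace.inner_single_right, conj_trivial]
        simp [PiLp.inner_apply]
      simp_rw [e1]
      rw [integral_finsetSum _ fun ia _ =>
        integrable_inner_of_memLp hq (hv j).memLp_grad (hcoord ia)]
      refine Finset.sum_congr rfl fun ia _ => ?_
      have := (hv j).integral_eq_of_hasCompactSupport hq (hgi ia) (hgci ia) ia.1 ia.2
      simp only [EuclideanSpace.inner_single_right, conj_trivial]
      simp only [mul_comm] at this ⊢
      rw [this, neg_neg]
    simp_rw [hsum]
    have : (0 : ℝ) = ∑ ia : Fin m × Fin n, -(0 : ℝ) := by simp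
    rw [this]
    refine tendsto_finsetSum _ fun ia _ => Tendsto.neg ?_
    have hψ1 : Continuous fun x =>
        fderiv ℝ (fun x => g x ia) x (EuclideanSpace.single ia.2 1) := by
      have := (hgi ia).continuous_fderiv (by simp)
      fun_prop
    have hmem : MemLp (fun x => EuclideanSpace.single ia.1
        (fderiv ℝ (fun x => g x ia) x (EuclideanSpace.single ia.2 1)))
        (ENNReal.ofReal (q / (q - 1))) (volume.restrict D) :=
      MemLp.restrict D (Continuous.memLp_of_hasCompactSupport
        (continuous_euclideanSpace_single hψ1 ia.1)
        (((hgci ia).fderiv (𝕜 := ℝ)).mono fun x hx h => hx (by simp [h])))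
    have := weakTendstoLp_zero_of_tendsto hq (fun j => (hv j).memLp) h0 _ hmem
    simpa using this
  intro φ hφ
  simp only [Pi.zero_apply, inner_zero_left, integral_zero]
  rw [Metric.tendsto_atTop]
  intro δ hδ
  have hφ' : MemLp (D.indicator φ) (ENNReal.ofReal (q / (q - 1))) volume :=
    (memLp_indicator_iff_restrict hD.measurableSet).2 hφ
  obtain ⟨g, hgc, hg, hgε⟩ := hφ'.exist_eLpNorm_sub_le ENNReal.ofReal_ne_top
    (one_le_ofReal hq') (ε := δ / (2 * (B + 1))) (by positivity)
  have hgL : MemLp g (ENNReal.ofReal (q / (q - 1))) (volume.restrict D) :=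
    (hg.continuous.memLp_of_hasCompactSupport hgc).restrict D
  obtain ⟨N, hN⟩ := Metric.tendsto_atTop.1 (hsmooth g hgc hg) (δ / 2) (by positivity)
  refine ⟨N, fun j hj => ?_⟩
  have h1 := hN j hj
  rw [dist_zero_right] at h1 ⊢
  have hsplit : ∫ x in D, inner ℝ (H j x) (φ x) =
      (∫ x in D, inner ℝ (H j x) ((φ - g) x)) + ∫ x in D, inner ℝ (H j x) (g x) := by
    rw [← integral_add (integrable_inner_of_memLp hq (hv j).memLp_grad (hφ.sub hgL))
      (integrable_inner_of_memLp hq (hv j).memLp_grad hgL)]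
    refine integral_congr_ae (Eventually.of_forall fun x => ?_)
    simp only [Pi.sub_apply]
    rw [← inner_add_right, sub_add_cancel]
  have h2 : ‖∫ x in D, inner ℝ (H j x) ((φ - g) x)‖ ≤ B * (δ / (2 * (B + 1))) := by
    have e1 := enorm_integral_inner_le hq (hv j).memLp_grad.1 (hφ.sub hgL).1
    have e2 : eLpNorm (φ - g) (ENNReal.ofReal (q / (q - 1))) (volume.restrict D) ≤
        ENNReal.ofReal (δ / (2 * (B + 1))) := by
      refine le_trans (le_of_eq ?_) ((eLpNorm_mono_measure _
        (Measure.restrict_le_self (s := D))).trans hgε)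
      refine eLpNorm_congr_ae ?_
      filter_upwards [ae_restrict_mem hD.measurableSet] with x hx
      simp [indicator_of_mem hx]
    have e3 := e1.trans (mul_le_mul' (hB j) e2)
    rw [← toReal_enorm]
    refine (ENNReal.toReal_mono (ENNReal.mul_ne_top ENNReal.coe_ne_top
      ENNReal.ofReal_ne_top) e3).trans (le_of_eq ?_)
    rw [ENNReal.toReal_mul, ENNReal.coe_toReal, ENNReal.toReal_ofReal (by positivity)]
  have h3 : (B : ℝ) * (δ / (2 * (B + 1))) ≤ δ / 2 := by
    have hB0 : (0 : ℝ) ≤ B := B.2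
    rw [mul_div_assoc', div_le_div_iff₀ (by positivity) (by positivity)]
    nlinarith
  rw [hsplit]
  exact (norm_add_le _ _).trans_lt (by linarith)

lemma IsW01Pair.add {q : ℝ} (hq : 1 < q) {D : Set (Vec n)} {u v : Vec n → Vec m}
    {G H : Vec n → Mat m n} (hu : IsW01Pair q D u G) (hv : IsW01Pair q D v H) :
    IsW01Pair q D (fun x => u x + v x) (fun x => G x + H x) := by
  have hq1 := one_le_ofReal hq
  obtain ⟨φ, hφ, hφu, hφG⟩ := hu.approx
  obtain ⟨ψ, hψ, hψv, hψH⟩ := hv.approx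
  refine ⟨hu.memLp.add hv.memLp, hu.memLp_grad.add hv.memLp_grad, fun l x => φ l x + ψ l x,
    fun l => ⟨(hφ l).1.add (hψ l).1, (hφ l).2.1.add (hψ l).2.1,
      (tsupport_add (φ l) (ψ l)).trans (union_subset (hφ l).2.2 (hψ l).2.2)⟩, ?_, ?_⟩
  · have hlim := hφu.add hψv
    rw [add_zero] at hlim
    refine tendsto_of_tendsto_of_tendsto_of_le_of_le tendsto_const_nhds hlim
      (fun _ => zero_le) fun l => ?_
    refine le_trans (le_of_eq ?_) (eLpNorm_add_le
      ((hφ l).1.continuous.aestronglyMeasurable.sub hu.memLp.1)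
      ((hψ l).1.continuous.aestronglyMeasurable.sub hv.memLp.1) hq1)
    congr 1
    funext x
    simp only [Pi.add_apply]
    abel
  · have hlim := hφG.add hψH
    rw [add_zero] at hlim
    refine tendsto_of_tendsto_of_tendsto_of_le_of_le tendsto_const_nhds hlim
      (fun _ => zero_le) fun l => ?_
    refine le_trans (le_of_eq ?_) (eLpNorm_add_le
      ((continuous_classicalGrad (hφ l).1).aestronglyMeasurable.sub hu.memLp_grad.1)
      ((continuous_classicalGrad (hψ l).1).aestronglyMeasurable.sub hv.memLp_grad.1) hq1)
    congr 1
    funext x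
    rw [classicalGrad_add ((hφ l).1.differentiable (by simp) x)
      ((hψ l).1.differentiable (by simp) x)]
    simp only [Pi.add_apply]
    abel

/-! ### Cutoff functions in annuli -/

/-- A smooth function of `y` that increases from `0` for `|y|² ≤ 5/16` to `1` for
`|y|² ≥ 7/16`. -/
noncomputable def innerStep (y : Vec n) : ℝ := Real.smoothTransition (8 * ‖y‖ ^ 2 - 5 / 2)

/-- A smooth function of `y` that decreases from `1` for `|y|² ≤ 11/16` to `0` for
`|y|² ≥ 13/16`. -/
noncomputable def outerStep (y : Vec n) : ℝ := Real.smoothTransition (13 / 2 - 8 * ‖y‖ ^ 2)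

/-- A smooth cutoff function, compactly supported in the annulus with centre `a` and radii `ρ / 2`
and `ρ`, that equals `1` near the sphere of radius `3ρ/4`. -/
noncomputable def cutoff (a : Vec n) (ρ : ℝ) (y : Vec n) : ℝ :=
  innerStep (ρ⁻¹ • (y - a)) * outerStep (ρ⁻¹ • (y - a))

lemma contDiff_innerStep : ContDiff ℝ ∞ (innerStep : Vec n → ℝ) :=
  Real.smoothTransition.contDiff.comp ((contDiff_const.mul (contDiff_norm_sq ℝ)).sub contDiff_const)

lemma contDiff_outerStep : ContDiff ℝ ∞ (outerStep : Vec n → ℝ) :=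
  Real.smoothTransition.contDiff.comp (contDiff_const.sub (contDiff_const.mul (contDiff_norm_sq ℝ)))

lemma contDiff_cutoff (a : Vec n) (ρ : ℝ) : ContDiff ℝ ∞ (cutoff a ρ) := by
  have h : ContDiff ℝ ∞ fun y : Vec n => ρ⁻¹ • (y - a) := by fun_prop
  exact (contDiff_innerStep.comp h).mul (contDiff_outerStep.comp h)

lemma cutoff_nonneg (a : Vec n) (ρ : ℝ) (y : Vec n) : 0 ≤ cutoff a ρ y :=
  mul_nonneg (Real.smoothTransition.nonneg _) (Real.smoothTransition.nonneg _)

lemma cutoff_le_one (a : Vec n) (ρ : ℝ) (y : Vec n) : cutoff a ρ y ≤ 1 :=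
  mul_le_one₀ (Real.smoothTransition.le_one _) (Real.smoothTransition.nonneg _)
    (Real.smoothTransition.le_one _)

lemma norm_inv_smul_sub {ρ : ℝ} (hρ : 0 < ρ) (a y : Vec n) :
    ‖ρ⁻¹ • (y - a)‖ = ‖y - a‖ / ρ := by
  rw [norm_smul, Real.norm_eq_abs, abs_of_pos (by positivity)]
  field_simp

lemma tsupport_cutoff_subset {a : Vec n} {ρ : ℝ} (hρ : 0 < ρ) :
    tsupport (cutoff a ρ) ⊆ ring a (ρ / 2) ρ := by
  have hcl : IsClosed {y : Vec n | 5 / 16 ≤ ‖ρ⁻¹ • (y - a)‖ ^ 2 ∧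
      ‖ρ⁻¹ • (y - a)‖ ^ 2 ≤ 13 / 16} := by
    have h1 : IsClosed {y : Vec n | 5 / 16 ≤ ‖ρ⁻¹ • (y - a)‖ ^ 2} :=
      isClosed_le (by fun_prop) (by fun_prop)
    have h2 : IsClosed {y : Vec n | ‖ρ⁻¹ • (y - a)‖ ^ 2 ≤ 13 / 16} :=
      isClosed_le (by fun_prop) (by fun_prop)
    exact h1.and h2
  have hsub : tsupport (cutoff a ρ) ⊆ {y : Vec n | 5 / 16 ≤ ‖ρ⁻¹ • (y - a)‖ ^ 2 ∧
      ‖ρ⁻¹ • (y - a)‖ ^ 2 ≤ 13 / 16} := by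
    refine closure_minimal (fun y hy => ?_) hcl
    by_contra hcon
    apply hy
    rw [mem_ofPred_eq, not_and_or, not_le, not_le] at hcon
    rcases hcon with h | h
    · have : innerStep (ρ⁻¹ • (y - a)) = 0 :=
        Real.smoothTransition.zero_of_nonpos (by linarith)
      simp [cutoff, this]
    · have : outerStep (ρ⁻¹ • (y - a)) = 0 :=
        Real.smoothTransition.zero_of_nonpos (by linarith)
      simp [cutoff, this]
  refine hsub.trans fun y hy => ?_
  have h1 := hy.1
  have h2 := hy.2
  rw [norm_inv_smul_sub hρ, div_pow] at h1 h2
  rw [le_div_iff₀ (by positivity)] at h1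
  rw [div_le_iff₀ (by positivity)] at h2
  constructor
  · by_contra hcon
    rw [not_lt] at hcon
    nlinarith [norm_nonneg (y - a), mul_pos hρ hρ]
  · by_contra hcon
    rw [not_lt] at hcon
    nlinarith [norm_nonneg (y - a), mul_pos hρ hρ]

lemma hasCompactSupport_of_tsupport_subset_ring {E : Type*} [Zero E] {f : Vec n → E} {a : Vec n}
    {r R : ℝ} (h : tsupport f ⊆ ring a r R) : HasCompactSupport f :=
  (isCompact_closedBall a R).of_isClosed_subset (isClosed_tsupport _)
    (h.trans ((ring_subset_ball a r R).trans Metric.ball_subset_closedBall))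

lemma partials_cutoff (a : Vec n) (ρ : ℝ) (y : Vec n) :
    partials (cutoff a ρ) y = ρ⁻¹ • partials (cutoff (0 : Vec n) 1) (ρ⁻¹ • (y - a)) := by
  have h1 : HasFDerivAt (fun z : Vec n => ρ⁻¹ • (z - a))
      (ρ⁻¹ • ContinuousLinearMap.id ℝ (Vec n)) y :=
    ((hasFDerivAt_id y).sub_const a).const_smul ρ⁻¹
  have h2 := (((contDiff_cutoff (0 : Vec n) 1).differentiable (by simp)
    (ρ⁻¹ • (y - a))).hasFDerivAt.comp y h1).fderiv
  have h3 : cutoff (0 : Vec n) 1 ∘ (fun z : Vec n => ρ⁻¹ • (z - a)) = cutoff a ρ := by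
    funext z
    simp [cutoff]
  rw [h3] at h2
  ext b
  simp [partials_apply, h2]

lemma exists_norm_partials_cutoff_le (n : ℕ) : ∃ c : ℝ, 0 < c ∧ ∀ (a : Vec n) (ρ : ℝ), 0 < ρ →
    ∀ y, ‖partials (cutoff a ρ) y‖ ≤ c / ρ := by
  have hc : HasCompactSupport (partials (cutoff (0 : Vec n) 1)) := by
    have h1 := hasCompactSupport_of_tsupport_subset_ring
      (tsupport_cutoff_subset (a := (0 : Vec n)) one_pos)
    refine (h1.fderiv (𝕜 := ℝ)).mono fun x hx h => hx ?_
    ext b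
    simp [h]
  obtain ⟨c, hcb⟩ :=
    (continuous_partials (contDiff_cutoff (0 : Vec n) 1)).bounded_above_of_compact_support hc
  refine ⟨max c 1, by positivity, fun a ρ hρ y => ?_⟩
  rw [partials_cutoff, norm_smul, Real.norm_eq_abs, abs_of_pos (by positivity), div_eq_inv_mul]
  exact mul_le_mul_of_nonneg_left ((hcb _).trans (le_max_left _ _)) (by positivity)

lemma partials_eq_zero_of_notMem {ζ : Vec n → ℝ} {y : Vec n} (hy : y ∉ tsupport ζ) :
    partials ζ y = 0 := by
  have : fderiv ℝ ζ y = 0 := by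
    by_contra h'
    exact hy (support_fderiv_subset ℝ h')
  ext b
  simp [this]

lemma partials_neg_sum {ι : Type*} (s : Finset ι) {ζ : ι → Vec n → ℝ}
    (hζ : ∀ i, ContDiff ℝ ∞ (ζ i)) (y : Vec n) :
    partials (fun y => -∑ i ∈ s, ζ i y) y = -∑ i ∈ s, partials (ζ i) y := by
  have h : HasFDerivAt (fun y => -∑ i ∈ s, ζ i y) (-∑ i ∈ s, fderiv ℝ (ζ i) y) y :=
    (HasFDerivAt.fun_sum fun i _ => ((hζ i).differentiable (by simp) y).hasFDerivAt).neg
  ext b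
  simp [h.fderiv]

lemma classicalGrad_sum_smul_const {ι : Type*} (s : Finset ι) {ζ : ι → Vec n → ℝ}
    (hζ : ∀ i, ContDiff ℝ ∞ (ζ i)) (c : ι → Vec m) (y : Vec n) :
    classicalGrad (fun y => ∑ i ∈ s, ζ i y • c i) y = ∑ i ∈ s, outer (c i) (partials (ζ i) y) := by
  have h : HasFDerivAt (fun y => ∑ i ∈ s, ζ i y • c i)
      (∑ i ∈ s, (fderiv ℝ (ζ i) y).smulRight (c i)) y :=
    HasFDerivAt.fun_sum fun i _ =>
      ((hζ i).differentiable (by simp) y).hasFDerivAt.smul_const (c i)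
  ext ia
  simp [h.fderiv, mul_comm]

/-! ### Replacing a map by constants on spheres -/

section Modification

variable {q : ℝ} {D : Set (Vec n)} {u : Vec n → Vec m} {G : Vec n → Mat m n}
  {ι : Type*} {s : Finset ι} {a : ι → Vec n} {ρ : ι → ℝ}

/-- The correction `v = ∑ₓ φₓ (cₓ - u)`, where `φₓ` is the cutoff function of the annulus of
index `x`. -/
noncomputable def correction (s : Finset ι) (a : ι → Vec n) (ρ : ι → ℝ) (c : ι → Vec m)
    (u : Vec n → Vec m) (y : Vec n) : Vec m :=
  (-∑ x ∈ s, cutoff (a x) (ρ x) y) • u y + ∑ x ∈ s, cutoff (a x) (ρ x) y • c x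

/-- The weak gradient `∑ₓ (-φₓ G + (cₓ - u) ⊗ ∇φₓ)` of the correction. -/
noncomputable def correctionGrad (s : Finset ι) (a : ι → Vec n) (ρ : ι → ℝ) (c : ι → Vec m)
    (u : Vec n → Vec m) (G : Vec n → Mat m n) (y : Vec n) : Mat m n :=
  ∑ x ∈ s, (-(cutoff (a x) (ρ x) y • G y) + outer (c x - u y) (partials (cutoff (a x) (ρ x)) y))

lemma outer_neg_sum (v : Vec m) (z : ι → Vec n) :
    outer v (-∑ x ∈ s, z x) = -∑ x ∈ s, outer v (z x) := by
  ext ia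
  simp [Finset.mul_sum]

lemma isW01Pair_correction (hq : 1 < q) (hu : IsW01Pair q D u G) (hρ : ∀ x ∈ s, 0 < ρ x)
    (hD : ∀ x ∈ s, Metric.ball (a x) (ρ x) ⊆ D) (c : ι → Vec m) :
    IsW01Pair q D (correction s a ρ c u) (correctionGrad s a ρ c u G) := by
  have hζ : ContDiff ℝ ∞ fun y => -∑ x ∈ s, cutoff (a x) (ρ x) y :=
    (ContDiff.sum fun x _ => contDiff_cutoff (a x) (ρ x)).neg
  have hsupp : ∀ x ∈ s, tsupport (cutoff (a x) (ρ x)) ⊆ D := fun x hx =>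
    (tsupport_cutoff_subset (hρ x hx)).trans ((ring_subset_ball _ _ _).trans (hD x hx))
  have hcomp : ∀ x ∈ s, HasCompactSupport (cutoff (a x) (ρ x)) := fun x hx =>
    hasCompactSupport_of_tsupport_subset_ring (tsupport_cutoff_subset (hρ x hx))
  -- the union of the supports of the cutoff functions
  set T : Set (Vec n) := ⋃ x ∈ s, tsupport (cutoff (a x) (ρ x)) with hT
  have hTc : IsCompact T := s.isCompact_biUnion fun x hx => hcomp x hx
  have hTD : T ⊆ D := iUnion₂_subset hsupp
  have hzero : ∀ y ∉ T, ∀ x ∈ s, cutoff (a x) (ρ x) y = 0 := by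
    intro y hy x hx
    refine image_eq_zero_of_notMem_tsupport fun h => hy ?_
    exact mem_biUnion hx h
  have hζc : HasCompactSupport fun y => -∑ x ∈ s, cutoff (a x) (ρ x) y :=
    HasCompactSupport.intro hTc fun y hy => by
      rw [Finset.sum_eq_zero (hzero y hy), neg_zero]
  have hpc : HasCompactSupport (partials fun y => -∑ x ∈ s, cutoff (a x) (ρ x) y) :=
    (hζc.fderiv (𝕜 := ℝ)).mono fun x hx h => hx (by ext b; simp [h])
  obtain ⟨Z₁, hZ₁⟩ := hζ.continuous.bounded_above_of_compact_support hζc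
  obtain ⟨Z₂, hZ₂⟩ := (continuous_partials hζ).bounded_above_of_compact_support hpc
  have hψ : ContDiff ℝ ∞ fun y => ∑ x ∈ s, cutoff (a x) (ρ x) y • c x :=
    ContDiff.sum fun x _ => (contDiff_cutoff (a x) (ρ x)).smul contDiff_const
  have hψT : tsupport (fun y => ∑ x ∈ s, cutoff (a x) (ρ x) y • c x) ⊆ T := by
    refine closure_minimal (fun y hy => ?_) hTc.isClosed
    by_contra hcon
    exact hy (Finset.sum_eq_zero fun x hx => by rw [hzero y hcon x hx, zero_smul])
  have := hu.smul_add hq subset_rfl hζ (Z := max Z₁ Z₂)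
    (fun y => (hZ₁ y).trans (le_max_left _ _)) (fun y => (hZ₂ y).trans (le_max_right _ _))
    inter_subset_left hψ (hTc.of_isClosed_subset (isClosed_tsupport _) hψT) (hψT.trans hTD)
  refine this.congr (ae_eq_refl _) (Eventually.of_forall fun y => ?_)
  simp only [correctionGrad]
  rw [partials_neg_sum s fun x => contDiff_cutoff (a x) (ρ x),
    classicalGrad_sum_smul_const s fun x => contDiff_cutoff (a x) (ρ x), outer_neg_sum]
  simp only [outer_sub_left, Finset.sum_add_distrib, Finset.sum_sub_distrib, Finset.sum_neg_distrib,
    neg_smul, Finset.sum_smul]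
  abel

lemma correction_eq_zero (hρ : ∀ x ∈ s, 0 < ρ x) (c : ι → Vec m) {y : Vec n}
    (hy : y ∉ ⋃ x ∈ s, ring (a x) (ρ x / 2) (ρ x)) :
    correction s a ρ c u y = 0 ∧ correctionGrad s a ρ c u G y = 0 := by
  have hnot : ∀ x ∈ s, y ∉ tsupport (cutoff (a x) (ρ x)) := fun x hx h =>
    hy (mem_biUnion (show x ∈ (s : Set ι) from hx) (tsupport_cutoff_subset (hρ x hx) h))
  have h0 : ∀ x ∈ s, cutoff (a x) (ρ x) y = 0 := fun x hx =>
    image_eq_zero_of_notMem_tsupport (hnot x hx)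
  constructor
  · rw [correction, Finset.sum_eq_zero h0,
      Finset.sum_eq_zero fun x hx => by rw [h0 x hx, zero_smul]]
    simp
  · refine Finset.sum_eq_zero fun x hx => ?_
    rw [h0 x hx, partials_eq_zero_of_notMem (hnot x hx)]
    simp

lemma correction_eq (hρ : ∀ x ∈ s, 0 < ρ x)
    (hdisj : ∀ x ∈ s, ∀ x' ∈ s, x ≠ x' →
      Disjoint (Metric.ball (a x) (ρ x)) (Metric.ball (a x') (ρ x')))
    (c : ι → Vec m) {x : ι} (hx : x ∈ s) {y : Vec n} (hy : y ∈ Metric.ball (a x) (ρ x)) :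
    correction s a ρ c u y = cutoff (a x) (ρ x) y • (c x - u y) ∧
      correctionGrad s a ρ c u G y =
        -(cutoff (a x) (ρ x) y • G y) + outer (c x - u y) (partials (cutoff (a x) (ρ x)) y) := by
  have hnot : ∀ x' ∈ s, x' ≠ x → y ∉ tsupport (cutoff (a x') (ρ x')) := fun x' hx' hne h =>
    (hdisj x' hx' x hx hne).le_bot
      ⟨ring_subset_ball _ _ _ (tsupport_cutoff_subset (hρ x' hx') h), hy⟩
  have h0 : ∀ x' ∈ s, x' ≠ x → cutoff (a x') (ρ x') y = 0 := fun x' hx' hne =>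
    image_eq_zero_of_notMem_tsupport (hnot x' hx' hne)
  constructor
  · rw [correction, Finset.sum_eq_single_of_mem x hx h0,
      Finset.sum_eq_single_of_mem x hx fun x' hx' hne => by rw [h0 x' hx' hne, zero_smul]]
    rw [smul_sub, neg_smul]
    abel
  · refine Finset.sum_eq_single_of_mem x hx fun x' hx' hne => ?_
    rw [h0 x' hx' hne, partials_eq_zero_of_notMem (hnot x' hx' hne)]
    simp

/-- On the intermediate spheres the corrected map is constant: in the inner ball it differs from the
constant by a smooth multiple of `u - cₓ` that vanishes near the sphere. -/
lemma eqConstOnSphere_correction (hq : 1 < q) (hu : IsW01Pair q D u G) (hρ : ∀ x ∈ s, 0 < ρ x)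
    (hD : ∀ x ∈ s, Metric.ball (a x) (ρ x) ⊆ D)
    (hdisj : ∀ x ∈ s, ∀ x' ∈ s, x ≠ x' →
      Disjoint (Metric.ball (a x) (ρ x)) (Metric.ball (a x') (ρ x')))
    (c : ι → Vec m) {x : ι} (hx : x ∈ s) :
    EqConstOnSphere q (fun y => u y + correction s a ρ c u y) (c x) (a x) (3 / 4 * ρ x) := by
  have hρx := hρ x hx
  set B := Metric.ball (a x) (3 / 4 * ρ x) with hB
  have hBball : B ⊆ Metric.ball (a x) (ρ x) := Metric.ball_subset_ball (by linarith)
  set ζ : Vec n → ℝ := fun y => 1 - innerStep ((ρ x)⁻¹ • (y - a x)) with hζdef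
  have hζ : ContDiff ℝ ∞ ζ := by
    have h : ContDiff ℝ ∞ fun y : Vec n => (ρ x)⁻¹ • (y - a x) := by fun_prop
    exact contDiff_const.sub (contDiff_innerStep.comp h)
  have hsub : tsupport ζ ⊆ {y : Vec n | ‖(ρ x)⁻¹ • (y - a x)‖ ^ 2 ≤ 7 / 16} := by
    refine closure_minimal (fun y hy => ?_) (isClosed_le (by fun_prop) (by fun_prop))
    by_contra hcon
    apply hy
    rw [mem_ofPred_eq, not_le] at hcon
    have : innerStep ((ρ x)⁻¹ • (y - a x)) = 1 :=
      Real.smoothTransition.one_of_one_le (by linarith)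
    rw [hζdef]
    simp [this]
  have hζB : tsupport ζ ⊆ B := by
    refine hsub.trans fun y hy => ?_
    rw [mem_ofPred_eq, norm_inv_smul_sub hρx, div_pow, div_le_iff₀ (by positivity)] at hy
    rw [hB, mem_ball_iff_norm]
    by_contra hcon
    rw [not_lt] at hcon
    nlinarith [norm_nonneg (y - a x), mul_pos hρx hρx]
  have hζc : HasCompactSupport ζ :=
    (isCompact_closedBall (a x) (3 / 4 * ρ x)).of_isClosed_subset (isClosed_tsupport _)
      (hζB.trans Metric.ball_subset_closedBall)
  have hpc : HasCompactSupport (partials ζ) :=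
    (hζc.fderiv (𝕜 := ℝ)).mono fun x hx h => hx (by ext b; simp [h])
  obtain ⟨Z₁, hZ₁⟩ := hζ.continuous.bounded_above_of_compact_support hζc
  obtain ⟨Z₂, hZ₂⟩ := (continuous_partials hζ).bounded_above_of_compact_support hpc
  have hψt : tsupport (fun y => ζ y • (-c x)) ⊆ tsupport ζ := tsupport_smul_subset_left ζ _
  have := hu.smul_add hq (hBball.trans (hD x hx)) hζ (Z := max Z₁ Z₂)
    (fun y => (hZ₁ y).trans (le_max_left _ _)) (fun y => (hZ₂ y).trans (le_max_right _ _))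
    (inter_subset_right.trans hζB) (hζ.smul contDiff_const) (hζc.smul_right (f' := fun _ => -c x))
    (hψt.trans hζB)
  refine (this.congr ?_ (ae_eq_refl _)).memW01 hq
  filter_upwards [ae_restrict_mem Metric.isOpen_ball.measurableSet] with y hy
  rw [(correction_eq (u := u) (G := G) hρ hdisj c hx (hBball hy)).1]
  have hout : outerStep ((ρ x)⁻¹ • (y - a x)) = 1 := by
    refine Real.smoothTransition.one_of_one_le ?_
    rw [mem_ball_iff_norm] at hy
    have h1 : ‖(ρ x)⁻¹ • (y - a x)‖ < 3 / 4 := by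
      rw [norm_inv_smul_sub hρx, div_lt_iff₀ hρx]
      exact hy
    nlinarith [norm_nonneg ((ρ x)⁻¹ • (y - a x))]
  rw [cutoff, hout, mul_one, hζdef]
  simp only [Pi.smul_apply', sub_smul, one_smul, smul_sub, smul_neg]
  abel

end Modification

/-! ### Integral estimates for the correction -/

/-- A finite family of disjoint open balls in `D`, with centres `a x` and radii `ρ x`, `x ∈ s`. -/
structure IsBallFamily (D : Set (Vec n)) (s : Finset (Vec n)) (a : Vec n → Vec n)
    (ρ : Vec n → ℝ) : Prop where
  pos : ∀ x ∈ s, 0 < ρ x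
  subset : ∀ x ∈ s, Metric.ball (a x) (ρ x) ⊆ D
  disjoint : ∀ x ∈ s, ∀ x' ∈ s, x ≠ x' →
    Disjoint (Metric.ball (a x) (ρ x)) (Metric.ball (a x') (ρ x'))

/-- The wide annulus with radii `2⁻⁽ⁿ⁺¹⁾ ρ` and `ρ`, whose gradient controls the oscillation
in the annulus with radii `ρ / 2` and `ρ`. -/
def wideRing (a : Vec n) (ρ : ℝ) : Set (Vec n) := ring a ((2 ^ (n + 1))⁻¹ * ρ) ρ

lemma ring_subset_wideRing (a : Vec n) {ρ : ℝ} (hρ : 0 < ρ) :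
    ring a (ρ / 2) ρ ⊆ wideRing a ρ := by
  have hsmall : (2 ^ (n + 1) : ℝ)⁻¹ ≤ 1 / 2 := by
    have : (2 : ℝ) ^ 1 ≤ 2 ^ (n + 1) := pow_le_pow_right₀ (by norm_num) (by omega)
    rw [one_div]
    exact inv_anti₀ (by norm_num) (by linarith)
  intro y hy
  refine ⟨lt_of_le_of_lt ?_ hy.1, hy.2⟩
  nlinarith

lemma measurableSet_wideRing (a : Vec n) (ρ : ℝ) : MeasurableSet (wideRing a ρ) :=
  (isOpen_ring _ _ _).measurableSet

lemma measurableSet_ring (a : Vec n) (r R : ℝ) : MeasurableSet (ring a r R) :=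
  (isOpen_ring _ _ _).measurableSet

lemma volume_ball_eq (a : Vec n) {ρ : ℝ} (hρ : 0 < ρ) :
    volume (Metric.ball a ρ) = ENNReal.ofReal (ρ ^ n) * volume (Metric.ball (0 : Vec n) 1) := by
  rw [Measure.addHaar_ball_of_pos _ _ hρ, finrank_euclideanSpace, Fintype.card_fin]

lemma two_rpow_ne_top {q : ℝ} (hq : 1 < q) : (2 : ℝ≥0∞) ^ (q - 1) ≠ ⊤ :=
  ENNReal.rpow_ne_top_of_nonneg (by linarith) (by simp)

/-- The mean value of `u` over the annulus of index `x`. -/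
noncomputable def ringMean (a : Vec n → Vec n) (ρ : Vec n → ℝ) (u : Vec n → Vec m)
    (x : Vec n) : Vec m :=
  ⨍ y in ring (a x) (ρ x / 2) (ρ x), u y

section Estimates

variable {q : ℝ}

/-- The estimates in a single annulus. -/
lemma exists_local_bounds (hq : 1 < q) (hn : 2 ≤ n) (m : ℕ) : ∃ K ≠ (⊤ : ℝ≥0∞),
    ∀ (D : Set (Vec n)) (u : Vec n → Vec m) (G : Vec n → Mat m n), IsW01Pair q D u G →
    ∀ (s : Finset (Vec n)) (a : Vec n → Vec n) (ρ : Vec n → ℝ), IsBallFamily D s a ρ →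
    ∀ x ∈ s,
      (∫⁻ y in ring (a x) (ρ x / 2) (ρ x), ‖correction s a ρ (ringMean a ρ u) u y‖ₑ ^ q ≤
        K * ENNReal.ofReal (ρ x) ^ q * ∫⁻ y in wideRing (a x) (ρ x), ‖G y‖ₑ ^ q) ∧
      (∀ E, MeasurableSet E → ∀ τ : ℝ, 0 < τ → τ ≤ 1 →
        ∫⁻ y in E ∩ ring (a x) (ρ x / 2) (ρ x),
            ‖correctionGrad s a ρ (ringMean a ρ u) u G y‖ₑ ^ q ≤
          K * ((∫⁻ y in E ∩ ring (a x) (ρ x / 2) (ρ x), ‖G y‖ₑ ^ q) +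
            (ENNReal.ofReal τ + volume (E ∩ ring (a x) (ρ x / 2) (ρ x)) *
              ENNReal.ofReal ((ρ x * τ) ^ n)⁻¹) * ∫⁻ y in wideRing (a x) (ρ x), ‖G y‖ₑ ^ q)) ∧
      ∫⁻ y in ring (a x) (ρ x / 2) (ρ x),
          ‖correctionGrad s a ρ (ringMean a ρ u) u G y‖ₑ ^ q ≤
        K * ∫⁻ y in wideRing (a x) (ρ x), ‖G y‖ₑ ^ q := by
  obtain ⟨C, hCt, hC⟩ := exists_poincare hq hn m
  obtain ⟨c, hc0, hc⟩ := exists_norm_partials_cutoff_le n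
  set V := volume (Metric.ball (0 : Vec n) 1) with hV
  have hVt : V ≠ ⊤ := measure_ball_lt_top.ne
  have hq0 : 0 < q := by linarith
  set K₂ : ℝ≥0∞ := 2 ^ (q - 1) * (1 + ENNReal.ofReal c ^ q * C) with hK₂
  have hct : ENNReal.ofReal c ^ q ≠ ⊤ :=
    ENNReal.rpow_ne_top_of_nonneg hq0.le ENNReal.ofReal_ne_top
  have h2t := two_rpow_ne_top hq
  have hK₂t : K₂ ≠ ⊤ := by finiteness
  refine ⟨C * (1 + V) + K₂ * (2 + V), by finiteness, ?_⟩
  intro D u G hu s a ρ hfam x hx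
  have hρ := hfam.pos x hx
  set R := ring (a x) (ρ x / 2) (ρ x) with hR
  set R' := wideRing (a x) (ρ x) with hR'
  set v := correction s a ρ (ringMean a ρ u) u
  set H := correctionGrad s a ρ (ringMean a ρ u) u G
  have hRR' : R ⊆ R' := ring_subset_wideRing _ hρ
  have hR'D : R' ⊆ D := (ring_subset_ball _ _ _).trans (hfam.subset x hx)
  have hRm : MeasurableSet R := measurableSet_ring _ _ _
  have hpt : ∀ y ∈ R, ‖v y‖ ≤ ‖u y - ringMean a ρ u x‖ ∧
      ‖H y‖ ≤ ‖G y‖ + c / ρ x * ‖u y - ringMean a ρ u x‖ := by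
    intro y hy
    obtain ⟨e1, e2⟩ := correction_eq (u := u) (G := G) hfam.pos hfam.disjoint (ringMean a ρ u) hx
      (ring_subset_ball _ _ _ hy)
    change v y = _ at e1
    change H y = _ at e2
    have hcut := cutoff_nonneg (a x) (ρ x) y
    have hcut1 := cutoff_le_one (a x) (ρ x) y
    constructor
    · rw [e1, norm_smul, Real.norm_eq_abs, abs_of_nonneg hcut, norm_sub_rev]
      exact mul_le_of_le_one_left (norm_nonneg _) hcut1
    · rw [e2]
      refine (norm_add_le _ _).trans (add_le_add ?_ ?_)
      · rw [norm_neg, norm_smul, Real.norm_eq_abs, abs_of_nonneg hcut]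
        exact mul_le_of_le_one_left (norm_nonneg _) hcut1
      · rw [norm_outer, norm_sub_rev, mul_comm]
        exact mul_le_mul_of_nonneg_right (hc _ _ hρ _) (norm_nonneg _)
  have hvolR : ∀ S ⊆ R, volume S * ENNReal.ofReal ((ρ x * 1) ^ n)⁻¹ ≤ V := by
    intro S hS
    have h1 : volume S ≤ ENNReal.ofReal (ρ x ^ n) * V := by
      rw [hV, ← volume_ball_eq _ hρ]
      exact measure_mono (hS.trans (ring_subset_ball _ _ _))
    refine (mul_le_mul_left h1 _).trans (le_of_eq ?_)
    rw [mul_one, mul_comm, ← mul_assoc, ← ENNReal.ofReal_mul (by positivity),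
      inv_mul_cancel₀ (by positivity), ENNReal.ofReal_one, one_mul]
  have hgrad : ∀ E, MeasurableSet E → ∀ τ : ℝ, 0 < τ → τ ≤ 1 →
      ∫⁻ y in E ∩ R, ‖H y‖ₑ ^ q ≤ K₂ * ((∫⁻ y in E ∩ R, ‖G y‖ₑ ^ q) +
        (ENNReal.ofReal τ + volume (E ∩ R) * ENNReal.ofReal ((ρ x * τ) ^ n)⁻¹) *
          ∫⁻ y in R', ‖G y‖ₑ ^ q) := by
    intro E hE τ hτ hτ1
    have hP := hC D u G hu (a x) (ρ x) hρ hR'D (E ∩ R) inter_subset_right (hE.inter hRm) τ hτ hτ1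
    have hGm : AEMeasurable (fun y => ‖G y‖ₑ ^ q) (volume.restrict (E ∩ R)) :=
      ((hu.memLp_grad.1.mono_measure (Measure.restrict_mono
        (inter_subset_right.trans (hRR'.trans hR'D)) le_rfl)).enorm).pow_const q
    set F := ENNReal.ofReal τ + volume (E ∩ R) * ENNReal.ofReal ((ρ x * τ) ^ n)⁻¹
    have hle : ∀ y ∈ E ∩ R, ‖H y‖ₑ ^ q ≤ 2 ^ (q - 1) * (‖G y‖ₑ ^ q +
        ENNReal.ofReal (c / ρ x) ^ q * ‖u y - ringMean a ρ u x‖ₑ ^ q) := by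
      intro y hy
      rw [← ENNReal.mul_rpow_of_nonneg _ _ hq0.le]
      refine le_trans (ENNReal.rpow_le_rpow ?_ hq0.le)
        (ENNReal.rpow_add_le_mul_rpow_add_rpow _ _ hq.le)
      have := ENNReal.ofReal_le_ofReal (hpt y hy.2).2
      rwa [ENNReal.ofReal_add (norm_nonneg _) (by positivity), ENNReal.ofReal_mul (by positivity),
        ofReal_norm, ofReal_norm, ofReal_norm] at this
    have hcρ : ENNReal.ofReal (c / ρ x) ^ q * ENNReal.ofReal (ρ x) ^ q = ENNReal.ofReal c ^ q := by
      rw [← ENNReal.mul_rpow_of_nonneg _ _ hq0.le, ← ENNReal.ofReal_mul (by positivity),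
        div_mul_cancel₀ _ hρ.ne']
    have hcρt : ENNReal.ofReal (c / ρ x) ^ q ≠ ⊤ :=
      ENNReal.rpow_ne_top_of_nonneg hq0.le ENNReal.ofReal_ne_top
    calc ∫⁻ y in E ∩ R, ‖H y‖ₑ ^ q
        ≤ ∫⁻ y in E ∩ R, 2 ^ (q - 1) * (‖G y‖ₑ ^ q +
          ENNReal.ofReal (c / ρ x) ^ q * ‖u y - ringMean a ρ u x‖ₑ ^ q) :=
          setLIntegral_mono' (hE.inter hRm) hle
      _ = 2 ^ (q - 1) * ((∫⁻ y in E ∩ R, ‖G y‖ₑ ^ q) + ENNReal.ofReal (c / ρ x) ^ q *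
            ∫⁻ y in E ∩ R, ‖u y - ringMean a ρ u x‖ₑ ^ q) := by
          rw [lintegral_const_mul' _ _ h2t, lintegral_add_left' hGm, lintegral_const_mul' _ _ hcρt]
      _ ≤ 2 ^ (q - 1) * ((∫⁻ y in E ∩ R, ‖G y‖ₑ ^ q) + ENNReal.ofReal (c / ρ x) ^ q *
            (C * ENNReal.ofReal (ρ x) ^ q * F * ∫⁻ y in R', ‖G y‖ₑ ^ q)) := by
          gcongr
          exact hP
      _ = 2 ^ (q - 1) * (1 * (∫⁻ y in E ∩ R, ‖G y‖ₑ ^ q) + ENNReal.ofReal c ^ q * C *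
            (F * ∫⁻ y in R', ‖G y‖ₑ ^ q)) := by
          rw [← hcρ]; ring
      _ ≤ 2 ^ (q - 1) * ((1 + ENNReal.ofReal c ^ q * C) * (∫⁻ y in E ∩ R, ‖G y‖ₑ ^ q) +
            (1 + ENNReal.ofReal c ^ q * C) * (F * ∫⁻ y in R', ‖G y‖ₑ ^ q)) := by
          gcongr
          · exact le_self_add
          · exact le_add_self
      _ = _ := by rw [hK₂]; ring
  have hK₂K : K₂ ≤ C * (1 + V) + K₂ * (2 + V) := by
    refine le_add_left (le_mul_of_one_le_right zero_le ?_)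
    exact le_add_right (by norm_num)
  refine ⟨?_, fun E hE τ hτ hτ1 => (hgrad E hE τ hτ hτ1).trans (mul_le_mul_left hK₂K _), ?_⟩
  · have hP := hC D u G hu (a x) (ρ x) hρ hR'D R subset_rfl hRm 1 one_pos le_rfl
    calc ∫⁻ y in R, ‖v y‖ₑ ^ q ≤ ∫⁻ y in R, ‖u y - ringMean a ρ u x‖ₑ ^ q := by
          refine setLIntegral_mono' hRm fun y hy => ENNReal.rpow_le_rpow ?_ hq0.le
          rw [← ofReal_norm, ← ofReal_norm]
          exact ENNReal.ofReal_le_ofReal (hpt y hy).1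
      _ ≤ C * ENNReal.ofReal (ρ x) ^ q * (ENNReal.ofReal 1 + volume R *
            ENNReal.ofReal ((ρ x * 1) ^ n)⁻¹) * ∫⁻ y in R', ‖G y‖ₑ ^ q := hP
      _ ≤ C * ENNReal.ofReal (ρ x) ^ q * (1 + V) * ∫⁻ y in R', ‖G y‖ₑ ^ q := by
          rw [ENNReal.ofReal_one]
          gcongr
          exact hvolR R subset_rfl
      _ = C * (1 + V) * ENNReal.ofReal (ρ x) ^ q * ∫⁻ y in R', ‖G y‖ₑ ^ q := by ring
      _ ≤ _ := by
          gcongr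
          exact le_self_add
  · have h1 := hgrad univ MeasurableSet.univ 1 one_pos le_rfl
    rw [univ_inter, ENNReal.ofReal_one] at h1
    calc ∫⁻ y in R, ‖H y‖ₑ ^ q
        ≤ K₂ * ((∫⁻ y in R', ‖G y‖ₑ ^ q) + (1 + V) * ∫⁻ y in R', ‖G y‖ₑ ^ q) := by
          refine h1.trans ?_
          gcongr
          exact hvolR R subset_rfl
      _ = K₂ * (2 + V) * ∫⁻ y in R', ‖G y‖ₑ ^ q := by ring
      _ ≤ _ := by
          gcongr
          exact le_add_self

lemma setLIntegral_eq_of_zero_off {f : Vec n → ℝ≥0∞} {U : Set (Vec n)} (hU : MeasurableSet U)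
    (hf : ∀ y ∉ U, f y = 0) (S : Set (Vec n)) : ∫⁻ y in S, f y = ∫⁻ y in S ∩ U, f y := by
  have : f = U.indicator f := by
    funext y
    by_cases hy : y ∈ U
    · rw [indicator_of_mem hy]
    · rw [indicator_of_notMem hy, hf y hy]
  conv_lhs => rw [this]
  rw [lintegral_indicator hU, Measure.restrict_restrict hU, inter_comm]

namespace IsBallFamily

variable {D : Set (Vec n)} {s : Finset (Vec n)} {a : Vec n → Vec n} {ρ : Vec n → ℝ}

lemma measurableSet_iUnion_ring (s : Finset (Vec n)) (a : Vec n → Vec n) (ρ : Vec n → ℝ) :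
    MeasurableSet (⋃ x ∈ s, ring (a x) (ρ x / 2) (ρ x)) :=
  s.measurableSet_biUnion fun _ _ => measurableSet_ring _ _ _

lemma measurableSet_iUnion_wideRing (s : Finset (Vec n)) (a : Vec n → Vec n) (ρ : Vec n → ℝ) :
    MeasurableSet (⋃ x ∈ s, wideRing (a x) (ρ x)) :=
  s.measurableSet_biUnion fun _ _ => measurableSet_wideRing _ _

lemma iUnion_ring_subset (h : IsBallFamily D s a ρ) :
    ⋃ x ∈ s, ring (a x) (ρ x / 2) (ρ x) ⊆ ⋃ x ∈ s, wideRing (a x) (ρ x) :=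
  iUnion₂_mono fun x hx => ring_subset_wideRing _ (h.pos x hx)

lemma iUnion_wideRing_subset (h : IsBallFamily D s a ρ) : ⋃ x ∈ s, wideRing (a x) (ρ x) ⊆ D :=
  iUnion₂_subset fun x hx => (ring_subset_ball _ _ _).trans (h.subset x hx)

lemma pairwiseDisjoint (h : IsBallFamily D s a ρ) {t : Vec n → Set (Vec n)}
    (ht : ∀ x ∈ s, t x ⊆ Metric.ball (a x) (ρ x)) : (s : Set (Vec n)).PairwiseDisjoint t :=
  fun x hx x' hx' hne => (h.disjoint x hx x' hx' hne).mono (ht x hx) (ht x' hx')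

lemma setLIntegral_inter_ring (h : IsBallFamily D s a ρ) {E : Set (Vec n)} (hE : MeasurableSet E)
    (f : Vec n → ℝ≥0∞) :
    ∫⁻ y in E ∩ ⋃ x ∈ s, ring (a x) (ρ x / 2) (ρ x), f y =
      ∑ x ∈ s, ∫⁻ y in E ∩ ring (a x) (ρ x / 2) (ρ x), f y := by
  rw [inter_iUnion₂, lintegral_biUnion_finset]
  · exact h.pairwiseDisjoint fun x _ => inter_subset_right.trans (ring_subset_ball _ _ _)
  · exact fun x _ => hE.inter (measurableSet_ring _ _ _)

lemma sum_setLIntegral_wideRing (h : IsBallFamily D s a ρ) {s' : Finset (Vec n)} (hs' : s' ⊆ s)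
    (f : Vec n → ℝ≥0∞) :
    ∑ x ∈ s', ∫⁻ y in wideRing (a x) (ρ x), f y =
      ∫⁻ y in ⋃ x ∈ s', wideRing (a x) (ρ x), f y := by
  rw [lintegral_biUnion_finset]
  · exact (h.pairwiseDisjoint fun x _ => ring_subset_ball _ _ _).subset (by exact_mod_cast hs')
  · exact fun x _ => measurableSet_wideRing _ _

end IsBallFamily

/-- The estimates for the whole correction `v` and its gradient `H`, with constant `K`. The last one
is used for equi-integrability: in the annuli that meet `E` in a small part, the localized Poincaré
inequality gains the factor `τ`; the other annuli have small total measure and form the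
set `E'`. -/
structure HasCorrectionBounds (n m : ℕ) (q : ℝ) (K : ℝ≥0∞) : Prop where
  lintegral_correction : ∀ {D : Set (Vec n)} {u : Vec n → Vec m} {G : Vec n → Mat m n}
    {s : Finset (Vec n)} {a : Vec n → Vec n} {ρ : Vec n → ℝ}, MeasurableSet D →
    IsW01Pair q D u G → IsBallFamily D s a ρ → ∀ r : ℝ, (∀ x ∈ s, ρ x ≤ r) →
    ∫⁻ y in D, ‖correction s a ρ (ringMean a ρ u) u y‖ₑ ^ q ≤
      K * ENNReal.ofReal r ^ q * ∫⁻ y in D, ‖G y‖ₑ ^ q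
  lintegral_correctionGrad : ∀ {D : Set (Vec n)} {u : Vec n → Vec m} {G : Vec n → Mat m n}
    {s : Finset (Vec n)} {a : Vec n → Vec n} {ρ : Vec n → ℝ}, MeasurableSet D →
    IsW01Pair q D u G → IsBallFamily D s a ρ →
    ∫⁻ y in D, ‖correctionGrad s a ρ (ringMean a ρ u) u G y‖ₑ ^ q ≤
      K * ∫⁻ y in ⋃ x ∈ s, wideRing (a x) (ρ x), ‖G y‖ₑ ^ q
  lintegral_correctionGrad_inter : ∀ {D : Set (Vec n)} {u : Vec n → Vec m} {G : Vec n → Mat m n}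
    {s : Finset (Vec n)} {a : Vec n → Vec n} {ρ : Vec n → ℝ}, MeasurableSet D →
    IsW01Pair q D u G → IsBallFamily D s a ρ →
    ∀ E, MeasurableSet E → ∀ τ : ℝ, 0 < τ → τ ≤ 1 → ∃ E' ⊆ D, MeasurableSet E' ∧
      volume E' ≤ K * ENNReal.ofReal (τ ^ (n + 1))⁻¹ * volume (E ∩ D) ∧
      ∫⁻ y in E ∩ D, ‖correctionGrad s a ρ (ringMean a ρ u) u G y‖ₑ ^ q ≤
        K * ((∫⁻ y in E ∩ D, ‖G y‖ₑ ^ q) + ENNReal.ofReal τ * (∫⁻ y in D, ‖G y‖ₑ ^ q) +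
          ∫⁻ y in E', ‖G y‖ₑ ^ q)

lemma exists_hasCorrectionBounds (hq : 1 < q) (hn : 2 ≤ n) (m : ℕ) :
    ∃ K ≠ (⊤ : ℝ≥0∞), HasCorrectionBounds n m q K := by
  obtain ⟨K, hKt, hK⟩ := exists_local_bounds hq hn m
  set V := volume (Metric.ball (0 : Vec n) 1) with hV
  have hVt : V ≠ ⊤ := measure_ball_lt_top.ne
  have hq0 : 0 < q := by linarith
  refine ⟨2 * K + V, by finiteness, ?_⟩
  suffices h : ∀ {D : Set (Vec n)} {u : Vec n → Vec m} {G : Vec n → Mat m n}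
      {s : Finset (Vec n)} {a : Vec n → Vec n} {ρ : Vec n → ℝ}, MeasurableSet D →
      IsW01Pair q D u G → IsBallFamily D s a ρ → _ ∧ _ ∧ _ from
    ⟨fun h₁ h₂ h₃ => (h h₁ h₂ h₃).1, fun h₁ h₂ h₃ => (h h₁ h₂ h₃).2.1,
      fun h₁ h₂ h₃ => (h h₁ h₂ h₃).2.2⟩
  intro D u G s a ρ hDm hu hfam
  have hloc := hK D u G hu s a ρ hfam
  set v := correction s a ρ (ringMean a ρ u) u
  set H := correctionGrad s a ρ (ringMean a ρ u) u G
  set U := ⋃ x ∈ s, ring (a x) (ρ x / 2) (ρ x) with hU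
  set U' := ⋃ x ∈ s, wideRing (a x) (ρ x) with hU'
  have hUm : MeasurableSet U := IsBallFamily.measurableSet_iUnion_ring s a ρ
  have hU'D : U' ⊆ D := hfam.iUnion_wideRing_subset
  have hv0 : ∀ y ∉ U, ‖v y‖ₑ ^ q = 0 := fun y hy => by
    rw [show v y = 0 from
      (correction_eq_zero (u := u) (G := G) hfam.pos (ringMean a ρ u) hy).1, enorm_zero,
      ENNReal.zero_rpow_of_pos hq0]
  have hH0 : ∀ y ∉ U, ‖H y‖ₑ ^ q = 0 := fun y hy => by
    rw [show H y = 0 from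
      (correction_eq_zero (u := u) (G := G) hfam.pos (ringMean a ρ u) hy).2, enorm_zero,
      ENNReal.zero_rpow_of_pos hq0]
  have hDR : ∀ x ∈ s, ∀ E : Set (Vec n), E ∩ D ∩ ring (a x) (ρ x / 2) (ρ x) =
      E ∩ ring (a x) (ρ x / 2) (ρ x) := by
    intro x hx E
    rw [inter_assoc, inter_eq_self_of_subset_right
      ((ring_subset_ball _ _ _).trans (hfam.subset x hx))]
  have hKK : K ≤ 2 * K + V := by
    rw [two_mul, add_assoc]
    exact le_self_add
  refine ⟨fun r hr => ?_, ?_, fun E hE τ hτ hτ1 => ?_⟩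
  · rw [setLIntegral_eq_of_zero_off hUm hv0, hfam.setLIntegral_inter_ring hDm]
    calc ∑ x ∈ s, ∫⁻ y in D ∩ ring (a x) (ρ x / 2) (ρ x), ‖v y‖ₑ ^ q
        ≤ ∑ x ∈ s, K * ENNReal.ofReal r ^ q * ∫⁻ y in wideRing (a x) (ρ x), ‖G y‖ₑ ^ q := by
          refine Finset.sum_le_sum fun x hx => ?_
          refine (lintegral_mono_set inter_subset_right).trans ((hloc x hx).1.trans ?_)
          gcongr
          exact hr x hx
      _ = K * ENNReal.ofReal r ^ q * ∫⁻ y in U', ‖G y‖ₑ ^ q := by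
          rw [← Finset.mul_sum, hfam.sum_setLIntegral_wideRing subset_rfl]
      _ ≤ _ := by gcongr
  · rw [setLIntegral_eq_of_zero_off hUm hH0, hfam.setLIntegral_inter_ring hDm]
    calc ∑ x ∈ s, ∫⁻ y in D ∩ ring (a x) (ρ x / 2) (ρ x), ‖H y‖ₑ ^ q
        ≤ ∑ x ∈ s, K * ∫⁻ y in wideRing (a x) (ρ x), ‖G y‖ₑ ^ q := by
          refine Finset.sum_le_sum fun x hx => ?_
          exact (lintegral_mono_set inter_subset_right).trans (hloc x hx).2.2
      _ = K * ∫⁻ y in U', ‖G y‖ₑ ^ q := by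
          rw [← Finset.mul_sum, hfam.sum_setLIntegral_wideRing subset_rfl]
      _ ≤ _ := by gcongr
  · classical
    set P : Vec n → Prop := fun x =>
      volume (E ∩ ring (a x) (ρ x / 2) (ρ x)) ≤ ENNReal.ofReal (τ ^ (n + 1) * ρ x ^ n) with hP
    have hbad : s.filter (fun x => ¬ P x) ⊆ s := Finset.filter_subset _ _
    have hgood : s.filter P ⊆ s := Finset.filter_subset _ _
    set E' := ⋃ x ∈ s.filter (fun x => ¬ P x), wideRing (a x) (ρ x) with hE'
    have hE'U : E' ⊆ U' := biUnion_subset_biUnion_left hbad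
    refine ⟨E', hE'U.trans hU'D, IsBallFamily.measurableSet_iUnion_wideRing _ a ρ, ?_, ?_⟩
    · calc volume E' ≤ ∑ x ∈ s.filter (fun x => ¬ P x), volume (wideRing (a x) (ρ x)) :=
            measure_biUnion_finset_le _ _
        _ ≤ ∑ x ∈ s.filter (fun x => ¬ P x), V * ENNReal.ofReal (τ ^ (n + 1))⁻¹ *
              volume (E ∩ ring (a x) (ρ x / 2) (ρ x)) := by
            refine Finset.sum_le_sum fun x hx => ?_
            obtain ⟨hxs, hxP⟩ := Finset.mem_filter.1 hx
            rw [hP, not_le] at hxP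
            have h1 : volume (wideRing (a x) (ρ x)) ≤ ENNReal.ofReal (ρ x ^ n) * V := by
              rw [hV, ← volume_ball_eq (a x) (hfam.pos x hxs)]
              exact measure_mono (ring_subset_ball _ _ _)
            refine h1.trans ?_
            have h2 : ENNReal.ofReal (ρ x ^ n) = ENNReal.ofReal (τ ^ (n + 1))⁻¹ *
                ENNReal.ofReal (τ ^ (n + 1) * ρ x ^ n) := by
              rw [← ENNReal.ofReal_mul (by positivity), inv_mul_cancel_left₀ (by positivity)]
            rw [h2, mul_comm _ V, mul_assoc]
            gcongr
        _ ≤ V * ENNReal.ofReal (τ ^ (n + 1))⁻¹ * ∑ x ∈ s,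
              volume (E ∩ ring (a x) (ρ x / 2) (ρ x)) := by
            rw [← Finset.mul_sum]
            gcongr
        _ = V * ENNReal.ofReal (τ ^ (n + 1))⁻¹ * volume (E ∩ U) := by
            have := hfam.setLIntegral_inter_ring hE (fun _ => 1)
            simp only [setLIntegral_one] at this
            rw [this]
        _ ≤ _ := by
            gcongr
            · exact le_add_self
            · exact hfam.iUnion_ring_subset.trans hU'D
    · rw [setLIntegral_eq_of_zero_off hUm hH0, hfam.setLIntegral_inter_ring (hE.inter hDm),
        Finset.sum_congr rfl fun x hx => by rw [hDR x hx],
        ← Finset.sum_filter_add_sum_filter_not s P]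
      have hsumG : ∑ x ∈ s.filter P, ∫⁻ y in E ∩ ring (a x) (ρ x / 2) (ρ x), ‖H y‖ₑ ^ q ≤
          K * ((∫⁻ y in E ∩ D, ‖G y‖ₑ ^ q) +
            2 * ENNReal.ofReal τ * ∫⁻ y in D, ‖G y‖ₑ ^ q) := by
        calc _ ≤ ∑ x ∈ s.filter P, K * ((∫⁻ y in E ∩ ring (a x) (ρ x / 2) (ρ x), ‖G y‖ₑ ^ q) +
              2 * ENNReal.ofReal τ * ∫⁻ y in wideRing (a x) (ρ x), ‖G y‖ₑ ^ q) := by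
              refine Finset.sum_le_sum fun x hx => ?_
              obtain ⟨hxs, hxP⟩ := Finset.mem_filter.1 hx
              have hρ := hfam.pos x hxs
              refine ((hloc x hxs).2.1 E hE τ hτ hτ1).trans ?_
              rw [two_mul]
              gcongr
              refine (mul_le_mul_left hxP _).trans (le_of_eq ?_)
              rw [← ENNReal.ofReal_mul (by positivity)]
              congr 1
              rw [mul_pow]
              field_simp
              ring
          _ = K * ((∑ x ∈ s.filter P, ∫⁻ y in E ∩ ring (a x) (ρ x / 2) (ρ x), ‖G y‖ₑ ^ q) +
              2 * ENNReal.ofReal τ *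
                ∑ x ∈ s.filter P, ∫⁻ y in wideRing (a x) (ρ x), ‖G y‖ₑ ^ q) := by
              rw [← Finset.mul_sum, Finset.sum_add_distrib, ← Finset.mul_sum]
          _ ≤ _ := by
              gcongr
              · refine (Finset.sum_le_sum_of_subset hgood).trans ?_
                rw [← hfam.setLIntegral_inter_ring hE]
                exact lintegral_mono_set (inter_subset_inter_right _
                  (hfam.iUnion_ring_subset.trans hU'D))
              · rw [hfam.sum_setLIntegral_wideRing hgood]
                exact lintegral_mono_set ((biUnion_subset_biUnion_left hgood).trans hU'D)
      have hsumB : ∑ x ∈ s.filter (fun x => ¬ P x),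
          ∫⁻ y in E ∩ ring (a x) (ρ x / 2) (ρ x), ‖H y‖ₑ ^ q ≤ K * ∫⁻ y in E', ‖G y‖ₑ ^ q := by
        rw [hE', ← hfam.sum_setLIntegral_wideRing hbad, Finset.mul_sum]
        refine Finset.sum_le_sum fun x hx => ?_
        exact (lintegral_mono_set inter_subset_right).trans (hloc x (hbad hx)).2.2
      refine (add_le_add hsumG hsumB).trans ?_
      calc _ ≤ 2 * K * ((∫⁻ y in E ∩ D, ‖G y‖ₑ ^ q) + ENNReal.ofReal τ *
            (∫⁻ y in D, ‖G y‖ₑ ^ q) + ∫⁻ y in E', ‖G y‖ₑ ^ q) := by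
            have e : ∀ A B C : ℝ≥0∞, K * (A + 2 * ENNReal.ofReal τ * B) + K * C ≤
                2 * K * (A + ENNReal.ofReal τ * B + C) := by
              intro A B C
              calc _ ≤ K * (A + 2 * ENNReal.ofReal τ * B) + K * C + (K * A + K * C) := le_self_add
                _ = _ := by ring
            exact e _ _ _
        _ ≤ _ := by
            gcongr
            exact le_self_add

end Estimates

/-! ### Energy, equi-integrability and weak convergence of the modified maps -/

/-- The map `u` with the correction added; it is constant on the intermediate spheres. -/
noncomputable def modified (s : Finset (Vec n)) (a : Vec n → Vec n) (ρ : Vec n → ℝ)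
    (u : Vec n → Vec m) (y : Vec n) : Vec m :=
  u y + correction s a ρ (ringMean a ρ u) u y

section Modified

variable {q : ℝ} {D : Set (Vec n)} {u : Vec n → Vec m} {s : Finset (Vec n)} {a : Vec n → Vec n}
  {ρ : Vec n → ℝ}

lemma isW01Pair_modified (hq : 1 < q) {G : Vec n → Mat m n} (hu : IsW01Pair q D u G)
    (hfam : IsBallFamily D s a ρ) :
    IsW01Pair q D (modified s a ρ u)
      (fun y => G y + correctionGrad s a ρ (ringMean a ρ u) u G y) :=
  hu.add hq (isW01Pair_correction hq hu hfam.pos hfam.subset _)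

lemma weakGrad_modified (hq : 1 < q) (hD : IsOpen D) (hu : MemW01 q D u)
    (hfam : IsBallFamily D s a ρ) :
    weakGrad D (modified s a ρ u) =ᵐ[volume.restrict D]
      fun y => weakGrad D u y + correctionGrad s a ρ (ringMean a ρ u) u (weakGrad D u) y :=
  (isW01Pair_modified hq (hu.isW01Pair hD) hfam).weakGrad_ae_eq hq hD

lemma HasGrowth.abs_le {c₁ c₂ : ℝ} {f : Mat m n → ℝ} (hf : HasGrowth q c₁ c₂ f) (ξ : Mat m n) :
    |f ξ| ≤ c₂ * (‖ξ‖ ^ q + 1) := by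
  have h1 := hf.lower ξ
  have h2 := hf.pos
  have h3 := hf.lt
  have h4 : 0 ≤ ‖ξ‖ ^ q := by positivity
  rw [_root_.abs_le]
  exact ⟨by nlinarith, hf.upper ξ⟩

lemma integrable_norm_rpow (hq : 1 < q) {α E : Type*} [MeasurableSpace α] {μ : Measure α}
    [NormedAddCommGroup E] {G : α → E} (hG : MemLp G (ENNReal.ofReal q) μ) :
    Integrable (fun x => ‖G x‖ ^ q) μ := by
  have := hG.integrable_norm_rpow (by simp; linarith) ENNReal.ofReal_ne_top
  rwa [ENNReal.toReal_ofReal (by linarith)] at this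

lemma integrable_energy (hq : 1 < q) (hDt : volume D ≠ ⊤) {c₁ c₂ : ℝ} {f : Mat m n → ℝ}
    (hf : HasGrowth q c₁ c₂ f) {G : Vec n → Mat m n}
    (hG : MemLp G (ENNReal.ofReal q) (volume.restrict D)) :
    Integrable (fun x => f (G x)) (volume.restrict D) := by
  have : IsFiniteMeasure (volume.restrict D) := ⟨by simpa using hDt.lt_top⟩
  refine Integrable.mono' (((integrable_norm_rpow hq hG).add (integrable_const 1)).const_mul c₂)
    (hf.measurable.comp_aemeasurable hG.1.aemeasurable).aestronglyMeasurable
    (Eventually.of_forall fun x => ?_)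
  rw [Real.norm_eq_abs]
  exact hf.abs_le _

/-- The factor by which the energy of the modified map may change, in terms of `|U|` and of the
gradient in the set `U` where the map is modified. -/
noncomputable def energyFactor (q c₂ : ℝ) (K : ℝ≥0∞) : ℝ≥0∞ :=
  ENNReal.ofReal c₂ * (2 + 1 + 2 ^ (q - 1) + 2 ^ (q - 1) * K)

lemma enorm_energy_sub_le (hq : 1 < q) (hD : IsOpen D) (hDt : volume D ≠ ⊤) {K : ℝ≥0∞}
    (hK : HasCorrectionBounds n m q K) (hu : MemW01 q D u) (hfam : IsBallFamily D s a ρ)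
    {c₁ c₂ : ℝ} {f : Mat m n → ℝ} (hf : HasGrowth q c₁ c₂ f) :
    ‖energy f D (modified s a ρ u) - energy f D u‖ₑ ≤
      energyFactor q c₂ K * (volume (⋃ x ∈ s, wideRing (a x) (ρ x)) +
        ∫⁻ y in ⋃ x ∈ s, wideRing (a x) (ρ x), ‖weakGrad D u y‖ₑ ^ q) := by
  have hq0 : 0 < q := by linarith
  have hup := hu.isW01Pair hD
  set G := weakGrad D u with hG
  set H := correctionGrad s a ρ (ringMean a ρ u) u G with hH
  set U := ⋃ x ∈ s, ring (a x) (ρ x / 2) (ρ x) with hU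
  set U' := ⋃ x ∈ s, wideRing (a x) (ρ x) with hU'
  have hUm : MeasurableSet U := IsBallFamily.measurableSet_iUnion_ring s a ρ
  have hUU' : U ⊆ U' := hfam.iUnion_ring_subset
  have hU'D : U' ⊆ D := hfam.iUnion_wideRing_subset
  have hHp := isW01Pair_correction hq hup hfam.pos hfam.subset (ringMean a ρ u)
  have hGH : MemLp (fun y => G y + H y) (ENNReal.ofReal q) (volume.restrict D) :=
    hup.memLp_grad.add hHp.memLp_grad
  have e1 : energy f D (modified s a ρ u) = ∫ y in D, f (G y + H y) := by
    refine integral_congr_ae ?_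
    filter_upwards [weakGrad_modified hq hD hu hfam] with y hy
    rw [hy]
  have e2 : energy f D (modified s a ρ u) - energy f D u =
      ∫ y in D, (f (G y + H y) - f (G y)) := by
    rw [e1, integral_sub (integrable_energy hq hDt hf hGH)
      (integrable_energy hq hDt hf hup.memLp_grad)]
    rfl
  have hc₂ : 0 ≤ c₂ := (hf.pos.trans hf.lt).le
  have h2t := two_rpow_ne_top hq
  have hpt : ∀ y, ‖f (G y + H y) - f (G y)‖ₑ ≤ ENNReal.ofReal c₂ *
      (2 + (1 + 2 ^ (q - 1)) * ‖G y‖ₑ ^ q + 2 ^ (q - 1) * ‖H y‖ₑ ^ q) := by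
    intro y
    have b1 : ∀ ξ : Mat m n, ‖f ξ‖ₑ ≤ ENNReal.ofReal c₂ * (‖ξ‖ₑ ^ q + 1) := by
      intro ξ
      rw [Real.enorm_eq_ofReal_abs]
      refine (ENNReal.ofReal_le_ofReal (hf.abs_le ξ)).trans (le_of_eq ?_)
      rw [ENNReal.ofReal_mul hc₂, ENNReal.ofReal_add (by positivity) one_pos.le,
        ENNReal.ofReal_one, ← ENNReal.ofReal_rpow_of_nonneg (norm_nonneg _) hq0.le, ofReal_norm]
    have b2 : ‖G y + H y‖ₑ ^ q ≤ 2 ^ (q - 1) * (‖G y‖ₑ ^ q + ‖H y‖ₑ ^ q) :=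
      (ENNReal.rpow_le_rpow (enorm_add_le _ _) hq0.le).trans
        (ENNReal.rpow_add_le_mul_rpow_add_rpow _ _ hq.le)
    calc _ ≤ ‖f (G y + H y)‖ₑ + ‖f (G y)‖ₑ := enorm_sub_le
      _ ≤ ENNReal.ofReal c₂ * (2 ^ (q - 1) * (‖G y‖ₑ ^ q + ‖H y‖ₑ ^ q) + 1) +
            ENNReal.ofReal c₂ * (‖G y‖ₑ ^ q + 1) := by
          refine add_le_add ((b1 _).trans ?_) (b1 _)
          gcongr
      _ = ENNReal.ofReal c₂ * ((1 + 1) + (1 + 2 ^ (q - 1)) * ‖G y‖ₑ ^ q +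
            2 ^ (q - 1) * ‖H y‖ₑ ^ q) := by ring
      _ = _ := by rw [one_add_one_eq_two]
  have hoff : ∀ y ∉ U, ‖f (G y + H y) - f (G y)‖ₑ = 0 := by
    intro y hy
    have : H y = 0 := (correction_eq_zero hfam.pos (ringMean a ρ u) hy).2
    rw [this, add_zero, sub_self, enorm_zero]
  have hGm : AEMeasurable (fun y => ‖G y‖ₑ ^ q) (volume.restrict U') :=
    ((hup.memLp_grad.1.mono_measure (Measure.restrict_mono hU'D le_rfl)).enorm).pow_const q
  rw [e2]
  set IG := ∫⁻ y in U', ‖G y‖ₑ ^ q with hIG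
  calc ‖∫ y in D, (f (G y + H y) - f (G y))‖ₑ
      ≤ ∫⁻ y in D, ‖f (G y + H y) - f (G y)‖ₑ := enorm_integral_le_lintegral_enorm _
    _ = ∫⁻ y in D ∩ U, ‖f (G y + H y) - f (G y)‖ₑ := setLIntegral_eq_of_zero_off hUm hoff D
    _ ≤ ∫⁻ y in U', ENNReal.ofReal c₂ *
          (2 + (1 + 2 ^ (q - 1)) * ‖G y‖ₑ ^ q + 2 ^ (q - 1) * ‖H y‖ₑ ^ q) :=
        (lintegral_mono_set (inter_subset_right.trans hUU')).trans (lintegral_mono hpt)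
    _ = ENNReal.ofReal c₂ * (2 * volume U' + (1 + 2 ^ (q - 1)) * IG +
          2 ^ (q - 1) * ∫⁻ y in U', ‖H y‖ₑ ^ q) := by
        rw [lintegral_const_mul' _ _ ENNReal.ofReal_ne_top, lintegral_add_left' (by fun_prop),
          lintegral_add_left' (by fun_prop), lintegral_const_mul' _ _ (by finiteness),
          lintegral_const_mul' _ _ h2t, setLIntegral_const]
    _ ≤ ENNReal.ofReal c₂ * (2 * volume U' + (1 + 2 ^ (q - 1)) * IG +
          2 ^ (q - 1) * (K * IG)) := by
        gcongr
        exact (lintegral_mono_set hU'D).trans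
          (hK.lintegral_correctionGrad hD.measurableSet hup hfam)
    _ ≤ ENNReal.ofReal c₂ * ((2 * volume U' + (1 + 2 ^ (q - 1)) * IG +
          2 ^ (q - 1) * (K * IG)) +
            ((1 + 2 ^ (q - 1) + 2 ^ (q - 1) * K) * volume U' + 2 * IG)) :=
        mul_le_mul_right le_self_add _
    _ = _ := by rw [energyFactor]; ring

lemma eLpNorm_one_indicator_rpow (hq : 1 < q) {E : Set (Vec n)} (hE : MeasurableSet E)
    (G : Vec n → Mat m n) :
    eLpNorm (E.indicator fun y => ‖G y‖ ^ q) 1 (volume.restrict D) =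
      ∫⁻ y in E ∩ D, ‖G y‖ₑ ^ q := by
  rw [eLpNorm_one_eq_lintegral_enorm]
  simp_rw [enorm_indicator_eq_indicator_enorm]
  rw [lintegral_indicator hE, Measure.restrict_restrict hE]
  refine lintegral_congr fun y => ?_
  rw [Real.enorm_eq_ofReal (by positivity),
    ← ENNReal.ofReal_rpow_of_nonneg (norm_nonneg _) (by linarith), ofReal_norm]

lemma equiIntegrableGrad_iff (hq : 1 < q) {u : ℕ → Vec n → Vec m} :
    EquiIntegrableGrad q D u ↔ ∀ η : ℝ, 0 < η → ∃ δ : ℝ, 0 < δ ∧ ∀ j E, MeasurableSet E →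
      volume (E ∩ D) ≤ ENNReal.ofReal δ →
        ∫⁻ y in E ∩ D, ‖weakGrad D (u j) y‖ₑ ^ q ≤ ENNReal.ofReal η := by
  constructor
  · intro h η hη
    obtain ⟨δ, hδ, h'⟩ := h hη
    refine ⟨δ, hδ, fun j E hE hv => ?_⟩
    rw [← eLpNorm_one_indicator_rpow hq hE]
    exact h' j E hE (by rwa [Measure.restrict_apply hE])
  · intro h η hη
    obtain ⟨δ, hδ, h'⟩ := h η hη
    refine ⟨δ, hδ, fun j E hE hv => ?_⟩
    rw [eLpNorm_one_indicator_rpow hq hE]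
    exact h' j E hE (by rwa [Measure.restrict_apply hE] at hv)

end Modified

section Sequences

variable {q : ℝ} {D : Set (Vec n)} {u : ℕ → Vec n → Vec m} {s : ℕ → Finset (Vec n)}
  {a : ℕ → Vec n → Vec n} {ρ : ℕ → Vec n → ℝ}

lemma equiIntegrableGrad_modified (hq : 1 < q) (hD : IsOpen D) {K : ℝ≥0∞} (hKt : K ≠ ⊤)
    (hK : HasCorrectionBounds n m q K) (hu : ∀ j, MemW01 q D (u j))
    (hfam : ∀ j, IsBallFamily D (s j) (a j) (ρ j)) {B : ℝ≥0∞} (hBt : B ≠ ⊤)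
    (hB : ∀ j, ∫⁻ y in D, ‖weakGrad D (u j) y‖ₑ ^ q ≤ B) (he : EquiIntegrableGrad q D u) :
    EquiIntegrableGrad q D fun j => modified (s j) (a j) (ρ j) (u j) := by
  have hq0 : 0 < q := by linarith
  have h2t := two_rpow_ne_top hq
  rw [equiIntegrableGrad_iff hq] at he ⊢
  intro η hη
  -- the final bound is `A` times the common bound `η₁` of the integrals that are made small
  set A : ℝ≥0∞ := 2 ^ (q - 1) * (1 + 3 * K) with hA
  have hAt : A ≠ ⊤ := by finiteness
  set η₁ : ℝ := η / (A.toReal + 1) with hη₁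
  have hη₁0 : 0 < η₁ := by positivity
  obtain ⟨δ₁, hδ₁, hδ⟩ := he η₁ hη₁0
  set τ : ℝ := min 1 (η₁ / (B.toReal + 1)) with hτ
  have hτ0 : 0 < τ := lt_min one_pos (by positivity)
  have hτ1 : τ ≤ 1 := min_le_left _ _
  have hτB : ENNReal.ofReal τ * B ≤ ENNReal.ofReal η₁ := by
    rw [← ENNReal.ofReal_toReal hBt, ← ENNReal.ofReal_mul hτ0.le]
    refine ENNReal.ofReal_le_ofReal ?_
    have h1 : τ ≤ η₁ / (B.toReal + 1) := min_le_right _ _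
    rw [le_div_iff₀ (by positivity)] at h1
    nlinarith
  set L : ℝ := K.toReal * (τ ^ (n + 1))⁻¹ + 1 with hL
  have hL1 : 1 ≤ L := by
    have : 0 ≤ K.toReal * (τ ^ (n + 1))⁻¹ := by positivity
    linarith
  refine ⟨δ₁ / L, by positivity, fun j E hE hvol => ?_⟩
  have hup := (hu j).isW01Pair hD
  set G := weakGrad D (u j) with hG
  set H := correctionGrad (s j) (a j) (ρ j) (ringMean (a j) (ρ j) (u j)) (u j) G with hH
  have hED : E ∩ D ⊆ D := inter_subset_right
  obtain ⟨E', hE'D, hE'm, hE'v, hE'H⟩ :=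
    hK.lintegral_correctionGrad_inter hD.measurableSet hup (hfam j) E hE τ hτ0 hτ1
  have hGE : ∫⁻ y in E ∩ D, ‖G y‖ₑ ^ q ≤ ENNReal.ofReal η₁ :=
    hδ j E hE (hvol.trans (ENNReal.ofReal_le_ofReal (div_le_self hδ₁.le hL1)))
  have hGE' : ∫⁻ y in E', ‖G y‖ₑ ^ q ≤ ENNReal.ofReal η₁ := by
    have h1 := hδ j E' hE'm
    rw [inter_eq_self_of_subset_left hE'D] at h1
    refine h1 (hE'v.trans ?_)
    calc K * ENNReal.ofReal (τ ^ (n + 1))⁻¹ * volume (E ∩ D)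
        ≤ ENNReal.ofReal L * ENNReal.ofReal (δ₁ / L) := by
          gcongr
          rw [hL, ENNReal.ofReal_add (by positivity) one_pos.le,
            ENNReal.ofReal_mul ENNReal.toReal_nonneg, ENNReal.ofReal_toReal hKt]
          exact le_self_add
      _ = ENNReal.ofReal δ₁ := by
          rw [← ENNReal.ofReal_mul (by positivity), mul_div_cancel₀ _ (by positivity)]
  have hHE : ∫⁻ y in E ∩ D, ‖H y‖ₑ ^ q ≤ K * (3 * ENNReal.ofReal η₁) := by
    refine hE'H.trans ?_
    gcongr
    calc _ ≤ ENNReal.ofReal η₁ + ENNReal.ofReal η₁ + ENNReal.ofReal η₁ :=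
          add_le_add (add_le_add hGE ((mul_le_mul_right (hB j) _).trans hτB)) hGE'
      _ = _ := by ring
  have hle : volume.restrict (E ∩ D) ≤ volume.restrict D := Measure.restrict_mono hED le_rfl
  have hGm : AEMeasurable (fun y => ‖G y‖ₑ ^ q) (volume.restrict (E ∩ D)) :=
    ((hup.memLp_grad.1.mono_measure hle).enorm).pow_const q
  have hae := ae_mono hle (weakGrad_modified hq hD (hu j) (hfam j))
  calc ∫⁻ y in E ∩ D, ‖weakGrad D (modified (s j) (a j) (ρ j) (u j)) y‖ₑ ^ q
      ≤ ∫⁻ y in E ∩ D, 2 ^ (q - 1) * (‖G y‖ₑ ^ q + ‖H y‖ₑ ^ q) := by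
        refine lintegral_mono_ae ?_
        filter_upwards [hae] with y hy
        rw [hy]
        exact (ENNReal.rpow_le_rpow (enorm_add_le _ _) hq0.le).trans
          (ENNReal.rpow_add_le_mul_rpow_add_rpow _ _ hq.le)
    _ = 2 ^ (q - 1) * ((∫⁻ y in E ∩ D, ‖G y‖ₑ ^ q) + ∫⁻ y in E ∩ D, ‖H y‖ₑ ^ q) := by
        rw [lintegral_const_mul' _ _ h2t, lintegral_add_left' hGm]
    _ ≤ 2 ^ (q - 1) * (ENNReal.ofReal η₁ + K * (3 * ENNReal.ofReal η₁)) := by gcongr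
    _ = A * ENNReal.ofReal η₁ := by rw [hA]; ring
    _ ≤ ENNReal.ofReal η := by
        rw [← ENNReal.ofReal_toReal hAt, ← ENNReal.ofReal_mul ENNReal.toReal_nonneg]
        refine ENNReal.ofReal_le_ofReal ?_
        rw [hη₁, mul_div_assoc', div_le_iff₀ (by positivity)]
        nlinarith [ENNReal.toReal_nonneg (a := A)]

lemma weakTendstoW1_modified (hq : 1 < q) (hD : IsOpen D) {K : ℝ≥0∞} (hKt : K ≠ ⊤)
    (hK : HasCorrectionBounds n m q K) (hu : ∀ j, MemW01 q D (u j))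
    (hfam : ∀ j, IsBallFamily D (s j) (a j) (ρ j)) {B : ℝ≥0∞} (hBt : B ≠ ⊤)
    (hB : ∀ j, ∫⁻ y in D, ‖weakGrad D (u j) y‖ₑ ^ q ≤ B) {r : ℕ → ℝ}
    (hr : ∀ j, ∀ x ∈ s j, ρ j x ≤ r j) (hr0 : Tendsto r atTop (𝓝 0)) {u₀ : Vec n → Vec m}
    (hw : WeakTendstoW1 q D u u₀) :
    WeakTendstoW1 q D (fun j => modified (s j) (a j) (ρ j) (u j)) u₀ := by
  have hq0 : 0 < q := by linarith
  set p := ENNReal.ofReal q with hp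
  set v : ℕ → Vec n → Vec m := fun j =>
    correction (s j) (a j) (ρ j) (ringMean (a j) (ρ j) (u j)) (u j) with hv
  set H : ℕ → Vec n → Mat m n := fun j =>
    correctionGrad (s j) (a j) (ρ j) (ringMean (a j) (ρ j) (u j)) (u j) (weakGrad D (u j)) with hH
  have hup := fun j => (hu j).isW01Pair hD
  have hvH : ∀ j, IsW01Pair q D (v j) (H j) := fun j =>
    isW01Pair_correction hq (hup j) (hfam j).pos (hfam j).subset _
  have hvb : ∀ j, eLpNorm (v j) p (volume.restrict D) ≤
      (K * B) ^ (1 / q) * ENNReal.ofReal (r j) := by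
    intro j
    rw [← ENNReal.rpow_le_rpow_iff hq0, ENNReal.mul_rpow_of_nonneg _ _ hq0.le, ← ENNReal.rpow_mul,
      one_div_mul_cancel hq0.ne', ENNReal.rpow_one, eLpNorm_rpow hq]
    refine (hK.lintegral_correction hD.measurableSet (hup j) (hfam j) (r j) (hr j)).trans ?_
    calc K * ENNReal.ofReal (r j) ^ q * ∫⁻ y in D, ‖weakGrad D (u j) y‖ₑ ^ q
        ≤ K * ENNReal.ofReal (r j) ^ q * B := by gcongr; exact hB j
      _ = _ := by ring
  have hKB : (K * B) ^ (1 / q) ≠ ⊤ :=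
    ENNReal.rpow_ne_top_of_nonneg (by positivity) (ENNReal.mul_ne_top hKt hBt)
  have hv0 : Tendsto (fun j => eLpNorm (v j) p (volume.restrict D)) atTop (𝓝 0) := by
    have hlim : Tendsto (fun j => (K * B) ^ (1 / q) * ENNReal.ofReal (r j)) atTop (𝓝 0) := by
      have h1 := ENNReal.tendsto_ofReal hr0
      rw [ENNReal.ofReal_zero] at h1
      simpa using ENNReal.Tendsto.const_mul h1 (Or.inr hKB)
    exact tendsto_of_tendsto_of_tendsto_of_le_of_le tendsto_const_nhds hlim
      (fun _ => zero_le) hvb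
  have hHb : ∀ j, eLpNorm (H j) p (volume.restrict D) ≤ ((K * B) ^ (1 / q)).toNNReal := by
    intro j
    rw [ENNReal.coe_toNNReal hKB, ← ENNReal.rpow_le_rpow_iff hq0, ← ENNReal.rpow_mul,
      one_div_mul_cancel hq0.ne', ENNReal.rpow_one, eLpNorm_rpow hq]
    refine (hK.lintegral_correctionGrad hD.measurableSet (hup j) (hfam j)).trans ?_
    gcongr
    exact (lintegral_mono_set (hfam j).iUnion_wideRing_subset).trans (hB j)
  refine ⟨?_, ?_⟩
  · exact hw.1.add_of_tendsto_zero hq (fun j => (hup j).memLp) (fun j => (hvH j).memLp)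
      (weakTendstoLp_zero_of_tendsto hq (fun j => (hvH j).memLp) hv0)
      (fun j => ae_eq_refl _)
  · exact hw.2.add_of_tendsto_zero hq (fun j => (hup j).memLp_grad) (fun j => (hvH j).memLp_grad)
      (weakTendstoLp_grad_zero hq hD hvH hv0 hHb)
      (fun j => weakGrad_modified hq hD (hu j) (hfam j))

end Sequences

/-! ### The choice of the annuli -/

/-- A point lies in at most `n + 1` of the dyadic wide annuli. -/
lemma card_wideRing_le (a y : Vec n) {R : ℝ} (hR : 0 < R) (k : ℕ) [DecidablePred fun l : ℕ =>
    y ∈ wideRing a ((2 ^ l)⁻¹ * R)] :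
    ((Finset.range k).filter fun l : ℕ => y ∈ wideRing a ((2 ^ l)⁻¹ * R)).card ≤ n + 1 := by
  set T := (Finset.range k).filter fun l : ℕ => y ∈ wideRing a ((2 ^ l)⁻¹ * R) with hT
  rcases T.eq_empty_or_nonempty with h | h
  · rw [h]; simp
  set l₀ := T.min' h with hl₀
  have hmem : y ∈ wideRing a ((2 ^ l₀)⁻¹ * R) := (Finset.mem_filter.1 (T.min'_mem h)).2
  have hsub : T ⊆ Finset.Ico l₀ (l₀ + (n + 1)) := by
    intro l hl
    rw [Finset.mem_Ico]
    refine ⟨T.min'_le l hl, ?_⟩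
    by_contra hcon
    rw [not_lt] at hcon
    have h1 := (Finset.mem_filter.1 hl).2.2
    have h2 := hmem.1
    have h3 : (2 ^ l : ℝ)⁻¹ * R ≤ (2 ^ (n + 1))⁻¹ * ((2 ^ l₀)⁻¹ * R) := by
      rw [← mul_assoc, ← mul_inv, ← pow_add]
      refine mul_le_mul_of_nonneg_right (inv_anti₀ (by positivity) ?_) hR.le
      exact pow_le_pow_right₀ (by norm_num) (by omega)
    linarith
  calc T.card ≤ (Finset.Ico l₀ (l₀ + (n + 1))).card := Finset.card_le_card hsub
    _ = n + 1 := by simp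

/-- Among the first `k` wide annuli in a ball there is one whose measure is at most `(n + 1) / k`
times the measure of the ball. -/
lemma exists_wideRing_measure_le (ν : Measure (Vec n)) (a : Vec n) {R : ℝ} (hR : 0 < R) {k : ℕ}
    (hk : 1 ≤ k) :
    ∃ l < k, k * ν (wideRing a ((2 ^ l)⁻¹ * R)) ≤ (n + 1) * ν (Metric.ball a R) := by
  classical
  obtain ⟨l, hl, hmin⟩ := (Finset.range k).exists_min_image
    (fun l => ν (wideRing a ((2 ^ l)⁻¹ * R))) ⟨0, Finset.mem_range.2 hk⟩
  refine ⟨l, Finset.mem_range.1 hl, ?_⟩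
  have h1 := (Finset.range k).card_nsmul_le_sum _ _ hmin
  rw [Finset.card_range, nsmul_eq_mul] at h1
  refine h1.trans ?_
  have hsub : ∀ l : ℕ, wideRing a ((2 ^ l)⁻¹ * R) ⊆ Metric.ball a R := fun l =>
    (ring_subset_ball _ _ _).trans (Metric.ball_subset_ball
      (mul_le_of_le_one_left hR.le (inv_le_one_of_one_le₀ (one_le_pow₀ (by norm_num)))))
  calc ∑ l ∈ Finset.range k, ν (wideRing a ((2 ^ l)⁻¹ * R))
      = ∫⁻ y in Metric.ball a R, ∑ l ∈ Finset.range k,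
          (wideRing a ((2 ^ l)⁻¹ * R)).indicator (fun _ => (1 : ℝ≥0∞)) y ∂ν := by
        rw [lintegral_finsetSum _ fun l _ =>
          measurable_const.indicator (measurableSet_wideRing _ _)]
        refine Finset.sum_congr rfl fun l _ => ?_
        rw [lintegral_indicator (measurableSet_wideRing _ _), lintegral_one,
          Measure.restrict_restrict (measurableSet_wideRing _ _), Measure.restrict_apply_univ,
          inter_eq_self_of_subset_left (hsub l)]
    _ ≤ ∫⁻ _ in Metric.ball a R, (n + 1 : ℝ≥0∞) ∂ν := by
        refine lintegral_mono fun y => ?_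
        simp only [indicator_apply]
        rw [Finset.sum_boole]
        exact_mod_cast card_wideRing_le a y hR k
    _ = (n + 1) * ν (Metric.ball a R) := setLIntegral_const _ _

/-! ### Families of balls around good centres -/

/-- The outer radius `2^{-l} θ ε / M` of the annulus of index `l`. -/
noncomputable def dyadicRadius (ε θ M : ℝ) (l : ℕ) : ℝ := (2 ^ l)⁻¹ * (θ * ε / M)

lemma annulus_eq_ring (ε θ M : ℝ) (l : ℕ) (x : Vec n) :
    annulus ε θ M l x = ring (ε • x) (dyadicRadius ε θ M l / 2) (dyadicRadius ε θ M l) := by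
  have h : (2 ^ (l + 1) : ℝ)⁻¹ * (θ * ε / M) = dyadicRadius ε θ M l / 2 := by
    rw [dyadicRadius, pow_succ, mul_inv]
    ring
  rw [annulus, h]
  rfl

lemma midRadius_eq (ε θ M : ℝ) (l : ℕ) : midRadius ε θ M l = 3 / 4 * dyadicRadius ε θ M l :=
  mul_assoc _ _ _

lemma dyadicRadius_pos {ε θ M : ℝ} (hε : 0 < ε) (hM : 0 < M) (hθ : 0 < θ) (l : ℕ) :
    0 < dyadicRadius ε θ M l := by
  rw [dyadicRadius]; positivity

lemma dyadicRadius_zero (ε θ M : ℝ) : dyadicRadius ε θ M 0 = θ * ε / M := by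
  rw [dyadicRadius, pow_zero, inv_one, one_mul]

lemma dyadicRadius_le {ε θ M : ℝ} (hε : 0 < ε) (hM : 0 < M) (hθ : 0 < θ) (l : ℕ) :
    dyadicRadius ε θ M l ≤ θ * ε / M :=
  mul_le_of_le_one_left (by positivity) (inv_le_one_of_one_le₀ (one_le_pow₀ (by norm_num)))

lemma scaled_radius_le {ε θ M : ℝ} (hε : 0 < ε) (hM : 0 < M) (hθ1 : θ < 1) :
    θ * ε / M ≤ ε / M := by
  gcongr
  exact mul_le_of_le_one_left hε.le hθ1.le

namespace GoodCentres

variable {D : Set (Vec n)} {ε M : ℝ} {G : Set (Vec n)}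

lemma ball_subset (h : GoodCentres D ε M G) {x : Vec n} (hx : x ∈ G) :
    Metric.ball (ε • x) (ε / M) ⊆ D :=
  Metric.ball_subset_closedBall.trans (h.closedBall_subset x hx)

lemma disjoint_ball (h : GoodCentres D ε M G) (hε : 0 < ε) {x y : Vec n} (hx : x ∈ G) (hy : y ∈ G)
    (hne : x ≠ y) : Disjoint (Metric.ball (ε • x) (ε / M)) (Metric.ball (ε • y) (ε / M)) := by
  refine Metric.ball_disjoint_ball ?_
  rw [dist_eq_norm, ← smul_sub, norm_smul, Real.norm_eq_abs, abs_of_pos hε]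
  calc ε / M + ε / M = ε * (2 / M) := by ring
    _ ≤ _ := mul_le_mul_of_nonneg_left (h.separated x hx y hy hne) hε.le

/-- There are only finitely many good centres, since the balls around them are disjoint, have the
same volume and lie in a set of finite volume. -/
lemma finite (h : GoodCentres D ε M G) (hε : 0 < ε) (hM : 0 < M) (hDt : volume D ≠ ⊤) :
    G.Finite := by
  have hpos : 0 < volume (Metric.ball (0 : Vec n) (ε / M)) :=
    Metric.measure_ball_pos volume _ (by positivity)
  have := Measure.finite_const_le_meas_of_disjoint_iUnion (volume : Measure (Vec n)) hpos
    (As := fun x : G => Metric.ball (ε • (x : Vec n)) (ε / M))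
    (fun x => Metric.isOpen_ball.measurableSet)
    (fun x y hxy => h.disjoint_ball hε x.2 y.2 fun hc => hxy (Subtype.ext hc))
    (ne_top_of_le_ne_top hDt (measure_mono (iUnion_subset fun x => h.ball_subset x.2)))
  have huniv : {i : G | volume (Metric.ball (0 : Vec n) (ε / M)) ≤
      volume (Metric.ball (ε • (i : Vec n)) (ε / M))} = univ := by
    refine eq_univ_of_forall fun x => ?_
    exact (Measure.addHaar_ball_center volume _ _).ge
  rw [huniv] at this
  exact Set.finite_coe_iff.1 (Set.finite_univ_iff.1 this)

lemma isBallFamily (h : GoodCentres D ε M G) (hG : G.Finite) (hε : 0 < ε) {ρ : Vec n → ℝ}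
    (hρ : ∀ x ∈ G, 0 < ρ x) (hρle : ∀ x ∈ G, ρ x ≤ ε / M) :
    IsBallFamily D hG.toFinset (fun x => ε • x) ρ where
  pos x hx := hρ x (hG.mem_toFinset.1 hx)
  subset x hx := by
    rw [hG.mem_toFinset] at hx
    exact (Metric.ball_subset_ball (hρle x hx)).trans (h.ball_subset hx)
  disjoint x hx y hy hne := by
    rw [hG.mem_toFinset] at hx hy
    exact (h.disjoint_ball hε hx hy hne).mono (Metric.ball_subset_ball (hρle x hx))
      (Metric.ball_subset_ball (hρle y hy))

end GoodCentres

namespace IsBallFamily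

variable {D : Set (Vec n)} {s : Finset (Vec n)} {a : Vec n → Vec n} {ρ : Vec n → ℝ}

lemma sum_measure_ball_le (h : IsBallFamily D s a ρ) (ν : Measure (Vec n)) :
    ∑ x ∈ s, ν (Metric.ball (a x) (ρ x)) ≤ ν D := by
  rw [← measure_biUnion_finset (h.pairwiseDisjoint fun x _ => subset_rfl)
    fun x _ => Metric.isOpen_ball.measurableSet]
  exact measure_mono (iUnion₂_subset h.subset)

/-- If the radii are scaled by `θ`, the balls occupy at most a fraction `θⁿ` of `D`. -/
lemma volume_iUnion_wideRing_le (h : IsBallFamily D s a ρ) {θ : ℝ} (hθ : 0 < θ)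
    {r : Vec n → ℝ} (hr : ∀ x ∈ s, r x ≤ θ * ρ x) :
    volume (⋃ x ∈ s, wideRing (a x) (r x)) ≤ ENNReal.ofReal (θ ^ n) * volume D := by
  calc volume (⋃ x ∈ s, wideRing (a x) (r x))
      ≤ ∑ x ∈ s, volume (wideRing (a x) (r x)) := measure_biUnion_finset_le _ _
    _ ≤ ∑ x ∈ s, ENNReal.ofReal (θ ^ n) * volume (Metric.ball (a x) (ρ x)) := by
        refine Finset.sum_le_sum fun x hx => ?_
        have hρ := h.pos x hx
        refine (measure_mono ((ring_subset_ball _ _ _).trans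
          (Metric.ball_subset_ball (hr x hx)))).trans (le_of_eq ?_)
        rw [volume_ball_eq _ (by positivity : 0 < θ * ρ x), volume_ball_eq _ hρ, mul_pow,
          ENNReal.ofReal_mul (by positivity), mul_assoc]
    _ ≤ ENNReal.ofReal (θ ^ n) * volume D := by
        rw [← Finset.mul_sum]
        gcongr
        exact h.sum_measure_ball_le volume

end IsBallFamily

/-! ### The modified sequence -/

section ModifiedSeq

variable {q : ℝ} {D : Set (Vec n)} {ε : ℕ → ℝ} {θ M : ℝ} {G : ℕ → Set (Vec n)}
  {u : ℕ → Vec n → Vec m} {u₀ : Vec n → Vec m}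

/-- The maps `u_j`, modified in the annuli of index `κ j x` around `ε_j x`, `x ∈ G_j`. -/
noncomputable def modifiedSeq (ε : ℕ → ℝ) (θ M : ℝ) {G : ℕ → Set (Vec n)}
    (hG : ∀ j, (G j).Finite) (κ : ℕ → Vec n → ℕ) (u : ℕ → Vec n → Vec m) (j : ℕ) :
    Vec n → Vec m :=
  modified (hG j).toFinset (fun x => ε j • x) (fun x => dyadicRadius (ε j) θ M (κ j x)) (u j)

lemma isModification_modifiedSeq (hq : 1 < q) (hD : IsOpen D) {K : ℝ≥0∞} (hKt : K ≠ ⊤)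
    (hK : HasCorrectionBounds n m q K) (hu : ∀ j, MemW01 q D (u j)) {B : ℝ≥0∞} (hBt : B ≠ ⊤)
    (hB : ∀ j, ∫⁻ y in D, ‖weakGrad D (u j) y‖ₑ ^ q ≤ B) (hw : WeakTendstoW1 q D u u₀)
    (hε : ∀ j, 0 < ε j) (hε0 : Tendsto ε atTop (𝓝 0)) (hM : 0 < M) (hθ : 0 < θ)
    (hG : ∀ j, (G j).Finite) (κ : ℕ → Vec n → ℕ)
    (hfam : ∀ j, IsBallFamily D (hG j).toFinset (fun x => ε j • x)
      (fun x => dyadicRadius (ε j) θ M (κ j x))) :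
    IsModification q D ε θ M G κ u u₀ (modifiedSeq ε θ M hG κ u) where
  mem j := (isW01Pair_modified hq ((hu j).isW01Pair hD) (hfam j)).memW01 hq
  eq_off j := by
    refine Eventually.of_forall fun y hy => ?_
    have hy' : y ∉ ⋃ x ∈ (hG j).toFinset, ring (ε j • x) (dyadicRadius (ε j) θ M (κ j x) / 2)
        (dyadicRadius (ε j) θ M (κ j x)) := by
      simpa only [annulus_eq_ring, Set.Finite.mem_toFinset] using hy
    have := (correction_eq_zero (u := u j) (G := weakGrad D (u j)) (hfam j).pos
      (ringMean (fun x => ε j • x) (fun x => dyadicRadius (ε j) θ M (κ j x)) (u j)) hy').1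
    rw [modifiedSeq, modified, this, add_zero]
  eq_on_sphere j x hx := by
    rw [midRadius_eq, annulus_eq_ring]
    exact eqConstOnSphere_correction hq ((hu j).isW01Pair hD) (hfam j).pos (hfam j).subset
      (hfam j).disjoint (ringMean (fun x => ε j • x) _ (u j)) ((hG j).mem_toFinset.2 hx)
  weakTendsto := by
    refine weakTendstoW1_modified hq hD hKt hK hu hfam hBt hB
      (r := fun j => θ * ε j / M) (fun j x _ => dyadicRadius_le (hε j) hM hθ _) ?_ hw
    simpa using (hε0.const_mul θ).div_const M

end ModifiedSeq

/-! ### The energy estimates -/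

section Estimates

variable {q : ℝ} {D : Set (Vec n)} {s : Finset (Vec n)} {a : Vec n → Vec n} {R : ℝ}

/-- In a suitable dyadic annulus of every ball, the total measure and energy is at most the fraction
`(n + 1) / k` of that in `D`. -/
lemma exists_index_sum_le (hD : MeasurableSet D) (hR : 0 < R)
    (hfam : IsBallFamily D s a fun _ => R) (g : Vec n → ℝ≥0∞) {k : ℕ} (hk : 1 ≤ k) :
    ∃ κ : Vec n → ℕ, (∀ x, κ x < k) ∧
      k * (volume (⋃ x ∈ s, wideRing (a x) ((2 ^ κ x)⁻¹ * R)) +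
        ∫⁻ y in ⋃ x ∈ s, wideRing (a x) ((2 ^ κ x)⁻¹ * R), g y) ≤
      (n + 1) * (volume D + ∫⁻ y in D, g y) := by
  set ν : Measure (Vec n) := volume.restrict D + (volume.restrict D).withDensity g with hν
  have hνU : ∀ U ⊆ D, MeasurableSet U → ν U = volume U + ∫⁻ y in U, g y := by
    intro U hUD hU
    rw [hν, Measure.add_apply, withDensity_apply _ hU, Measure.restrict_restrict hU,
      Measure.restrict_apply hU, inter_eq_self_of_subset_left hUD]
  choose κ hκ hκν using fun x => exists_wideRing_measure_le ν (a x) hR hk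
  refine ⟨κ, hκ, ?_⟩
  have hsub : ⋃ x ∈ s, wideRing (a x) ((2 ^ κ x)⁻¹ * R) ⊆ D :=
    iUnion₂_subset fun x hx => (ring_subset_ball _ _ _).trans ((Metric.ball_subset_ball
      (mul_le_of_le_one_left hR.le (inv_le_one_of_one_le₀ (one_le_pow₀ (by norm_num))))).trans
      (hfam.subset x hx))
  rw [← hνU _ hsub (IsBallFamily.measurableSet_iUnion_wideRing s a _), ← hνU D subset_rfl hD]
  calc k * ν (⋃ x ∈ s, wideRing (a x) ((2 ^ κ x)⁻¹ * R))
      ≤ k * ∑ x ∈ s, ν (wideRing (a x) ((2 ^ κ x)⁻¹ * R)) := by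
        gcongr
        exact measure_biUnion_finset_le _ _
    _ ≤ ∑ x ∈ s, (n + 1) * ν (Metric.ball (a x) R) := by
        rw [Finset.mul_sum]
        exact Finset.sum_le_sum fun x _ => hκν x
    _ ≤ (n + 1) * ν D := by
        rw [← Finset.mul_sum]
        gcongr
        exact hfam.sum_measure_ball_le ν

/-- The constant `C(s)` as a function of the bound `s` for the norms of the gradients. -/
noncomputable def joiningConst (n : ℕ) (q : ℝ) (L V s : ℝ≥0∞) : ℝ :=
  (L * (n + 1) * (V + s ^ q)).toReal + L.toReal + 1

lemma joiningConst_pos (n : ℕ) (q : ℝ) (L V s : ℝ≥0∞) : 0 < joiningConst n q L V s := by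
  rw [joiningConst]; positivity

lemma le_ofReal_joiningConst {L V s : ℝ≥0∞} (h : L * (n + 1) * (V + s ^ q) ≠ ⊤) :
    L * (n + 1) * (V + s ^ q) ≤ ENNReal.ofReal (joiningConst n q L V s) := by
  rw [joiningConst, add_assoc, ENNReal.ofReal_add (by positivity) (by positivity),
    ENNReal.ofReal_toReal h]
  exact le_self_add

lemma abs_le_joiningConst_div {L V s : ℝ≥0∞} (h : L * (n + 1) * (V + s ^ q) ≠ ⊤) {k : ℕ}
    (hk : 1 ≤ k) {A : ℝ≥0∞} (hA : k * A ≤ (n + 1) * (V + s ^ q)) {e : ℝ} (he : ‖e‖ₑ ≤ L * A) :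
    |e| ≤ joiningConst n q L V s / k := by
  have hk0 : (0 : ℝ) < k := by exact_mod_cast hk
  have hC := joiningConst_pos n q L V s
  rw [le_div_iff₀ hk0, ← ENNReal.ofReal_le_ofReal_iff hC.le, ENNReal.ofReal_mul (abs_nonneg _),
    ← Real.enorm_eq_ofReal_abs, ENNReal.ofReal_natCast]
  calc ‖e‖ₑ * k ≤ L * A * k := by gcongr
    _ = L * (k * A) := by ring
    _ ≤ L * ((n + 1) * (V + s ^ q)) := by gcongr
    _ = L * (n + 1) * (V + s ^ q) := by ring
    _ ≤ _ := le_ofReal_joiningConst h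

/-- If the set of volume `A` in which the map is modified is so small that its gradient energy `I`
is at most `1 / k` as soon as `A ≤ δ`, then the energy changes by at most a multiple of `θⁿ` plus
a multiple of `1 / k`; for `A > δ` the whole gradient energy is absorbed into the first term. -/
lemma abs_le_add_joiningConst_div {L V s : ℝ≥0∞} (hL : L ≠ ⊤) (hV : V ≠ ⊤) (hs : s ^ q ≠ ⊤)
    {k : ℕ} (hk : 1 ≤ k) {A I : ℝ≥0∞} {t δ : ℝ} (ht : 0 ≤ t) (hδ : 0 < δ)
    (hA : A ≤ ENNReal.ofReal t * V) (hIs : I ≤ s ^ q)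
    (hI : A ≤ ENNReal.ofReal δ → I ≤ ENNReal.ofReal (1 / (k + 1))) {e : ℝ}
    (he : ‖e‖ₑ ≤ L * (A + I)) :
    |e| ≤ ((L * V * (1 + s ^ q / ENNReal.ofReal δ)).toReal + 1) * t +
      joiningConst n q L V s / k := by
  have hk0 : (0 : ℝ) < k := by exact_mod_cast hk
  have hC := joiningConst_pos n q L V s
  have hδ' : ENNReal.ofReal δ ≠ 0 := by simpa using hδ
  have hXt : L * V * (1 + s ^ q / ENNReal.ofReal δ) ≠ ⊤ :=
    ENNReal.mul_ne_top (ENNReal.mul_ne_top hL hV)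
      (ENNReal.add_ne_top.2 ⟨ENNReal.one_ne_top, ENNReal.div_ne_top hs hδ'⟩)
  set X := L * V * (1 + s ^ q / ENNReal.ofReal δ) with hX
  have hXle : X ≤ ENNReal.ofReal (X.toReal + 1) := by
    rw [ENNReal.ofReal_add (by positivity) (by positivity), ENNReal.ofReal_toReal hXt]
    exact le_self_add
  rw [← ENNReal.ofReal_le_ofReal_iff (by positivity), ← Real.enorm_eq_ofReal_abs,
    ENNReal.ofReal_add (by positivity) (by positivity), ENNReal.ofReal_mul (by positivity)]
  refine he.trans ?_
  rcases le_or_gt A (ENNReal.ofReal δ) with h | h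
  · have h1 : L * ENNReal.ofReal (1 / (k + 1)) ≤
        ENNReal.ofReal (joiningConst n q L V s / k) := by
      have h2 : L * ENNReal.ofReal (1 / (k + 1)) = ENNReal.ofReal (L.toReal / (k + 1)) := by
        rw [div_eq_mul_one_div L.toReal, ENNReal.ofReal_mul ENNReal.toReal_nonneg,
          ENNReal.ofReal_toReal hL]
      rw [h2]
      refine ENNReal.ofReal_le_ofReal (div_le_div₀ hC.le ?_ hk0 (by linarith))
      rw [joiningConst]
      have : 0 ≤ (L * (n + 1) * (V + s ^ q)).toReal := ENNReal.toReal_nonneg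
      linarith
    rw [mul_add]
    refine add_le_add ?_ ((mul_le_mul_right (hI h) _).trans h1)
    calc L * A ≤ L * (ENNReal.ofReal t * V) := by gcongr
      _ = L * V * 1 * ENNReal.ofReal t := by ring
      _ ≤ X * ENNReal.ofReal t := by
          rw [hX]
          gcongr
          exact le_self_add
      _ ≤ _ := by gcongr
  · refine le_trans ?_ le_self_add
    have h1 : I ≤ s ^ q / ENNReal.ofReal δ * (ENNReal.ofReal t * V) := by
      calc I ≤ s ^ q := hIs
        _ = s ^ q / ENNReal.ofReal δ * ENNReal.ofReal δ :=
            (ENNReal.div_mul_cancel hδ' ENNReal.ofReal_ne_top).symm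
        _ ≤ _ := mul_le_mul_right (h.le.trans hA) _
    calc L * (A + I) ≤ L * (ENNReal.ofReal t * V +
          s ^ q / ENNReal.ofReal δ * (ENNReal.ofReal t * V)) := by gcongr
      _ = X * ENNReal.ofReal t := by rw [hX]; ring
      _ ≤ _ := by gcongr

lemma energyFactor_ne_top (hq : 1 < q) (c₂ : ℝ) {K : ℝ≥0∞} (hK : K ≠ ⊤) :
    energyFactor q c₂ K ≠ ⊤ := by
  have := two_rpow_ne_top hq
  rw [energyFactor]
  finiteness

end Estimates

end JoiningLemma

open JoiningLemma

theorem lemma4p6 {n m : ℕ} (q c₂ : ℝ) (hq : 1 < q) (hqn : q < n)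
    (D : Set (Vec n)) (hD : IsOpen D) (hDb : Bornology.IsBounded D) :
    ∃ C : ℝ≥0∞ → ℝ, (∀ s, 0 < C s) ∧
      ∀ (u : ℕ → Vec n → Vec m)
        (u₀ : Vec n → Vec m),
        (∀ j, MemW01 q D (u j)) → MemW01 q D u₀ →
        WeakTendstoW1 q D u u₀ →
        supGradNorm q D u < ⊤ ∧
        (∀ (f : Mat m n → ℝ) (c₁ : ℝ), HasGrowth q c₁ c₂ f →
          ∀ (ε : ℕ → ℝ) (M θ : ℝ) (k : ℕ) (G : ℕ → Set (Vec n)),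
            (∀ j, 0 < ε j) → Antitone ε → Tendsto ε atTop (𝓝 0) → 0 < M → 0 < θ → θ < 1 →
            1 ≤ k → (∀ j, GoodCentres D (ε j) M (G j)) →
            ∃ (κ : ℕ → Vec n → ℕ)
              (w : ℕ → Vec n → Vec m),
              (∀ j, ∀ x ∈ G j, κ j x < k) ∧
              IsModification q D ε θ M G κ u u₀ w ∧
              (∀ j, |energy f D (w j) - energy f D (u j)| ≤
                C (supGradNorm q D u) / k) ∧
              (EquiIntegrableGrad q D u →
                EquiIntegrableGrad q D w)) ∧
        (EquiIntegrableGrad q D u →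
          ∃ C' : ℕ → ℝ, (∀ k, 0 < C' k) ∧
            ∀ (f : Mat m n → ℝ) (c₁ : ℝ), HasGrowth q c₁ c₂ f →
            ∀ (ε : ℕ → ℝ) (M θ : ℝ) (k : ℕ) (G : ℕ → Set (Vec n)),
              (∀ j, 0 < ε j) → Antitone ε → Tendsto ε atTop (𝓝 0) → 0 < M → 0 < θ → θ < 1 →
              1 ≤ k → (∀ j, GoodCentres D (ε j) M (G j)) →
              ∃ w : ℕ → Vec n → Vec m,
                IsModification q D ε θ M G (fun _ _ => 0) u u₀ w ∧
                (∀ j, |energy f D (w j) - energy f D (u j)| ≤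
                  C' k * θ ^ n + C (supGradNorm q D u) / k) ∧
                EquiIntegrableGrad q D w) := by
  have hn : 2 ≤ n := by
    have : (1 : ℝ) < n := hq.trans hqn
    exact_mod_cast this
  have hq0 : 0 < q := by linarith
  have hDt : volume D ≠ ⊤ := hDb.measure_lt_top.ne
  obtain ⟨K, hKt, hK⟩ := exists_hasCorrectionBounds hq hn m
  set L := energyFactor q c₂ K with hL
  have hLt : L ≠ ⊤ := energyFactor_ne_top hq c₂ hKt
  refine ⟨joiningConst n q L (volume D), joiningConst_pos n q L (volume D), ?_⟩
  intro u u₀ hu hu₀ hw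
  have hS : supGradNorm q D u < ⊤ :=
    hw.2.iSup_eLpNorm_lt_top hq fun j => ((hu j).isW01Pair hD).memLp_grad
  set S := supGradNorm q D u with hSdef
  have hSt : S ^ q ≠ ⊤ := ENNReal.rpow_ne_top_of_nonneg hq0.le hS.ne
  have hB : ∀ j, ∫⁻ y in D, ‖weakGrad D (u j) y‖ₑ ^ q ≤ S ^ q := by
    intro j
    rw [← eLpNorm_rpow hq]
    exact ENNReal.rpow_le_rpow (le_iSup (fun j => eLpNorm (weakGrad D (u j)) (ENNReal.ofReal q)
      (volume.restrict D)) j) hq0.le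
  have hCt : L * (n + 1) * (volume D + S ^ q) ≠ ⊤ := by finiteness
  refine ⟨hS, ?_, ?_⟩
  · intro f c₁ hf ε M θ k G hε _ hε0 hM hθ hθ1 hk hgood
    have hG := fun j => (hgood j).finite (hε j) hM hDt
    -- the index of the annulus is chosen in the ball of radius `θ ε / M`, which contains all annuli
    have hbig : ∀ j, IsBallFamily D (hG j).toFinset (fun x => ε j • x) fun _ => θ * ε j / M :=
      fun j => (hgood j).isBallFamily (hG j) (hε j)
        (fun _ _ => by have := hε j; positivity) fun _ _ => scaled_radius_le (hε j) hM hθ1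
    choose κ hκ hκsum using fun j => exists_index_sum_le hD.measurableSet
      (by have := hε j; positivity) (hbig j) (fun y => ‖weakGrad D (u j) y‖ₑ ^ q) hk
    have hfam : ∀ j, IsBallFamily D (hG j).toFinset (fun x => ε j • x)
        (fun x => dyadicRadius (ε j) θ M (κ j x)) := fun j =>
      (hgood j).isBallFamily (hG j) (hε j) (fun _ _ => dyadicRadius_pos (hε j) hM hθ _)
        fun _ _ => (dyadicRadius_le (hε j) hM hθ _).trans (scaled_radius_le (hε j) hM hθ1)
    refine ⟨κ, modifiedSeq ε θ M hG κ u, fun j x _ => hκ j x,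
      isModification_modifiedSeq hq hD hKt hK hu hSt hB hw hε hε0 hM hθ hG κ hfam, fun j => ?_,
      equiIntegrableGrad_modified hq hD hKt hK hu hfam hSt hB⟩
    refine abs_le_joiningConst_div hCt hk ((hκsum j).trans ?_)
      (enorm_energy_sub_le hq hD hDt hK (hu j) (hfam j) hf)
    gcongr
    exact hB j
  · intro he
    have he' := (equiIntegrableGrad_iff hq).1 he
    choose δ hδ0 hδ using fun k : ℕ => he' (1 / ((k : ℝ) + 1)) (by positivity)
    refine ⟨fun k => (L * volume D * (1 + S ^ q / ENNReal.ofReal (δ k))).toReal + 1,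
      fun k => by positivity, ?_⟩
    intro f c₁ hf ε M θ k G hε _ hε0 hM hθ hθ1 hk hgood
    have hG := fun j => (hgood j).finite (hε j) hM hDt
    have hfam : ∀ j, IsBallFamily D (hG j).toFinset (fun x => ε j • x)
        (fun _ => dyadicRadius (ε j) θ M 0) := fun j =>
      (hgood j).isBallFamily (hG j) (hε j) (fun _ _ => dyadicRadius_pos (hε j) hM hθ _)
        fun _ _ => (dyadicRadius_le (hε j) hM hθ _).trans (scaled_radius_le (hε j) hM hθ1)
    refine ⟨modifiedSeq ε θ M hG (fun _ _ => 0) u,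
      isModification_modifiedSeq hq hD hKt hK hu hSt hB hw hε hε0 hM hθ hG _ hfam, fun j => ?_,
      equiIntegrableGrad_modified hq hD hKt hK hu hfam hSt hB he⟩
    have hUD := (hfam j).iUnion_wideRing_subset
    have hUm := IsBallFamily.measurableSet_iUnion_wideRing (hG j).toFinset (fun x => ε j • x)
      (fun _ => dyadicRadius (ε j) θ M 0)
    -- the factor `θⁿ` comes from comparison with the disjoint balls of radius `ε / M` in `D`
    have hUv := ((hgood j).isBallFamily (hG j) (hε j) (ρ := fun _ => ε j / M)
      (fun _ _ => by have := hε j; positivity) fun _ _ => le_rfl).volume_iUnion_wideRing_le hθ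
      (r := fun _ => dyadicRadius (ε j) θ M 0)
      fun _ _ => (dyadicRadius_zero (ε j) θ M).le.trans (mul_div_assoc _ _ _).le
    have hUδ := hδ k j _ hUm
    rw [inter_eq_self_of_subset_left hUD] at hUδ
    exact abs_le_add_joiningConst_div hLt hDt hSt hk (by positivity) (hδ0 k) hUv
      ((lintegral_mono_set hUD).trans (hB j)) hUδ
      (enorm_energy_sub_le hq hD hDt hK (hu j) (hfam j) hf)
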